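/- **Model.** Fix $N\in\mathbb N$ queues and a finite schedule set $\Pi\subset\mathbb Z_+^N$ such that: (A1) $d\in\Pi$, $d'\in\mathbb Z_+^N$, $d'\le d$ imply $d'\in\Pi$; (A2) there is $c>0$ with $c\,e^{(i)}\in\Pi$ for every $i$; (A3) $\Pi$ has at least two distinct maximal elements (for the componentwise order). Let $F$ be the set of maximal elements of $\Pi$, and let $\Lambda=\{\lambda\in\mathbb R_+^N:\ \lambda<y \text{ in every coordinate for some } y\in\mathrm{conv}(\Pi)\}$. A channel $\mathcal C=(\mathcal X,\mathcal Y,C)$ consists of finite alphabets $\mathcal X,\mathcal Y$ and a row-stochastic matrix $C\in\mathbb R^{\mathcal X\times\mathcal Y}$; it is *informative* if two rows of $C$ differ. For $k,v\in\mathbb Z_+$, an encoding policy with $k$ bits of memory (with feedback of the receiver memory) is a function $\phi(q,a,m_e,m_r,u)$ with values in $\mathcal X\times\{0,1\}^k$, and an allocation policy with $v$ bits of memory is a pair of functions $\psi_a(y,m_r,u)\in\Pi$, $\psi_m(y,m_r,u)\in\{0,1\}^v$; here $q\in\mathbb Z_+^N$, $a\in\{0,1\}^N$, $m_e\in\{0,1\}^k$,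 $m_r\in\{0,1\}^v$, $y\in\mathcal Y$, $u\in[0,1]$. For an arrival rate vector $\lambda\in[0,1]^N$ the system state $W(t)=(Q(t),A(t),M_e(t),X(t),M_r(t))$ is the Markov chain with the following one-step transitions. Given $W(t-1)$, the variables $A(t)$ (independent Bernoulli coordinates with means $\lambda_i$), $U_e$ and $U_r$ (uniform on $[0,1]$) are independent, $$(X(t),M_e(t))=\phi(Q(t-1),A(t-1),M_e(t-1),M_r(t-1),U_e),$$ the messages $Y(t-1)$ and $Y(t)$ are outputs of the channel on the inputs $X(t-1)$ and $X(t)$, that is, $Y(t-1)$ has law $C_{X(t-1),\cdot}$ and $Y(t)$ has law $C_{X(t),\cdot}$, all channel noise being independent, and $$D(t)=\psi_a(Y(t),M_r(t-1),U_r),\quad M_r(t)=\psi_m(Y(t-1),M_r(t-1),U_r),\quad Q(t)=(Q(t-1)-D(t))^++A(t).$$ The pair $(\phi,\psi)$ *stabilizes* the system under $\lambda$ if this chain is irreducible up to transient states and positive recurrent: there is a state whose expected hitting time (at times $\ge1$) is finite from every initial state, that state included. Let $\tilde\Lambda(\phi,\psi)\subseteq[0,1]^N$ be the set of the $\lambda$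 under which $(\phi,\psi)$ stabilizes the system, $$\rho^*(\phi,\psi,\mathcal C)=\sup\{\rho\ge0:\rho\Lambda\subseteq\tilde\Lambda(\phi,\psi)\},\qquad \rho^*_{k,v}(\mathcal C)=\sup_{\phi,\psi}\rho^*(\phi,\psi,\mathcal C),$$ the last supremum being over all encoding policies with $k$ bits and allocation policies with $v$ bits of memory. For $k=\infty$ or $v=\infty$ the capacity factor is the limit of those with finite memory sizes; $\rho^*_{\infty,\infty}$ is the common value of the two iterated limits. **Theorem.** Let $\Pi$ satisfy (A1)-(A3) and let $\mathcal C$ be informative. In each item the existence of the limits defining $\rho^*_{k,v}(\mathcal C)$ for $k=\infty$ or $v=\infty$ is part of the claim. 1. $\rho^*_{k,0}(\mathcal C)=\rho^*_{0,0}(\mathcal C)$ for all $k\in\mathbb Z_+\cup\{\infty\}$. 2. Let $K(\Pi,\mathcal X)=\lceil\log_2|F|+\log_2|\mathcal X|\rceil$. For every integer $v\ge1$, $\rho^*_{k,v}(\mathcal C)=\rho^*_{K(\Pi,\mathcal X),v}(\mathcal C)$ for all $k\in\mathbb Z_+\cup\{\infty\}$ with $k\ge K(\Pi,\mathcal X)$.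 3. If $\Pi\subseteq\{0,1\}^N$, so that every vector of $\Lambda$ is a rate vector of Bernoulli arrivals, then $\rho^*_{k,\infty}(\mathcal C)=1$ for all $k\in\mathbb Z_+\cup\{\infty\}$. 4. Suppose that for some $\varepsilon\in(0,1)$ one can write $C=\varepsilon C^0+(1-\varepsilon)C^1$ with row-stochastic matrices $C^0,C^1$ such that the rows of $C^0$ are identical, all entries of $C^0$ are positive, and every column of $C^1$ has a zero entry. Then $\rho^*_{k,v}(\mathcal C)<1$ for all $v\in\mathbb Z_+$ and all $k\in\mathbb Z_+\cup\{\infty\}$. -/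

import Mathlib

open Filter Topology MeasureTheory
open scoped ENNReal NNReal

namespace SPII

/-! ### Positive recurrence of countable-state Markov chains -/

/-- `survival P z n w` is the probability that the chain with transition probabilities `P`, started
at `w`, does not visit `z` at any of the times `1, …, n`. -/
noncomputable def survival {S : Type*} (P : S → S → ℝ≥0∞) (z : S) : ℕ → S → ℝ≥0∞
  | 0, _ => 1
  | n + 1, w => ∑' s : {s : S // s ≠ z}, P w s * survival P z n s

/-- The mean of `τ = inf {n ≥ 1 : the chain is at z at time n}` for the chain started at `w`,
written as `∑ₙ ℙ_w (τ > n)`. For `w = z` this is the mean return time to `z`. -/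
noncomputable def meanHittingTime {S : Type*} (P : S → S → ℝ≥0∞) (z w : S) : ℝ≥0∞ :=
  ∑' n : ℕ, survival P z n w

/-- The chain is irreducible, up to inessential (transient) states, and positive recurrent: some
state `z` is hit in finite mean time from every state, `z` itself included. Equivalently, there is
exactly one closed communicating class, it is positive recurrent, and it is entered in finite mean
time from every initial state. For a chain that is irreducible on its whole state space this is
ordinary positive recurrence. -/
def IsPositiveRecurrentChain {S : Type*} (P : S → S → ℝ≥0∞) : Prop :=
  ∃ z : S, ∀ w : S, meanHittingTime P z w < ∞

/-! ### Schedule sets -/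

/-- The schedule set contains, with each schedule, every smaller non-negative integer vector. -/
def IsMonotone {N : ℕ} (Sch : Finset (Fin N → ℕ)) : Prop :=
  ∀ d ∈ Sch, ∀ d' : Fin N → ℕ, d' ≤ d → d' ∈ Sch

/-- Each queue can be given a positive service rate: `c e⁽ⁱ⁾` is a schedule for each `i`. -/
def ServesEachQueue {N : ℕ} (Sch : Finset (Fin N → ℕ)) : Prop :=
  ∃ c : ℕ, 0 < c ∧ ∀ i : Fin N, (Pi.single i c : Fin N → ℕ) ∈ Sch

/-- The set of maximal elements of the schedule set, for the componentwise order. -/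
def maximalSchedules {N : ℕ} (Sch : Finset (Fin N → ℕ)) : Set (Fin N → ℕ) :=
  {d | Maximal (fun e => e ∈ Sch) d}

/-- There are at least two distinct maximal schedules. -/
def HasTwoMaximal {N : ℕ} (Sch : Finset (Fin N → ℕ)) : Prop :=
  ∃ d₁ ∈ maximalSchedules Sch, ∃ d₂ ∈ maximalSchedules Sch, d₁ ≠ d₂

/-- The maximum capacity region `Λ`: the vectors in the non-negative orthant which are strictly
dominated by some element of the convex hull of the schedule set. -/
def maxCapacityRegion {N : ℕ} (Sch : Finset (Fin N → ℕ)) : Set (Fin N → ℝ) :=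
  {r | (∀ i, 0 ≤ r i) ∧
    ∃ y ∈ convexHull ℝ ((fun (d : Fin N → ℕ) (i : Fin N) => (d i : ℝ)) '' (Sch : Set (Fin N → ℕ))),
      ∀ i, r i < y i}

/-- The encoder memory threshold `⌈log₂ |F| + log₂ |𝒳|⌉ = ⌈log₂ (|F| |𝒳|)⌉`, where `F` is the set
of maximal schedules and `𝒳` the input alphabet. -/
noncomputable def memoryThreshold {N : ℕ} (Sch : Finset (Fin N → ℕ)) (X : Type*) [Fintype X] : ℕ :=
  Nat.clog 2 ((maximalSchedules Sch).ncard * Fintype.card X)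

/-! ### Channels -/

/-- A channel with input alphabet `X` and output alphabet `Y`: a row-stochastic matrix. -/
structure Channel (X Y : Type*) [Fintype Y] where
  /-- the channel matrix; `prob x y` is the probability of output `y` on input `x` -/
  prob : Matrix X Y ℝ
  prob_nonneg : ∀ x y, 0 ≤ prob x y
  sum_prob : ∀ x, ∑ y, prob x y = 1

/-- The channel matrix has two distinct rows. -/
def Channel.Informative {X Y : Type*} [Fintype Y] (C : Channel X Y) : Prop :=
  ∃ x x' : X, C.prob x ≠ C.prob x'

/-- `C = ε C⁰ + (1 - ε) C¹` with `C⁰`, `C¹` row-stochastic, where the rows of `C⁰` are identical,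
each column of `C¹` has a zero entry, and all entries of `C⁰` are positive. -/
def Channel.PositivelyMajorizing {X Y : Type*} [Fintype Y] (C : Channel X Y) (ε : ℝ) : Prop :=
  ∃ C₀ C₁ : Channel X Y,
    C.prob = ε • C₀.prob + (1 - ε) • C₁.prob ∧
    (∀ x x', C₀.prob x = C₀.prob x') ∧
    (∀ y, ∃ x, C₁.prob x y = 0) ∧
    (∀ x y, 0 < C₀.prob x y)

/-! ### Policies -/

/-- The states of a memory of `k` bits. -/
abbrev Memory (k : ℕ) : Type := Fin k → Bool

/-- An encoding policy with `k` bits of memory, under feedback of the `v`-bit receiver memory: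
`(X(t), Mₑ(t)) = φ (Q(t-1), A(t-1), Mₑ(t-1), Mᵣ(t-1), Uₑ(t-1))`. -/
structure EncodingPolicy (N : ℕ) (X : Type*) (k v : ℕ) where
  /-- the new signal and encoder memory, from the queues, the last arrivals, the encoder memory,
  the receiver memory and the randomization variable -/
  encode : (Fin N → ℕ) → (Fin N → Bool) → Memory k → Memory v → unitInterval → X × Memory k
  measurable_encode : ∀ q a m r p, MeasurableSet {u | encode q a m r u = p}

/-- An allocation policy with `v` bits of memory:
`D(t) = ψₐ (Y(t), Mᵣ(t-1), Uᵣ(t-1))` and `Mᵣ(t) = ψₘ (Y(t-1), Mᵣ(t-1), Uᵣ(t-1))`. -/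
structure AllocationPolicy {N : ℕ} (Sch : Finset (Fin N → ℕ)) (Y : Type*) (v : ℕ) where
  /-- the allocation vector, from the message, the receiver memory and the randomization -/
  alloc : Y → Memory v → unitInterval → (Fin N → ℕ)
  /-- the new receiver memory, from the previous message, the memory and the randomization -/
  update : Y → Memory v → unitInterval → Memory v
  alloc_mem : ∀ y r u, alloc y r u ∈ Sch
  measurable_alloc : ∀ y r d, MeasurableSet {u | alloc y r u = d}
  measurable_update : ∀ y r r', MeasurableSet {u | update y r u = r'}

/-! ### The system state and its Markov chain -/

/-- The system state `W(t) = (Q(t), A(t), Mₑ(t), X(t), Mᵣ(t))`. -/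
structure State (N : ℕ) (X : Type*) (k v : ℕ) where
  /-- queue lengths -/
  queue : Fin N → ℕ
  /-- arrivals of the last slot -/
  arrival : Fin N → Bool
  /-- encoder memory -/
  encMem : Memory k
  /-- last signal sent -/
  signal : X
  /-- receiver memory -/
  recMem : Memory v

/-- The probability that independent Bernoulli variables with means `rate i` take the values
`a i`. -/
noncomputable def arrivalProb {N : ℕ} (rate : Fin N → ℝ) (a : Fin N → Bool) : ℝ≥0∞ :=
  ∏ i, if a i then ENNReal.ofReal (rate i) else ENNReal.ofReal (1 - rate i)

/-- The transition probability `ℙ (W(t) = w' | W(t-1) = w)`. Given `W(t-1) = w`, the variables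
`A(t)`, `Uₑ(t-1)`, `Uᵣ(t-1)` are independent, the latter two uniform on the unit interval; the
message `Y(t-1)` has the law of the channel output on input `X(t-1)`, and the message `Y(t)` that
of the channel output on input `X(t)`. Then
`(X(t), Mₑ(t)) = φ (Q(t-1), A(t-1), Mₑ(t-1), Mᵣ(t-1), Uₑ(t-1))`,
`D(t) = ψₐ (Y(t), Mᵣ(t-1), Uᵣ(t-1))`, `Mᵣ(t) = ψₘ (Y(t-1), Mᵣ(t-1), Uᵣ(t-1))` and
`Q(t) = (Q(t-1) - D(t))⁺ + A(t)`. In the sum, `y` is the value of `Y(t-1)` and `y'` that of `Y(t)`;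
the subtraction in `ℕ` is truncated, which is the positive part. -/
noncomputable def transitionProb {N : ℕ} {Sch : Finset (Fin N → ℕ)} {X Y : Type*} [Fintype Y]
    (C : Channel X Y) {k v : ℕ} (φ : EncodingPolicy N X k v) (ψ : AllocationPolicy Sch Y v)
    (rate : Fin N → ℝ) (w w' : State N X k v) : ℝ≥0∞ :=
  arrivalProb rate w'.arrival *
  volume {u : unitInterval |
    φ.encode w.queue w.arrival w.encMem w.recMem u = (w'.signal, w'.encMem)} *
  ∑ y : Y, ∑ y' : Y,
    ENNReal.ofReal (C.prob w.signal y) * ENNReal.ofReal (C.prob w'.signal y') *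
    volume {u : unitInterval | ψ.update y w.recMem u = w'.recMem ∧
      ∀ i, w'.queue i = (w.queue i - ψ.alloc y' w.recMem u i) + (w'.arrival i).toNat}

/-! ### Capacity region and capacity factor -/

/-- The capacity region of a policy pair: the arrival rate vectors (of Bernoulli arrivals) under
which the chain of system states is stable, that is, positive recurrent. -/
def capacityRegion {N : ℕ} {Sch : Finset (Fin N → ℕ)} {X Y : Type*} [Fintype Y]
    (C : Channel X Y) {k v : ℕ} (φ : EncodingPolicy N X k v) (ψ : AllocationPolicy Sch Y v) :
    Set (Fin N → ℝ) :=
  {rate | (∀ i, 0 ≤ rate i ∧ rate i ≤ 1) ∧ IsPositiveRecurrentChain (transitionProb C φ ψ rate)}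

/-- The capacity factor of a channel under a policy pair: the supremum of the `ρ ≥ 0` such that
`ρ Λ` is contained in the capacity region of the pair. -/
noncomputable def policyCapacityFactor {N : ℕ} {Sch : Finset (Fin N → ℕ)} {X Y : Type*} [Fintype Y]
    (C : Channel X Y) {k v : ℕ} (φ : EncodingPolicy N X k v) (ψ : AllocationPolicy Sch Y v) :
    ℝ≥0∞ :=
  ⨆ (ρ : ℝ≥0) (_ : ∀ r ∈ maxCapacityRegion Sch, (ρ : ℝ) • r ∈ capacityRegion C φ ψ), (ρ : ℝ≥0∞)

/-- The `(k, v)`-capacity factor of a channel, for finite `k` and `v`. -/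
noncomputable def capacityFactor {N : ℕ} (Sch : Finset (Fin N → ℕ)) {X Y : Type*} [Fintype Y]
    (C : Channel X Y) (k v : ℕ) : ℝ≥0∞ :=
  ⨆ (φ : EncodingPolicy N X k v) (ψ : AllocationPolicy Sch Y v), policyCapacityFactor C φ ψ

/-- `r` is the `(k, v)`-capacity factor, for extended non-negative integers `k` and `v`: for an
infinite memory size, the limit of the capacity factors for finite sizes exists and is `r`; if both
are infinite, both iterated limits exist and are `r`. -/
def IsCapacityFactor {N : ℕ} (Sch : Finset (Fin N → ℕ)) {X Y : Type*} [Fintype Y]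
    (C : Channel X Y) (k v : ℕ∞) (r : ℝ≥0∞) : Prop :=
  match k, v with
  | some k, some v => capacityFactor Sch C k v = r
  | some k, none => Tendsto (fun v : ℕ => capacityFactor Sch C k v) atTop (𝓝 r)
  | none, some v => Tendsto (fun k : ℕ => capacityFactor Sch C k v) atTop (𝓝 r)
  | none, none =>
    (∃ f : ℕ → ℝ≥0∞,
      (∀ k : ℕ, Tendsto (fun v : ℕ => capacityFactor Sch C k v) atTop (𝓝 (f k))) ∧
        Tendsto f atTop (𝓝 r)) ∧
    (∃ g : ℕ → ℝ≥0∞,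
      (∀ v : ℕ, Tendsto (fun k : ℕ => capacityFactor Sch C k v) atTop (𝓝 (g v))) ∧
        Tendsto g atTop (𝓝 r))

end SPII

/-! Everything reduces to a finite control problem attached to the receiver. For fixed `ψ`, the pair
(last signal, receiver memory) is a controlled chain: the action is the next signal, the reward is
the mean service offered, weighted by a vector `q`. The condition `Achieves C ψ ρ` says that over
some horizon `n` the optimal reward `value` is at least `n * ρ` times the weight of every schedule,
for all `q ≥ 0` at once.

Necessity (`achieves_of_smul_mem_capacityRegion`): in a positive recurrent system started empty,
mean queue lengths are o(n), while no encoder extracts more service than `value`. Hence the load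
cannot exceed the value per slot. Stability also forces a memory state reachable from all others,
and Bernoulli rates force `ρ * d i ≤ 1`. These conditions do not mention the encoder.

Sufficiency (`exists_policy_of_achieves`): the encoder plays the optimal signal for weights equal to
the present queues, and random signals when queues are short. The Lyapunov function is half the sum
of squared queues minus a discounted value. The Bellman equation turns its drift into load minus `(1
- β) * value`, up to a constant, and this is negative for long queues.

So encoder memory only serves to recall the last signal, which drives the next move of the receiver
memory and is not an input of the encoder. It is irrelevant for a memoryless receiver (item 1), and
the threshold number of bits can store it (item 2).

Item 3: the receiver keeps a schedule until it sees a long run of one message `y₀`, then redraws.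
The encoder sends the signal with the larger probability of `y₀` to force a change and the other one
to hold. Waiting times for the run differ by an exponential factor, so the wanted schedule is in use
most of the time. Reading every second message makes the last signal irrelevant.

Item 4: all channel entries exceed some `c > 0`, so all controls induce comparable transitions, and
their stationary laws are comparable with a constant depending only on `c` and the number of memory
states (`IsComparableFlow.comparable`). A factor near one would need, for each queue, a stationary
law giving it maximal service almost always. But a memory frequent under one law is frequent under
all, and at each memory some queue loses, since no schedule is best for all queues. -/

namespace SPII

/-! ### Countable-state Markov chains -/

section Chain

variable {S : Type*} {P : S → S → ℝ≥0∞} {z : S}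

/-- The expectation of `f` after one step of the chain. -/
noncomputable def stepMean (P : S → S → ℝ≥0∞) (f : S → ℝ≥0∞) (w : S) : ℝ≥0∞ :=
  ∑' s, P w s * f s

/-- The expectation of `f` after one step of the chain, on the event that the step avoids `z`. -/
noncomputable def tabooMean (P : S → S → ℝ≥0∞) (z : S) (f : S → ℝ≥0∞) (w : S) : ℝ≥0∞ :=
  ∑' s : {s : S // s ≠ z}, P w s * f s

theorem survival_succ (n : ℕ) (w : S) :
    survival P z (n + 1) w = tabooMean P z (survival P z n) w := rfl

theorem tabooMean_add_eq_stepMean (f : S → ℝ≥0∞) (w : S) :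
    tabooMean P z f w + P w z * f z = stepMean P f w := by
  classical
  have h := ENNReal.summable.tsum_add_tsum_compl (f := fun s => P w s * f s) (s := {s | s ≠ z})
    ENNReal.summable
  have hc : ({s | s ≠ z} : Set S)ᶜ = {z} := by ext s; simp
  rw [hc] at h
  rw [stepMean, ← h, tabooMean]
  congr 1
  exact (tsum_singleton z (fun s => P w s * f s)).symm

theorem tabooMean_le_stepMean (f : S → ℝ≥0∞) (w : S) : tabooMean P z f w ≤ stepMean P f w :=
  tabooMean_add_eq_stepMean (P := P) (z := z) f w ▸ le_self_add

theorem tabooMean_mono {f g : S → ℝ≥0∞} {w : S} (h : ∀ s, P w s ≠ 0 → f s ≤ g s) :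
    tabooMean P z f w ≤ tabooMean P z g w := by
  refine ENNReal.tsum_le_tsum fun s => ?_
  by_cases hs : P w s = 0
  · simp [hs]
  · gcongr
    exact h s hs

theorem stepMean_mono {f g : S → ℝ≥0∞} {w : S} (h : ∀ s, P w s ≠ 0 → f s ≤ g s) :
    stepMean P f w ≤ stepMean P g w := by
  refine ENNReal.tsum_le_tsum fun s => ?_
  by_cases hs : P w s = 0
  · simp [hs]
  · gcongr
    exact h s hs

theorem tabooMean_add (f g : S → ℝ≥0∞) (w : S) :
    tabooMean P z (fun s => f s + g s) w = tabooMean P z f w + tabooMean P z g w := by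
  simp only [tabooMean, mul_add, ENNReal.tsum_add]

theorem tabooMean_const_mul (c : ℝ≥0∞) (f : S → ℝ≥0∞) (w : S) :
    tabooMean P z (fun s => c * f s) w = c * tabooMean P z f w := by
  simp only [tabooMean, ← ENNReal.tsum_mul_left]
  exact tsum_congr fun s => by ring

theorem tabooMean_sum {ι : Type*} (t : Finset ι) (f : ι → S → ℝ≥0∞) (w : S) :
    tabooMean P z (fun s => ∑ i ∈ t, f i s) w = ∑ i ∈ t, tabooMean P z (f i) w := by
  classical
  induction t using Finset.induction_on with
  | empty => simp [tabooMean]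
  | insert i t hi ih => simp only [Finset.sum_insert hi, tabooMean_add, ih]

theorem survival_le_one (hP : ∀ w, ∑' s, P w s = 1) (n : ℕ) (w : S) : survival P z n w ≤ 1 := by
  induction n generalizing w with
  | zero => exact le_rfl
  | succ n ih =>
    refine (tabooMean_le_stepMean _ w).trans ?_
    refine (stepMean_mono (g := fun _ => 1) fun s _ => ih s).trans ?_
    simp [stepMean, hP]

theorem survival_antitone (hP : ∀ w, ∑' s, P w s = 1) (w : S) :
    Antitone fun n => survival P z n w := by
  refine antitone_nat_of_succ_le fun n => ?_
  induction n generalizing w with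
  | zero => exact survival_le_one hP 1 w
  | succ n ih => exact tabooMean_mono fun s _ => ih s

/-- A function that decreases by at least one in the mean, on the event that the chain avoids `z`,
bounds the mean hitting time of `z`. -/
theorem meanHittingTime_le_of_tabooMean_add_one_le {U : S → ℝ≥0∞}
    (hU : ∀ w, tabooMean P z U w + 1 ≤ U w) (w : S) : meanHittingTime P z w ≤ U w := by
  have key : ∀ n w, ∑ j ∈ Finset.range n, survival P z j w ≤ U w := by
    intro n
    induction n with
    | zero => simp
    | succ n ih =>
      intro w
      rw [Finset.sum_range_succ']
      simp only [survival_succ]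
      rw [← tabooMean_sum]
      refine le_trans ?_ (hU w)
      exact add_le_add (tabooMean_mono fun s _ => ih s) le_rfl
  rw [meanHittingTime, ENNReal.tsum_eq_iSup_nat]
  exact iSup_le fun n => key n w

/-- A step into `z` lowers the survival probability at time 1; a step to another state inherits the
loss of that state one time unit later. -/
theorem survival_lt_one_of_step (hP : ∀ w, ∑' s, P w s = 1) {w s : S} (hs : P w s ≠ 0)
    (h : s = z ∨ ∃ n, survival P z n s < 1) : ∃ n, survival P z n w < 1 := by
  have hfin : ∀ w s, P w s ≠ ∞ := fun w s =>
    ne_top_of_le_ne_top ENNReal.one_ne_top (hP w ▸ ENNReal.le_tsum s)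
  rcases eq_or_ne s z with rfl | hsz
  · refine ⟨1, ?_⟩
    have h1 := tabooMean_add_eq_stepMean (P := P) (z := s) (fun _ => 1) w
    have h2 : stepMean P (fun _ => 1) w = 1 := by simp [stepMean, hP]
    rw [h2, mul_one] at h1
    change tabooMean P s (fun _ => 1) w < 1
    exact (ENNReal.lt_add_right (ne_top_of_le_ne_top ENNReal.one_ne_top
      (le_self_add.trans h1.le)) hs).trans_eq h1
  · obtain ⟨n, hn⟩ := h.resolve_left hsz
    refine ⟨n + 1, ?_⟩
    have h2 : stepMean P (fun _ => 1) w = 1 := by simp [stepMean, hP]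
    refine lt_of_lt_of_le ?_ (h2.le.trans' (tabooMean_le_stepMean (z := z) (fun _ => 1) w))
    rw [survival_succ]
    refine ENNReal.tsum_lt_tsum (i := ⟨s, hsz⟩) ?_ (fun t => ?_) ?_
    · exact ne_top_of_le_ne_top ENNReal.one_ne_top
        ((tabooMean_le_stepMean _ w).trans ((stepMean_mono (g := fun _ => 1)
          fun s _ => survival_le_one hP n s).trans h2.le))
    · gcongr
      exact survival_le_one hP n t
    · exact ENNReal.mul_lt_mul_right hs (hfin w s) hn

theorem survival_lt_one_of_transGen (hP : ∀ w, ∑' s, P w s = 1) {w : S}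
    (h : Relation.TransGen (fun w s => P w s ≠ 0) w z) : ∃ n, survival P z n w < 1 := by
  induction h using Relation.TransGen.head_induction_on with
  | single h => exact survival_lt_one_of_step hP h (Or.inl rfl)
  | head h _ ih => exact survival_lt_one_of_step hP h (Or.inr ih)

/-- The Foster criterion, with drift `-1` off a finite set from which `z` can be reached. The drift
is only required on a set `G` which the chain enters in one step. -/
theorem meanHittingTime_lt_top_of_drift (hP : ∀ w, ∑' s, P w s = 1) {V : S → ℝ≥0∞}
    (hV : ∀ w, V w < ∞) (hPV : ∀ w, stepMean P V w < ∞) {G K : Set S} (hK : K.Finite)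
    (hG : ∀ w s, P w s ≠ 0 → s ∈ G) (hdrift : ∀ w ∈ G, w ∉ K → stepMean P V w + 1 ≤ V w)
    (hreach : ∀ w ∈ K, ∃ n, survival P z n w < 1) (w : S) : meanHittingTime P z w < ∞ := by
  classical
  choose! nn hnn using hreach
  -- Survival decreases in time and `K` is finite, so one horizon `m` and one margin `θ` serve all
  -- of `K`.
  obtain ⟨m, hm⟩ : ∃ m, ∀ w ∈ K, survival P z m w < 1 := by
    refine ⟨∑ w ∈ hK.toFinset, nn w, fun w hw => ?_⟩
    refine lt_of_le_of_lt (survival_antitone hP w ?_) (hnn w hw)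
    exact Finset.single_le_sum (f := nn) (fun _ _ => Nat.zero_le _) (hK.mem_toFinset.2 hw)
  obtain ⟨θ, hθ0, hθ⟩ : ∃ θ : ℝ≥0∞, θ ≠ 0 ∧ ∀ w ∈ K, survival P z m w + θ ≤ 1 := by
    refine ⟨hK.toFinset.inf fun w => 1 - survival P z m w, ?_, fun w hw => ?_⟩
    · refine pos_iff_ne_zero.1 ((Finset.lt_inf_iff (by simp)).2 fun w hw => ?_)
      exact tsub_pos_of_lt (hm w (hK.mem_toFinset.1 hw))
    · calc _ ≤ survival P z m w + (1 - survival P z m w) := by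
            gcongr
            exact Finset.inf_le (hK.mem_toFinset.2 hw)
        _ = 1 := add_tsub_cancel_of_le (hm w hw).le
  set b : ℝ≥0∞ := ∑ w ∈ hK.toFinset, stepMean P V w with hb
  have hbtop : b ≠ ∞ := (ENNReal.sum_lt_top.2 fun w _ => hPV w).ne
  set θ' := min θ 1 with hθ'
  have hθ'0 : θ' ≠ 0 := by simp [hθ', hθ0]
  have hθ't : θ' ≠ ∞ := ne_top_of_le_ne_top ENNReal.one_ne_top (min_le_right _ _)
  -- On `K` the function `h` below falls by at least `θ'`; this multiple of it pays for `stepMean P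
  -- V` there and leaves one.
  set c : ℝ≥0∞ := (b + 1) / θ' with hc
  have hct : c ≠ ∞ := ENNReal.div_ne_top (by simp [hbtop]) hθ'0
  have hcθ : c * θ' = b + 1 := ENNReal.div_mul_cancel hθ'0 hθ't
  -- The mean of the hitting time truncated at `m`. By `hh1` its taboo mean falls by `1 - survival P
  -- z m w`.
  set h : S → ℝ≥0∞ := fun w => ∑ j ∈ Finset.range m, survival P z j w with hh
  have hh1 : ∀ w, tabooMean P z h w + 1 = h w + survival P z m w := by
    intro w
    rw [hh, tabooMean_sum]
    simp only [← survival_succ]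
    rw [← Finset.sum_range_succ, Finset.sum_range_succ']
    rfl
  have hhtop : ∀ w, h w ≠ ∞ := fun w => (ENNReal.sum_lt_top.2 fun j _ =>
    (survival_le_one hP j w).trans_lt ENNReal.one_lt_top).ne
  have hh2 : ∀ w, tabooMean P z h w ≤ h w := by
    intro w
    have := (hh1 w).le.trans (add_le_add le_rfl (survival_le_one hP m w))
    exact (ENNReal.add_le_add_iff_right ENNReal.one_ne_top).1 this
  have hh3 : ∀ w ∈ K, tabooMean P z h w + θ' ≤ h w := by
    intro w hw
    have h1 : survival P z m w + θ' ≤ 1 :=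
      (add_le_add le_rfl (min_le_left _ _)).trans (hθ w hw)
    have : tabooMean P z h w + θ' + 1 ≤ h w + 1 := by
      calc _ = h w + (survival P z m w + θ') := by rw [add_right_comm, hh1, add_assoc]
        _ ≤ _ := by gcongr
    exact (ENNReal.add_le_add_iff_right ENNReal.one_ne_top).1 this
  set U : S → ℝ≥0∞ := fun w => V w + c * h w with hU
  have hUtop : ∀ w, U w ≠ ∞ := fun w =>
    ENNReal.add_ne_top.2 ⟨(hV w).ne, ENNReal.mul_ne_top hct (hhtop w)⟩
  have hTU : ∀ w, tabooMean P z U w = tabooMean P z V w + c * tabooMean P z h w := by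
    intro w
    rw [hU, tabooMean_add, tabooMean_const_mul]
  have hdr : ∀ w, w ∈ G ∨ w ∈ K → tabooMean P z U w + 1 ≤ U w := by
    intro w hw
    rw [hTU]
    by_cases hwK : w ∈ K
    · have h1 : tabooMean P z V w ≤ b :=
        (tabooMean_le_stepMean _ w).trans (Finset.single_le_sum (f := stepMean P V)
          (fun _ _ => zero_le) (hK.mem_toFinset.2 hwK))
      calc _ ≤ b + c * tabooMean P z h w + 1 := by gcongr
        _ = c * (tabooMean P z h w + θ') := by rw [mul_add, hcθ]; ring
        _ ≤ c * h w := by gcongr; exact hh3 w hwK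
        _ ≤ U w := le_add_self
    · calc _ = (tabooMean P z V w + 1) + c * tabooMean P z h w := by ring
        _ ≤ (stepMean P V w + 1) + c * h w := by
          gcongr
          · exact tabooMean_le_stepMean _ w
          · exact hh2 w
        _ ≤ U w := add_le_add (hdrift w (hw.resolve_right hwK) hwK) le_rfl
  -- Off `G ∪ K` no drift is assumed. The chain enters `G` in one step, so one plus the mean of `U`
  -- after that step is a valid bound.
  set U' : S → ℝ≥0∞ := fun w => if w ∈ G ∨ w ∈ K then U w else tabooMean P z U w + 1 with hU'
  have hTU' : ∀ w, tabooMean P z U' w ≤ tabooMean P z U w := fun w =>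
    tabooMean_mono fun s hs => by simp [hU', hG w s hs]
  have hfin : ∀ w, tabooMean P z U w ≠ ∞ := by
    intro w
    rw [hTU]
    exact ENNReal.add_ne_top.2 ⟨ne_top_of_le_ne_top (hPV w).ne (tabooMean_le_stepMean _ w),
      ENNReal.mul_ne_top hct (ne_top_of_le_ne_top (hhtop w) (hh2 w))⟩
  refine (meanHittingTime_le_of_tabooMean_add_one_le (U := U') (fun w => ?_) w).trans_lt ?_
  · refine (add_le_add (hTU' w) le_rfl).trans ?_
    simp only [hU']
    split_ifs with hw
    · exact hdr w hw
    · exact le_rfl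
  · simp only [hU']
    split_ifs
    · exact (hUtop w).lt_top
    · exact (ENNReal.add_ne_top.2 ⟨hfin w, ENNReal.one_ne_top⟩).lt_top

/-- A state with finite mean hitting time from `w` can be reached from `w`. -/
theorem of_meanHittingTime_lt_top (hP : ∀ w, ∑' s, P w s = 1) {R : S → Prop} (hz : R z)
    (hR : ∀ w s, P w s ≠ 0 → R s → R w) {w : S} (hw : meanHittingTime P z w < ∞) : R w := by
  by_contra hRw
  -- Successors of a state outside `R` are outside `R`, so from there `z` is never hit and the mean
  -- hitting time diverges.
  have key : ∀ n w, ¬ R w → survival P z n w = 1 := by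
    intro n
    induction n with
    | zero => intro w _; rfl
    | succ n ih =>
      intro w hRw
      have hzero : P w z = 0 := by
        by_contra h0
        exact hRw (hR w z h0 hz)
      have h1 := tabooMean_add_eq_stepMean (P := P) (z := z) (fun _ => 1) w
      rw [hzero, zero_mul, add_zero] at h1
      have h2 : stepMean P (fun _ => 1) w = 1 := by simp [stepMean, hP]
      rw [survival_succ, ← h2, ← h1]
      refine le_antisymm (tabooMean_mono fun s hs => ?_) (tabooMean_mono fun s hs => ?_)
      · exact survival_le_one hP n s
      · exact (ih s fun hs' => hRw (hR w s hs hs')).ge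
  refine hw.ne ?_
  simp only [meanHittingTime, fun n => key n w hRw]
  exact ENNReal.tsum_const_eq_top_of_ne_zero one_ne_zero

/-- Decompose at the last visit to `z` up to time `n`: if it was `i` steps ago, `f` is now at most
`f z + i`, and this has probability at most `survival P z i z`. The first term covers the absence of
any visit. -/
theorem iterate_stepMean_le (hP : ∀ w, ∑' s, P w s = 1) {f : S → ℝ≥0∞}
    (hf : ∀ w s, P w s ≠ 0 → f s ≤ f w + 1) (n : ℕ) (w : S) :
    (stepMean P)^[n] f w ≤
      (f w + n) * survival P z n w + ∑ i ∈ Finset.range n, (f z + i) * survival P z i z := by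
  induction n generalizing w with
  | zero => simp [survival]
  | succ n ih =>
    rw [Function.iterate_succ_apply', ← tabooMean_add_eq_stepMean (z := z)]
    set c := ∑ i ∈ Finset.range n, (f z + i) * survival P z i z with hc
    have h1 : tabooMean P z ((stepMean P)^[n] f) w ≤
        (f w + (n + 1 : ℕ)) * survival P z (n + 1) w + c * tabooMean P z (fun _ => 1) w := by
      rw [survival_succ, ← tabooMean_const_mul, ← tabooMean_const_mul, ← tabooMean_add]
      refine tabooMean_mono fun s hs => (ih s).trans ?_
      rw [mul_one]
      gcongr ?_ * _ + _
      calc f s + n ≤ f w + 1 + n := by gcongr; exact hf w s hs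
        _ = _ := by push_cast; ring
    have h2 := tabooMean_add_eq_stepMean (P := P) (z := z) (fun _ => 1) w
    have h3 : stepMean P (fun _ => 1) w = 1 := by simp [stepMean, hP]
    rw [h3, mul_one] at h2
    rw [Finset.sum_range_succ, ← hc]
    set c' := c + (f z + n) * survival P z n z with hc'
    have h4 : (stepMean P)^[n] f z ≤ c' := (ih z).trans (by rw [hc', add_comm])
    calc _ ≤ ((f w + (n + 1 : ℕ)) * survival P z (n + 1) w + c * tabooMean P z (fun _ => 1) w)
          + P w z * c' := by gcongr
      _ ≤ ((f w + (n + 1 : ℕ)) * survival P z (n + 1) w + c' * tabooMean P z (fun _ => 1) w)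
          + P w z * c' := by gcongr; exact le_self_add
      _ = (f w + (n + 1 : ℕ)) * survival P z (n + 1) w
          + c' * (tabooMean P z (fun _ => 1) w + P w z) := by ring
      _ = _ := by rw [h2, mul_one]

/-- Dominated convergence: each fixed term vanishes after division by `n`, and `(K + i) / n ≤ K + 1`
for `i < n`. -/
theorem tendsto_weighted_sum_div {a : ℕ → ℝ} (ha : ∀ n, 0 ≤ a n) (hs : Summable a) (K : ℝ)
    (hK : 0 ≤ K) :
    Tendsto (fun n : ℕ => (∑ i ∈ Finset.range n, (K + i) * a i) / n) atTop (𝓝 0) := by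
  have h := tendsto_tsum_of_dominated_convergence (β := ℕ) (𝓕 := atTop)
    (f := fun (n : ℕ) (i : ℕ) => if i < n then (K + i) / n * a i else 0)
    (g := fun _ => (0 : ℝ)) (bound := fun i => (K + 1) * a i) (hs.mul_left _) ?_ ?_
  · rw [tsum_zero] at h
    refine h.congr fun n => ?_
    rw [tsum_eq_sum (s := Finset.range n) (fun i hi => by
      rw [if_neg (by simpa using hi)]), Finset.sum_div]
    refine Finset.sum_congr rfl fun i hi => ?_
    rw [if_pos (by simpa using hi)]
    ring
  · intro i
    have : Tendsto (fun n : ℕ => (K + i) / n * a i) atTop (𝓝 0) := by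
      simpa using (tendsto_const_div_atTop_nhds_zero_nat (K + i)).mul_const (a i)
    refine squeeze_zero' (Eventually.of_forall fun n => ?_) (Eventually.of_forall fun n => ?_) this
    · have := ha i
      split_ifs <;> positivity
    · have := ha i
      split_ifs
      · exact le_rfl
      · positivity
  · refine Eventually.of_forall fun n i => ?_
    have := ha i
    rw [Real.norm_eq_abs, abs_of_nonneg (by split_ifs <;> positivity)]
    split_ifs with h
    · have hn : (1 : ℝ) ≤ n := by exact_mod_cast (Nat.one_le_iff_ne_zero.2 (by omega))
      have hi : (i : ℝ) ≤ n := by exact_mod_cast h.le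
      gcongr
      rw [div_le_iff₀ (by linarith)]
      nlinarith
    · positivity

/-- The mean of a function with increments at most one grows sublinearly along a positive recurrent
chain. -/
theorem tendsto_iterate_stepMean_div (hP : ∀ w, ∑' s, P w s = 1) {f : S → ℝ≥0∞}
    (hf : ∀ w s, P w s ≠ 0 → f s ≤ f w + 1) (hft : ∀ w, f w ≠ ∞)
    (hz : ∀ w, meanHittingTime P z w < ∞) (w : S) :
    (∀ n, (stepMean P)^[n] f w ≠ ∞) ∧
      Tendsto (fun n : ℕ => ((stepMean P)^[n] f w).toReal / n) atTop (𝓝 0) := by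
  have hsv : ∀ n w, survival P z n w ≠ ∞ := fun n w =>
    ne_top_of_le_ne_top ENNReal.one_ne_top (survival_le_one hP n w)
  set g : ℕ → ℝ := fun n => ((f w).toReal + n) * (survival P z n w).toReal +
    ∑ i ∈ Finset.range n, ((f z).toReal + i) * (survival P z i z).toReal with hg
  have hterm : ∀ (n : ℕ) w, (f w + n) * survival P z n w ≠ ∞ := fun n w =>
    ENNReal.mul_ne_top (by simp [hft]) (hsv n w)
  have hbd : ∀ n, (stepMean P)^[n] f w ≤ ENNReal.ofReal (g n) := by
    intro n
    refine (iterate_stepMean_le (z := z) hP hf n w).trans (le_of_eq ?_)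
    rw [ENNReal.ofReal_add (by positivity) (by positivity), ENNReal.ofReal_sum_of_nonneg
      (fun i _ => by positivity)]
    congr 1
    · rw [← ENNReal.ofReal_toReal (hterm n w), ENNReal.toReal_mul, ENNReal.toReal_add (hft w)
        (by simp)]
      simp
    · refine Finset.sum_congr rfl fun i _ => ?_
      rw [← ENNReal.ofReal_toReal (hterm i z), ENNReal.toReal_mul, ENNReal.toReal_add (hft z)
        (by simp)]
      simp
  refine ⟨fun n => ne_top_of_le_ne_top ENNReal.ofReal_ne_top (hbd n), ?_⟩
  have hg0 : ∀ n, 0 ≤ g n := fun n => by rw [hg]; positivity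
  have hlim : Tendsto (fun n : ℕ => g n / n) atTop (𝓝 0) := by
    have hsum : ∀ w, Summable fun n => (survival P z n w).toReal := fun w =>
      ENNReal.summable_toReal (hz w).ne
    have h1 : Tendsto (fun n : ℕ => ((f w).toReal / n + 1) * (survival P z n w).toReal) atTop
        (𝓝 0) := by
      simpa using ((tendsto_const_div_atTop_nhds_zero_nat (f w).toReal).add_const 1).mul
        (hsum w).tendsto_atTop_zero
    have h2 := tendsto_weighted_sum_div (fun n => ENNReal.toReal_nonneg) (hsum z) (f z).toReal
      ENNReal.toReal_nonneg
    have h3 := h1.add h2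
    rw [add_zero] at h3
    refine h3.congr' ?_
    filter_upwards [eventually_gt_atTop 0] with n hn
    have : (n : ℝ) ≠ 0 := by positivity
    rw [hg]
    field_simp
  refine squeeze_zero (fun n => by positivity) (fun n => ?_) hlim
  gcongr
  exact ENNReal.toReal_le_of_le_ofReal (hg0 n) (hbd n)

end Chain

/-! ### One step of the system -/

section Step

variable {N : ℕ} {Sch : Finset (Fin N → ℕ)} {X Y : Type*} [Fintype Y] {k v : ℕ}

/-- The probability of the arrivals `a`, as a real number. -/
def arrivalWeight (rate : Fin N → ℝ) (a : Fin N → Bool) : ℝ :=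
  ∏ i, if a i then rate i else 1 - rate i

/-- The probability that the encoder selects the signal and memory `e`. -/
noncomputable def encWeight (φ : EncodingPolicy N X k v) (w : State N X k v) (e : X × Memory k) :
    ℝ :=
  (volume {u : unitInterval | φ.encode w.queue w.arrival w.encMem w.recMem u = e}).toReal

/-- The probability that the receiver moves from memory `m` to `m'` and allocates `d`, when the
previous signal is `x` and the current one is `x'`. -/
noncomputable def jointWeight (C : Channel X Y) (ψ : AllocationPolicy Sch Y v)
    (x : X) (m : Memory v) (x' : X) (m' : Memory v) (d : Fin N → ℕ) : ℝ :=
  ∑ y, ∑ y', C.prob x y * C.prob x' y' *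
    (volume {u : unitInterval | ψ.update y m u = m' ∧ ψ.alloc y' m u = d}).toReal

/-- The probability that the receiver moves from memory `m` to `m'` when the previous signal
is `x`. -/
noncomputable def recTrans (C : Channel X Y) (ψ : AllocationPolicy Sch Y v) (x : X)
    (m m' : Memory v) : ℝ :=
  ∑ y, C.prob x y * (volume {u : unitInterval | ψ.update y m u = m'}).toReal

/-- The probability that the receiver with memory `m` allocates `d` on the signal `x`. -/
noncomputable def allocProb (C : Channel X Y) (ψ : AllocationPolicy Sch Y v) (x : X)
    (m : Memory v) (d : Fin N → ℕ) : ℝ :=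
  ∑ y, C.prob x y * (volume {u : unitInterval | ψ.alloc y m u = d}).toReal

/-- The mean service offered to queue `i` by the receiver with memory `m` on the signal `x`. -/
noncomputable def allocMean (C : Channel X Y) (ψ : AllocationPolicy Sch Y v) (x : X)
    (m : Memory v) (i : Fin N) : ℝ :=
  ∑ d ∈ Sch, allocProb C ψ x m d * d i

/-! ### Marginal laws of the receiver and the encoder in one slot -/

theorem sum_volume_toReal_eq {ι : Type*} (t : Finset ι) (E : Set unitInterval)
    (A : ι → Set unitInterval) (hA : ∀ i ∈ t, MeasurableSet (A i))
    (hd : (t : Set ι).PairwiseDisjoint A) (hE : E = ⋃ i ∈ t, A i) :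
    ∑ i ∈ t, (volume (A i)).toReal = (volume E).toReal := by
  rw [hE, measure_biUnion_finset hd hA, ENNReal.toReal_sum fun i _ => measure_ne_top _ _]

theorem pairwiseDisjoint_fiber {A B : Type*} (f : A → B) (t : Set B) (E : Set A) :
    t.PairwiseDisjoint fun b => {u | u ∈ E ∧ f u = b} := by
  intro b _ b' _ hbb'
  refine Set.disjoint_left.2 fun u hu hu' => hbb' ?_
  exact hu.2.symm.trans hu'.2

omit [Fintype Y] in
theorem sum_volume_update_and (ψ : AllocationPolicy Sch Y v) (y y' : Y) (m : Memory v)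
    (d : Fin N → ℕ) :
    ∑ m', (volume {u : unitInterval | ψ.update y m u = m' ∧ ψ.alloc y' m u = d}).toReal =
      (volume {u : unitInterval | ψ.alloc y' m u = d}).toReal := by
  refine sum_volume_toReal_eq _ _ _ (fun m' _ => ?_) ?_ ?_
  · exact (ψ.measurable_update y m m').inter (ψ.measurable_alloc y' m d)
  · have := pairwiseDisjoint_fiber (ψ.update y m) (Set.univ) {u | ψ.alloc y' m u = d}
    simpa [and_comm] using this
  · ext u; simp

omit [Fintype Y] in
theorem sum_volume_and_alloc (ψ : AllocationPolicy Sch Y v) (y y' : Y) (m m' : Memory v) :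
    ∑ d ∈ Sch, (volume {u : unitInterval | ψ.update y m u = m' ∧ ψ.alloc y' m u = d}).toReal =
      (volume {u : unitInterval | ψ.update y m u = m'}).toReal := by
  refine sum_volume_toReal_eq _ _ _ (fun d _ => ?_) ?_ ?_
  · exact (ψ.measurable_update y m m').inter (ψ.measurable_alloc y' m d)
  · exact pairwiseDisjoint_fiber (ψ.alloc y' m) _ {u | ψ.update y m u = m'}
  · ext u; simp [ψ.alloc_mem y' m u]

omit [Fintype Y] in
theorem sum_volume_update (ψ : AllocationPolicy Sch Y v) (y : Y) (m : Memory v) :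
    ∑ m', (volume {u : unitInterval | ψ.update y m u = m'}).toReal = 1 := by
  rw [sum_volume_toReal_eq Finset.univ Set.univ _ (fun m' _ => ψ.measurable_update y m m')]
  · simp
  · have := pairwiseDisjoint_fiber (ψ.update y m) Set.univ Set.univ
    simpa using this
  · ext u; simp

omit [Fintype Y] in
theorem sum_volume_alloc (ψ : AllocationPolicy Sch Y v) (y : Y) (m : Memory v) :
    ∑ d ∈ Sch, (volume {u : unitInterval | ψ.alloc y m u = d}).toReal = 1 := by
  rw [sum_volume_toReal_eq Sch Set.univ _ (fun d _ => ψ.measurable_alloc y m d)]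
  · simp
  · have := pairwiseDisjoint_fiber (ψ.alloc y m) (Sch : Set (Fin N → ℕ)) Set.univ
    simpa using this
  · ext u; simp [ψ.alloc_mem y m u]

theorem sum_encWeight [Fintype X] (φ : EncodingPolicy N X k v) (w : State N X k v) :
    ∑ e, encWeight φ w e = 1 := by
  simp only [encWeight]
  rw [sum_volume_toReal_eq Finset.univ Set.univ _ (fun e _ => φ.measurable_encode _ _ _ _ e)]
  · simp
  · have := pairwiseDisjoint_fiber (φ.encode w.queue w.arrival w.encMem w.recMem)
      Set.univ Set.univ
    simpa using this
  · ext u; simp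

variable (C : Channel X Y) (ψ : AllocationPolicy Sch Y v)

theorem recTrans_nonneg (x : X) (m m' : Memory v) : 0 ≤ recTrans C ψ x m m' :=
  Finset.sum_nonneg fun y _ => mul_nonneg (C.prob_nonneg x y) ENNReal.toReal_nonneg

theorem allocProb_nonneg (x : X) (m : Memory v) (d : Fin N → ℕ) : 0 ≤ allocProb C ψ x m d :=
  Finset.sum_nonneg fun y _ => mul_nonneg (C.prob_nonneg x y) ENNReal.toReal_nonneg

theorem allocMean_nonneg (x : X) (m : Memory v) (i : Fin N) : 0 ≤ allocMean C ψ x m i :=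
  Finset.sum_nonneg fun d _ => mul_nonneg (allocProb_nonneg C ψ x m d) (Nat.cast_nonneg _)

theorem jointWeight_nonneg (x : X) (m : Memory v) (x' : X) (m' : Memory v) (d : Fin N → ℕ) :
    0 ≤ jointWeight C ψ x m x' m' d :=
  Finset.sum_nonneg fun y _ => Finset.sum_nonneg fun y' _ =>
    mul_nonneg (mul_nonneg (C.prob_nonneg x y) (C.prob_nonneg x' y')) ENNReal.toReal_nonneg

theorem sum_recTrans (x : X) (m : Memory v) : ∑ m', recTrans C ψ x m m' = 1 := by
  simp only [recTrans]
  rw [Finset.sum_comm]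
  simp only [← Finset.mul_sum, sum_volume_update, mul_one, C.sum_prob]

theorem sum_allocProb (x : X) (m : Memory v) : ∑ d ∈ Sch, allocProb C ψ x m d = 1 := by
  simp only [allocProb]
  rw [Finset.sum_comm]
  simp only [← Finset.mul_sum, sum_volume_alloc, mul_one, C.sum_prob]

/-- One variable `u` drives update and allocation, but each marginal sees only its own message: the
memory move depends on the previous signal alone, the allocation (`sum_jointWeight_update`) on the
current one alone. -/
theorem sum_jointWeight_alloc (x : X) (m : Memory v) (x' : X) (m' : Memory v) :
    ∑ d ∈ Sch, jointWeight C ψ x m x' m' d = recTrans C ψ x m m' := by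
  simp only [jointWeight, recTrans]
  rw [Finset.sum_comm]
  refine Finset.sum_congr rfl fun y _ => ?_
  rw [Finset.sum_comm]
  simp only [← Finset.mul_sum, sum_volume_and_alloc]
  rw [← Finset.sum_mul, ← Finset.mul_sum, C.sum_prob, mul_one]

theorem sum_jointWeight_update (x : X) (m : Memory v) (x' : X) (d : Fin N → ℕ) :
    ∑ m', jointWeight C ψ x m x' m' d = allocProb C ψ x' m d := by
  simp only [jointWeight, allocProb]
  rw [Finset.sum_comm]
  have : ∀ y, ∑ m', ∑ y', C.prob x y * C.prob x' y' *
      (volume {u : unitInterval | ψ.update y m u = m' ∧ ψ.alloc y' m u = d}).toReal =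
      C.prob x y * ∑ y', C.prob x' y' * (volume {u : unitInterval | ψ.alloc y' m u = d}).toReal := by
    intro y
    rw [Finset.sum_comm, Finset.mul_sum]
    refine Finset.sum_congr rfl fun y' _ => ?_
    rw [← Finset.mul_sum, sum_volume_update_and, mul_assoc]
  simp only [this]
  rw [← Finset.sum_mul, C.sum_prob, one_mul]

theorem arrivalWeight_nonneg {rate : Fin N → ℝ} (hr : ∀ i, 0 ≤ rate i ∧ rate i ≤ 1)
    (a : Fin N → Bool) : 0 ≤ arrivalWeight rate a := by
  refine Finset.prod_nonneg fun i _ => ?_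
  split_ifs
  · exact (hr i).1
  · linarith [(hr i).2]

theorem arrivalProb_eq {rate : Fin N → ℝ} (hr : ∀ i, 0 ≤ rate i ∧ rate i ≤ 1)
    (a : Fin N → Bool) : arrivalProb rate a = ENNReal.ofReal (arrivalWeight rate a) := by
  rw [arrivalWeight, ENNReal.ofReal_prod_of_nonneg, arrivalProb]
  · exact Finset.prod_congr rfl fun i _ => by split_ifs <;> rfl
  · intro i _
    split_ifs
    · exact (hr i).1
    · linarith [(hr i).2]

theorem sum_prod_arrivals (g : Fin N → Bool → ℝ) :
    ∑ a : Fin N → Bool, ∏ i, g i (a i) = ∏ i, (g i true + g i false) := by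
  rw [← Fintype.piFinset_univ, ← Finset.prod_univ_sum]
  simp

theorem sum_arrivalWeight (rate : Fin N → ℝ) : ∑ a, arrivalWeight rate a = 1 := by
  have := sum_prod_arrivals (fun i b => if b then rate i else 1 - rate i)
  simpa [arrivalWeight] using this

theorem sum_arrivalWeight_mul (rate : Fin N → ℝ) (i : Fin N) :
    ∑ a, arrivalWeight rate a * (a i).toNat = rate i := by
  classical
  -- A factor inserted in coordinate `i` only preserves the product form.
  have := sum_prod_arrivals (fun j b => (if b then rate j else 1 - rate j) *
    (if j = i then (b.toNat : ℝ) else 1))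
  simp only [Finset.prod_mul_distrib, Finset.prod_ite_eq', Finset.mem_univ, if_true] at this
  rw [show (∑ a, arrivalWeight rate a * ((a i).toNat : ℝ)) = _ from this]
  rw [Finset.prod_eq_single i]
  · simp
  · intro j _ hj
    simp [hj]
  · simp

/-- The queues after one slot. -/
def nextQueue (q d : Fin N → ℕ) (a : Fin N → Bool) : Fin N → ℕ := fun i => q i - d i + (a i).toNat

/-- The mean of a real function of the arrivals, the encoder's selection, the receiver's memory and
the allocation in one slot, starting from `w`. -/
noncomputable def slotMean [Fintype X] (φ : EncodingPolicy N X k v) (rate : Fin N → ℝ)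
    (w : State N X k v) (F : (Fin N → Bool) → X × Memory k → Memory v → (Fin N → ℕ) → ℝ) : ℝ :=
  ∑ a, arrivalWeight rate a * ∑ e, encWeight φ w e *
    ∑ m', ∑ d ∈ Sch, jointWeight C ψ w.signal w.recMem e.1 m' d * F a e m' d

theorem slotMean_mono [Fintype X] (φ : EncodingPolicy N X k v) {rate : Fin N → ℝ}
    (hr : ∀ i, 0 ≤ rate i ∧ rate i ≤ 1) (w : State N X k v)
    {F G : (Fin N → Bool) → X × Memory k → Memory v → (Fin N → ℕ) → ℝ}
    (h : ∀ a e m', ∀ d ∈ Sch, encWeight φ w e ≠ 0 → F a e m' d ≤ G a e m' d) :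
    slotMean C ψ φ rate w F ≤ slotMean C ψ φ rate w G := by
  refine Finset.sum_le_sum fun a _ => mul_le_mul_of_nonneg_left ?_ (arrivalWeight_nonneg hr a)
  refine Finset.sum_le_sum fun e _ => ?_
  by_cases he : encWeight φ w e = 0
  · simp [he]
  refine mul_le_mul_of_nonneg_left ?_ ENNReal.toReal_nonneg
  refine Finset.sum_le_sum fun m' _ => Finset.sum_le_sum fun d hd => ?_
  exact mul_le_mul_of_nonneg_left (h a e m' d hd he) (jointWeight_nonneg C ψ _ _ _ _ _)

theorem slotMean_nonneg [Fintype X] (φ : EncodingPolicy N X k v) {rate : Fin N → ℝ}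
    (hr : ∀ i, 0 ≤ rate i ∧ rate i ≤ 1) (w : State N X k v)
    {F : (Fin N → Bool) → X × Memory k → Memory v → (Fin N → ℕ) → ℝ}
    (h : ∀ a e m' d, 0 ≤ F a e m' d) : 0 ≤ slotMean C ψ φ rate w F := by
  have := slotMean_mono C ψ φ hr w (F := fun _ _ _ _ => 0) (G := F) fun a e m' d _ _ => h a e m' d
  simpa [slotMean] using this

/-- For a sum of separate functions only marginals enter, so the correlation between allocation and
receiver memory is harmless. The drift estimates are brought to this form. -/
theorem slotMean_add_add [Fintype X] (φ : EncodingPolicy N X k v) (rate : Fin N → ℝ)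
    (w : State N X k v) (F : (Fin N → Bool) → ℝ) (G : (Fin N → ℕ) → ℝ)
    (H : X × Memory k → Memory v → ℝ) :
    slotMean C ψ φ rate w (fun a e m' d => F a + G d + H e m') =
      ∑ a, arrivalWeight rate a * F a +
      ∑ e, encWeight φ w e * ∑ d ∈ Sch, allocProb C ψ e.1 w.recMem d * G d +
      ∑ e, encWeight φ w e * ∑ m', recTrans C ψ w.signal w.recMem m' * H e m' := by
  have h1 : ∀ a e, ∑ m', ∑ d ∈ Sch, jointWeight C ψ w.signal w.recMem e.1 m' d *
      (F a + G d + H e m') = F a + ∑ d ∈ Sch, allocProb C ψ e.1 w.recMem d * G d +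
        ∑ m', recTrans C ψ w.signal w.recMem m' * H e m' := by
    intro a e
    simp only [mul_add, Finset.sum_add_distrib, ← Finset.sum_mul, sum_jointWeight_alloc,
      sum_recTrans, one_mul]
    congr 2
    rw [Finset.sum_comm]
    simp only [← Finset.sum_mul, sum_jointWeight_update]
  simp only [slotMean, h1]
  simp only [mul_add, Finset.sum_add_distrib, ← Finset.sum_mul, sum_encWeight, one_mul,
    sum_arrivalWeight]

/-- Summing over the outcomes of the slot is needed because distinct allocations can lead to the
same queues by truncation at zero. -/
theorem transitionProb_eq_sum [Fintype X] [DecidableEq (State N X k v)]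
    (φ : EncodingPolicy N X k v) {rate : Fin N → ℝ}
    (hr : ∀ i, 0 ≤ rate i ∧ rate i ≤ 1) (w w' : State N X k v) :
    transitionProb C φ ψ rate w w' = ∑ a, ∑ e, ∑ m', ∑ d ∈ Sch,
      if w' = ⟨nextQueue w.queue d a, a, e.2, e.1, m'⟩ then
        ENNReal.ofReal (arrivalWeight rate a * (encWeight φ w e *
          jointWeight C ψ w.signal w.recMem e.1 m' d)) else 0 := by
  classical
  obtain ⟨q', a', me', x', m''⟩ := w'
  simp only [State.mk.injEq]
  rw [Finset.sum_eq_single a', Finset.sum_eq_single (x', me'), Finset.sum_eq_single m'']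
  rotate_left
  · intro b _ hb
    exact Finset.sum_eq_zero fun d _ => if_neg fun h => hb h.2.2.2.2.symm
  · simp
  · rintro ⟨b₁, b₂⟩ _ hb
    refine Finset.sum_eq_zero fun m _ => Finset.sum_eq_zero fun d _ => if_neg fun h => hb ?_
    simp [h.2.2.1, h.2.2.2.1]
  · simp
  · intro b _ hb
    refine Finset.sum_eq_zero fun e _ => Finset.sum_eq_zero fun m _ =>
      Finset.sum_eq_zero fun d _ => if_neg fun h => hb h.2.1.symm
  · simp
  have hvol : ∀ y y', volume {u : unitInterval | ψ.update y w.recMem u = m'' ∧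
      ∀ i, q' i = (w.queue i - ψ.alloc y' w.recMem u i) + (a' i).toNat} =
      ∑ d ∈ Sch, if q' = nextQueue w.queue d a' then
        volume {u : unitInterval | ψ.update y w.recMem u = m'' ∧ ψ.alloc y' w.recMem u = d}
        else 0 := by
    intro y y'
    rw [← Finset.sum_filter, ← measure_biUnion_finset]
    · congr 1
      ext u
      simp only [Set.mem_ofPred_eq, Finset.mem_filter, Set.mem_iUnion, exists_prop, nextQueue,
        funext_iff]
      constructor
      · rintro ⟨h1, h2⟩
        exact ⟨_, ⟨ψ.alloc_mem y' w.recMem u, h2⟩, h1, fun _ => rfl⟩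
      · rintro ⟨d, ⟨_, h2⟩, h1, h3⟩
        exact ⟨h1, fun i => by rw [h2 i, h3 i]⟩
    · exact (pairwiseDisjoint_fiber (ψ.alloc y' w.recMem) _ {u | ψ.update y w.recMem u = m''})
    · exact fun d _ => (ψ.measurable_update y _ m'').inter (ψ.measurable_alloc y' _ d)
  simp only [transitionProb, hvol, arrivalProb_eq hr, and_true]
  have he : volume {u : unitInterval | φ.encode w.queue w.arrival w.encMem w.recMem u = (x', me')} =
      ENNReal.ofReal (encWeight φ w (x', me')) := (ENNReal.ofReal_toReal (measure_ne_top _ _)).symm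
  have hj : ∀ d, ENNReal.ofReal (jointWeight C ψ w.signal w.recMem x' m'' d) =
      ∑ y, ∑ y', ENNReal.ofReal (C.prob w.signal y) * ENNReal.ofReal (C.prob x' y') *
        volume {u : unitInterval | ψ.update y w.recMem u = m'' ∧
          ψ.alloc y' w.recMem u = d} := by
    intro d
    rw [jointWeight, ENNReal.ofReal_sum_of_nonneg]
    · refine Finset.sum_congr rfl fun y _ => ?_
      rw [ENNReal.ofReal_sum_of_nonneg]
      · refine Finset.sum_congr rfl fun y' _ => ?_
        rw [ENNReal.ofReal_mul (mul_nonneg (C.prob_nonneg _ _) (C.prob_nonneg _ _)),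
          ENNReal.ofReal_mul (C.prob_nonneg _ _), ENNReal.ofReal_toReal (measure_ne_top _ _)]
      · exact fun y' _ => mul_nonneg (mul_nonneg (C.prob_nonneg _ _) (C.prob_nonneg _ _))
          ENNReal.toReal_nonneg
    · exact fun y _ => Finset.sum_nonneg fun y' _ =>
        mul_nonneg (mul_nonneg (C.prob_nonneg _ _) (C.prob_nonneg _ _)) ENNReal.toReal_nonneg
  rw [he]
  have hsplit : ∀ d, ENNReal.ofReal (arrivalWeight rate a' * (encWeight φ w (x', me') *
      jointWeight C ψ w.signal w.recMem x' m'' d)) = ENNReal.ofReal (arrivalWeight rate a') *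
      ENNReal.ofReal (encWeight φ w (x', me')) *
        ENNReal.ofReal (jointWeight C ψ w.signal w.recMem x' m'' d) := fun d => by
    have h0 : 0 ≤ encWeight φ w (x', me') := ENNReal.toReal_nonneg
    rw [ENNReal.ofReal_mul (arrivalWeight_nonneg hr a'), ENNReal.ofReal_mul h0, mul_assoc]
  have hite : ∀ d, (if q' = nextQueue w.queue d a' then
      ENNReal.ofReal (arrivalWeight rate a' * (encWeight φ w (x', me') *
        jointWeight C ψ w.signal w.recMem x' m'' d)) else 0) =
      ENNReal.ofReal (arrivalWeight rate a') * ENNReal.ofReal (encWeight φ w (x', me')) *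
      ∑ y, ∑ y', ENNReal.ofReal (C.prob w.signal y) * ENNReal.ofReal (C.prob x' y') *
        if q' = nextQueue w.queue d a' then
          volume {u : unitInterval | ψ.update y w.recMem u = m'' ∧ ψ.alloc y' w.recMem u = d}
        else 0 := by
    intro d
    split_ifs with h
    · rw [hsplit, hj]
    · simp
  simp only [hite, ← Finset.mul_sum]
  congr 1
  symm
  rw [Finset.sum_comm]
  refine Finset.sum_congr rfl fun y _ => ?_
  rw [Finset.sum_comm]
  simp only [Finset.mul_sum]

/-- Replaces a sum over infinitely many states by a finite real sum, in which the drift can be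
computed with subtraction. -/
theorem stepMean_transitionProb [Fintype X] (φ : EncodingPolicy N X k v) {rate : Fin N → ℝ}
    (hr : ∀ i, 0 ≤ rate i ∧ rate i ≤ 1) (w : State N X k v) {V : State N X k v → ℝ}
    (hV : ∀ s, 0 ≤ V s) :
    stepMean (transitionProb C φ ψ rate) (fun s => ENNReal.ofReal (V s)) w =
      ENNReal.ofReal (slotMean C ψ φ rate w
        fun a e m' d => V ⟨nextQueue w.queue d a, a, e.2, e.1, m'⟩) := by
  classical
  have hw : ∀ a e m' d, 0 ≤ arrivalWeight rate a * (encWeight φ w e *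
      jointWeight C ψ w.signal w.recMem e.1 m' d) := fun a e m' d =>
    mul_nonneg (arrivalWeight_nonneg hr a) (mul_nonneg ENNReal.toReal_nonneg
      (jointWeight_nonneg C ψ _ _ _ _ _))
  have hsum : slotMean C ψ φ rate w (fun a e m' d => V ⟨nextQueue w.queue d a, a, e.2, e.1, m'⟩) =
      ∑ a, ∑ e, ∑ m', ∑ d ∈ Sch, arrivalWeight rate a * (encWeight φ w e *
      jointWeight C ψ w.signal w.recMem e.1 m' d) *
        V ⟨nextQueue w.queue d a, a, e.2, e.1, m'⟩ := by
    simp only [slotMean, Finset.mul_sum, mul_assoc]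
  rw [hsum, ENNReal.ofReal_sum_of_nonneg fun a _ => Finset.sum_nonneg fun e _ =>
    Finset.sum_nonneg fun m' _ => Finset.sum_nonneg fun d _ => mul_nonneg (hw _ _ _ _) (hV _)]
  simp only [stepMean, transitionProb_eq_sum C ψ φ hr, Finset.sum_mul]
  rw [Summable.tsum_finsetSum fun _ _ => ENNReal.summable]
  refine Finset.sum_congr rfl fun a _ => ?_
  rw [Summable.tsum_finsetSum fun _ _ => ENNReal.summable, ENNReal.ofReal_sum_of_nonneg fun e _ =>
    Finset.sum_nonneg fun m' _ => Finset.sum_nonneg fun d _ => mul_nonneg (hw _ _ _ _) (hV _)]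
  refine Finset.sum_congr rfl fun e _ => ?_
  rw [Summable.tsum_finsetSum fun _ _ => ENNReal.summable, ENNReal.ofReal_sum_of_nonneg
    fun m' _ => Finset.sum_nonneg fun d _ => mul_nonneg (hw _ _ _ _) (hV _)]
  refine Finset.sum_congr rfl fun m' _ => ?_
  rw [Summable.tsum_finsetSum fun _ _ => ENNReal.summable, ENNReal.ofReal_sum_of_nonneg
    fun d _ => mul_nonneg (hw _ _ _ _) (hV _)]
  refine Finset.sum_congr rfl fun d _ => ?_
  rw [tsum_eq_single ⟨nextQueue w.queue d a, a, e.2, e.1, m'⟩ fun s hs => by rw [if_neg hs, zero_mul],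
    if_pos rfl, ENNReal.ofReal_mul (hw _ _ _ _)]

theorem tsum_transitionProb [Fintype X] (φ : EncodingPolicy N X k v) {rate : Fin N → ℝ}
    (hr : ∀ i, 0 ≤ rate i ∧ rate i ≤ 1) (w : State N X k v) :
    ∑' s, transitionProb C φ ψ rate w s = 1 := by
  have h := stepMean_transitionProb C ψ φ hr w (V := fun _ => 1) fun _ => zero_le_one
  have h2 := slotMean_add_add C ψ φ rate w (fun _ => 1) (fun _ => 0) (fun _ _ => 0)
  simp only [add_zero, mul_zero, Finset.sum_const_zero, mul_one, sum_arrivalWeight] at h2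
  simpa [stepMean, h2] using h

theorem exists_of_transitionProb_ne_zero [Fintype X] (φ : EncodingPolicy N X k v)
    {rate : Fin N → ℝ} (hr : ∀ i, 0 ≤ rate i ∧ rate i ≤ 1) {w s : State N X k v}
    (h : transitionProb C φ ψ rate w s ≠ 0) :
    ∃ a e m', ∃ d ∈ Sch, s = ⟨nextQueue w.queue d a, a, e.2, e.1, m'⟩ ∧ encWeight φ w e ≠ 0 ∧
      jointWeight C ψ w.signal w.recMem e.1 m' d ≠ 0 := by
  classical
  rw [transitionProb_eq_sum C ψ φ hr] at h
  obtain ⟨a, _, h⟩ := Finset.exists_ne_zero_of_sum_ne_zero h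
  obtain ⟨e, _, h⟩ := Finset.exists_ne_zero_of_sum_ne_zero h
  obtain ⟨m', _, h⟩ := Finset.exists_ne_zero_of_sum_ne_zero h
  obtain ⟨d, hd, h⟩ := Finset.exists_ne_zero_of_sum_ne_zero h
  obtain ⟨hs, h⟩ := ite_ne_right_iff.1 h
  have h2 : arrivalWeight rate a * (encWeight φ w e *
      jointWeight C ψ w.signal w.recMem e.1 m' d) ≠ 0 := fun h0 => h (by rw [h0]; simp)
  exact ⟨a, e, m', d, hd, hs, left_ne_zero_of_mul (right_ne_zero_of_mul h2),
    right_ne_zero_of_mul (right_ne_zero_of_mul h2)⟩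

theorem transitionProb_ne_zero [Fintype X] (φ : EncodingPolicy N X k v)
    {rate : Fin N → ℝ} (hr : ∀ i, 0 ≤ rate i ∧ rate i ≤ 1) {w : State N X k v}
    {a : Fin N → Bool} {e : X × Memory k} {m' : Memory v} {d : Fin N → ℕ} (hd : d ∈ Sch)
    (ha : arrivalWeight rate a ≠ 0) (he : encWeight φ w e ≠ 0)
    (hj : jointWeight C ψ w.signal w.recMem e.1 m' d ≠ 0) :
    transitionProb C φ ψ rate w ⟨nextQueue w.queue d a, a, e.2, e.1, m'⟩ ≠ 0 := by
  classical
  rw [transitionProb_eq_sum C ψ φ hr]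
  intro h
  simp only [Finset.sum_eq_zero_iff] at h
  have := h a (Finset.mem_univ _) e (Finset.mem_univ _) m' (Finset.mem_univ _) d hd
  rw [if_pos rfl, ENNReal.ofReal_eq_zero] at this
  have h1 := (arrivalWeight_nonneg hr a).lt_of_ne' ha
  have h2 := (ENNReal.toReal_nonneg : 0 ≤ encWeight φ w e).lt_of_ne' he
  have h3 := (jointWeight_nonneg C ψ _ _ _ _ _).lt_of_ne' hj
  exact absurd this (not_le.2 (by positivity))

end Step

/-! ### A controlled chain with delayed actions

The state is `(x, m)`, where `x` is the last action. The action `x'` earns the reward vector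
`r x' m`, and `m` moves to `m'` with probability `p x m m'`. -/

section Values

variable {N : ℕ} {X M : Type*} [Fintype X] [Fintype M]

/-- The weighted reward of the action `x'`, plus the discounted mean of `u` after the transition. -/
def objective (p : X → M → M → ℝ) (r : X → M → Fin N → ℝ) (β : ℝ) (q : Fin N → ℝ) (u : X → M → ℝ)
    (x : X) (m : M) (x' : X) : ℝ :=
  ∑ i, q i * r x' m i + β * ∑ m', p x m m' * u x' m'

variable [Nonempty X]

/-- The Bellman operator with weights `q` and discount factor `β`. -/
noncomputable def bellman (p : X → M → M → ℝ) (r : X → M → Fin N → ℝ) (β : ℝ) (q : Fin N → ℝ)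
    (u : X → M → ℝ) (x : X) (m : M) : ℝ :=
  Finset.univ.sup' Finset.univ_nonempty (objective p r β q u x m)

/-- The optimal discounted reward over `n` steps. -/
noncomputable def value (p : X → M → M → ℝ) (r : X → M → Fin N → ℝ) (β : ℝ) (q : Fin N → ℝ)
    (n : ℕ) : X → M → ℝ :=
  (bellman p r β q)^[n] fun _ _ => 0

variable {p : X → M → M → ℝ} {r : X → M → Fin N → ℝ} {β : ℝ} {q : Fin N → ℝ}

theorem value_succ (n : ℕ) : value p r β q (n + 1) = bellman p r β q (value p r β q n) :=
  Function.iterate_succ_apply' _ _ _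

theorem objective_le_bellman (u : X → M → ℝ) (x : X) (m : M) (x' : X) :
    objective p r β q u x m x' ≤ bellman p r β q u x m :=
  Finset.le_sup' _ (Finset.mem_univ x')

theorem exists_objective_eq_bellman (u : X → M → ℝ) (x : X) (m : M) :
    ∃ x', objective p r β q u x m x' = bellman p r β q u x m := by
  obtain ⟨x', _, h⟩ := Finset.exists_mem_eq_sup' Finset.univ_nonempty (objective p r β q u x m)
  exact ⟨x', h.symm⟩

omit [Fintype X] [Nonempty X] in
theorem objective_mono (hp : ∀ x m m', 0 ≤ p x m m') (hβ : 0 ≤ β) {u u' : X → M → ℝ}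
    (h : ∀ x m, u x m ≤ u' x m) (x : X) (m : M) (x' : X) :
    objective p r β q u x m x' ≤ objective p r β q u' x m x' := by
  unfold objective
  gcongr with m'
  · exact hp x m m'
  · exact h x' m'

theorem bellman_mono (hp : ∀ x m m', 0 ≤ p x m m') (hβ : 0 ≤ β) {u u' : X → M → ℝ}
    (h : ∀ x m, u x m ≤ u' x m) (x : X) (m : M) :
    bellman p r β q u x m ≤ bellman p r β q u' x m :=
  Finset.sup'_le _ _ fun x' _ =>
    (objective_mono hp hβ h x m x').trans (objective_le_bellman u' x m x')

theorem iterate_bellman_mono (hp : ∀ x m m', 0 ≤ p x m m') (hβ : 0 ≤ β) {u u' : X → M → ℝ}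
    (h : ∀ x m, u x m ≤ u' x m) (n : ℕ) (x : X) (m : M) :
    (bellman p r β q)^[n] u x m ≤ (bellman p r β q)^[n] u' x m := by
  induction n generalizing x m with
  | zero => exact h x m
  | succ n ih =>
    rw [Function.iterate_succ_apply', Function.iterate_succ_apply']
    exact bellman_mono hp hβ ih x m

theorem bellman_add_const (hp1 : ∀ x m, ∑ m', p x m m' = 1) (u : X → M → ℝ) (c : ℝ) :
    bellman p r 1 q (fun x m => u x m + c) = fun x m => bellman p r 1 q u x m + c := by
  have h : ∀ x m x', objective p r 1 q (fun x m => u x m + c) x m x' =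
      objective p r 1 q u x m x' + c := by
    intro x m x'
    simp only [objective, mul_add, Finset.sum_add_distrib, ← Finset.sum_mul, hp1]
    ring
  funext x m
  apply le_antisymm
  · refine Finset.sup'_le _ _ fun x' _ => ?_
    rw [h]
    gcongr
    exact objective_le_bellman u x m x'
  · obtain ⟨x', hx'⟩ := exists_objective_eq_bellman (p := p) (r := r) (β := 1) (q := q) u x m
    rw [← hx', ← h]
    exact objective_le_bellman _ x m x'

theorem iterate_bellman_const (hp1 : ∀ x m, ∑ m', p x m m' = 1) (c : ℝ) (n : ℕ) :
    (bellman p r 1 q)^[n] (fun _ _ => c) = fun x m => value p r 1 q n x m + c := by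
  induction n with
  | zero => simp [value]
  | succ n ih => rw [Function.iterate_succ_apply', ih, bellman_add_const hp1, value_succ]

theorem value_nonneg (hp : ∀ x m m', 0 ≤ p x m m') (hr : ∀ x m i, 0 ≤ r x m i) (hβ : 0 ≤ β)
    (hq : ∀ i, 0 ≤ q i) (n : ℕ) (x : X) (m : M) : 0 ≤ value p r β q n x m := by
  induction n generalizing x m with
  | zero => exact le_rfl
  | succ n ih =>
    rw [value_succ]
    refine le_trans ?_ (objective_le_bellman _ x m x)
    exact add_nonneg (Finset.sum_nonneg fun i _ => mul_nonneg (hq i) (hr x m i))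
      (mul_nonneg hβ (Finset.sum_nonneg fun m' _ => mul_nonneg (hp x m m') (ih x m')))

/-- With nonnegative rewards an extra stage cannot hurt. Thus the finite-horizon value is a
subsolution of the Bellman equation, which is all the Lyapunov drift needs; no infinite-horizon
value is constructed. -/
theorem value_le_value_succ (hp : ∀ x m m', 0 ≤ p x m m') (hr : ∀ x m i, 0 ≤ r x m i)
    (hβ : 0 ≤ β) (hq : ∀ i, 0 ≤ q i) (n : ℕ) (x : X) (m : M) :
    value p r β q n x m ≤ value p r β q (n + 1) x m := by
  rw [value, value, Function.iterate_succ_apply]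
  exact iterate_bellman_mono hp hβ (fun x m => by
    have := value_nonneg hp hr hβ hq 1 x m
    simpa [value] using this) n x m

/-- Every reward collected within `n` steps is discounted by a factor of at least `β ^ n`, and the
terminal reward by exactly this factor. -/
theorem pow_mul_iterate_bellman_le (hp : ∀ x m m', 0 ≤ p x m m') (hr : ∀ x m i, 0 ≤ r x m i)
    (hβ : 0 ≤ β) (hβ1 : β ≤ 1) (hq : ∀ i, 0 ≤ q i) (u : X → M → ℝ) (n : ℕ) (x : X) (m : M) :
    β ^ n * (bellman p r 1 q)^[n] u x m ≤ (bellman p r β q)^[n] u x m := by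
  induction n generalizing x m with
  | zero => simp
  | succ n ih =>
    rw [Function.iterate_succ_apply', Function.iterate_succ_apply']
    obtain ⟨x', hx'⟩ := exists_objective_eq_bellman (p := p) (r := r) (β := 1) (q := q)
      ((bellman p r 1 q)^[n] u) x m
    rw [← hx']
    refine le_trans ?_ (objective_le_bellman _ x m x')
    have h1 : 0 ≤ ∑ i, q i * r x' m i := Finset.sum_nonneg fun i _ => mul_nonneg (hq i) (hr x' m i)
    have h2 : ∑ m', p x m m' * (β ^ n * (bellman p r 1 q)^[n] u x' m') ≤
        ∑ m', p x m m' * (bellman p r β q)^[n] u x' m' :=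
      Finset.sum_le_sum fun m' _ => mul_le_mul_of_nonneg_left (ih x' m') (hp x m m')
    have h3 : ∑ m', p x m m' * (β ^ n * (bellman p r 1 q)^[n] u x' m') =
        β ^ n * ∑ m', p x m m' * (bellman p r 1 q)^[n] u x' m' := by
      rw [Finset.mul_sum]
      exact Finset.sum_congr rfl fun m' _ => by ring
    have h4 : β ^ (n + 1) ≤ 1 := pow_le_one₀ hβ hβ1
    rw [h3] at h2
    unfold objective
    calc _ = β ^ (n + 1) * ∑ i, q i * r x' m i +
          β * (β ^ n * ∑ m', p x m m' * (bellman p r 1 q)^[n] u x' m') := by ring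
      _ ≤ _ := add_le_add (mul_le_of_le_one_left h1 h4) (mul_le_mul_of_nonneg_left h2 hβ)

/-- Concatenation of horizons: the value of the last `j` steps acts as a terminal reward, at least
`c`, for the first `n`. -/
theorem pow_mul_value_add_le (hp : ∀ x m m', 0 ≤ p x m m') (hp1 : ∀ x m, ∑ m', p x m m' = 1)
    (hr : ∀ x m i, 0 ≤ r x m i) (hβ : 0 ≤ β) (hβ1 : β ≤ 1) (hq : ∀ i, 0 ≤ q i) {c : ℝ} {j : ℕ}
    (hc : ∀ x m, c ≤ value p r β q j x m) (n : ℕ) (x : X) (m : M) :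
    β ^ n * (value p r 1 q n x m + c) ≤ value p r β q (n + j) x m := by
  rw [value, value, Function.iterate_add_apply]
  refine le_trans ?_ (iterate_bellman_mono hp hβ hc n x m)
  have := pow_mul_iterate_bellman_le hp hr hβ hβ1 hq (fun _ _ => c) n x m
  rw [iterate_bellman_const hp1] at this
  exact this

/-- Lipschitz dependence on the weights. It bounds the effect on the value of the change of the
queues in one slot. -/
theorem value_le_value_add (hp : ∀ x m m', 0 ≤ p x m m') (hp1 : ∀ x m, ∑ m', p x m m' = 1)
    {R : ℝ} (hr : ∀ x m i, 0 ≤ r x m i) (hR : ∀ x m i, r x m i ≤ R) (hβ : 0 ≤ β) (hβ1 : β ≤ 1)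
    (q q' : Fin N → ℝ) (n : ℕ) (x : X) (m : M) :
    value p r β q n x m ≤ value p r β q' n x m + n * (R * ∑ i, |q i - q' i|) := by
  induction n generalizing x m with
  | zero => simp [value]
  | succ n ih =>
    have hA : 0 ≤ n * (R * ∑ i, |q i - q' i|) := by
      rcases isEmpty_or_nonempty (Fin N) with h | ⟨⟨i⟩⟩
      · simp
      · have := (hr x m i).trans (hR x m i)
        positivity
    obtain ⟨x', hx'⟩ := exists_objective_eq_bellman (p := p) (r := r) (β := β) (q := q)
      (value p r β q n) x m
    rw [value_succ, value_succ, ← hx']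
    have h1 : ∑ i, q i * r x' m i ≤ ∑ i, q' i * r x' m i + R * ∑ i, |q i - q' i| := by
      rw [Finset.mul_sum, ← Finset.sum_add_distrib]
      refine Finset.sum_le_sum fun i _ => ?_
      nlinarith [le_abs_self (q i - q' i), abs_nonneg (q i - q' i), hr x' m i, hR x' m i]
    have h2 : ∑ m', p x m m' * value p r β q n x' m' ≤
        ∑ m', p x m m' * value p r β q' n x' m' + n * (R * ∑ i, |q i - q' i|) := by
      calc _ ≤ ∑ m', p x m m' * (value p r β q' n x' m' + n * (R * ∑ i, |q i - q' i|)) :=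
            Finset.sum_le_sum fun m' _ => mul_le_mul_of_nonneg_left (ih x' m') (hp x m m')
        _ = _ := by
            simp only [mul_add, Finset.sum_add_distrib, ← Finset.sum_mul, hp1, one_mul]
    have h3 := objective_le_bellman (p := p) (r := r) (β := β) (q := q')
      (value p r β q' n) x m x'
    unfold objective at *
    push_cast
    nlinarith [mul_le_mul_of_nonneg_left h2 hβ, mul_le_mul_of_nonneg_right hβ1 hA]

theorem value_le (hp : ∀ x m m', 0 ≤ p x m m') (hp1 : ∀ x m, ∑ m', p x m m' = 1)
    {R : ℝ} (hr : ∀ x m i, 0 ≤ r x m i) (hR : ∀ x m i, r x m i ≤ R) (hβ : 0 ≤ β) (hβ1 : β ≤ 1)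
    (hq : ∀ i, 0 ≤ q i) (n : ℕ) (x : X) (m : M) :
    value p r β q n x m ≤ n * (R * ∑ i, q i) := by
  have h := value_le_value_add hp hp1 hr hR hβ hβ1 q (fun _ => 0) n x m
  have h0 : ∀ n x m, value p r β (fun _ : Fin N => 0) n x m = 0 := by
    intro n
    induction n with
    | zero => intro x m; rfl
    | succ n ih =>
      intro x m
      rw [value_succ]
      obtain ⟨x', hx'⟩ := exists_objective_eq_bellman (p := p) (r := r) (β := β)
        (q := fun _ : Fin N => 0) (value p r β (fun _ : Fin N => 0) n) x m
      rw [← hx']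
      simp [objective, ih]
  simpa [h0, abs_of_nonneg (hq _)] using h

/-- A lower bound on the undiscounted values from an average reward inequality. -/
theorem le_value_of_le_objective (hp : ∀ x m m', 0 ≤ p x m m') (hp1 : ∀ x m, ∑ m', p x m m' = 1)
    {g H : ℝ} {h : X → M → ℝ} (hH : ∀ x m, h x m ≤ H) (f : X → M → X)
    (hf : ∀ x m, g + h x m ≤ objective p r 1 q h x m (f x m)) (n : ℕ) (x : X) (m : M) :
    n * g + h x m - H ≤ value p r 1 q n x m := by
  induction n generalizing x m with
  | zero => simpa [value] using hH x m
  | succ n ih =>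
    rw [value_succ]
    refine le_trans ?_ (objective_le_bellman _ x m (f x m))
    refine le_trans ?_ (objective_mono hp zero_le_one ih x m (f x m))
    have h1 := hf x m
    have h2 : objective p r 1 q (fun x m => n * g + h x m - H) x m (f x m) =
        objective p r 1 q h x m (f x m) + (n * g - H) := by
      have : ∀ m', p x m m' * (n * g + h (f x m) m' - H) =
          p x m m' * h (f x m) m' + p x m m' * (n * g - H) := fun m' => by ring
      simp only [objective, this, Finset.sum_add_distrib, ← Finset.sum_mul, hp1]
      ring
    rw [h2]
    push_cast
    linarith

theorem mul_le_value_mul (hp : ∀ x m m', 0 ≤ p x m m') (hp1 : ∀ x m, ∑ m', p x m m' = 1)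
    (hr : ∀ x m i, 0 ≤ r x m i) (hq : ∀ i, 0 ≤ q i) {c : ℝ} {n : ℕ}
    (hc : ∀ x m, c ≤ value p r 1 q n x m) (k : ℕ) (x : X) (m : M) :
    k * c ≤ value p r 1 q (n * k) x m := by
  induction k generalizing x m with
  | zero => simp [value]
  | succ k ih =>
    have := pow_mul_value_add_le hp hp1 hr zero_le_one le_rfl hq ih n x m
    rw [mul_add_one, add_comm (n * k)]
    rw [one_pow, one_mul] at this
    push_cast
    linarith [hc x m]

/-- Lower bounds on undiscounted values carry over to discounted values, for a discount factor close
to `1`. -/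
theorem exists_discount_le_value (hp : ∀ x m m', 0 ≤ p x m m')
    (hp1 : ∀ x m, ∑ m', p x m m' = 1) (hr : ∀ x m i, 0 ≤ r x m i) {n : ℕ} (hn : 0 < n)
    {ρ ρ' : ℝ} (hρ : 0 ≤ ρ) (hρ' : ρ' < ρ) :
    ∃ β : ℝ, 0 ≤ β ∧ β < 1 ∧ ∃ k : ℕ, ∀ q : Fin N → ℝ, (∀ i, 0 ≤ q i) → ∀ G : ℝ, 0 ≤ G →
      (∀ x m, n * (ρ * G) ≤ value p r 1 q n x m) →
      ∀ x m, ρ' * G ≤ (1 - β) * value p r β q k x m := by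
  -- Discounting over one block of `n` steps must not consume the gap between `ρ` and `ρ'`. The
  -- choice does not involve the weights.
  obtain ⟨β, ⟨hβ0, hβ1⟩, hβ⟩ : ∃ β : ℝ, (0 < β ∧ β < 1) ∧ ρ' < β ^ n * ρ := by
    have h1 : Tendsto (fun β : ℝ => β ^ n * ρ) (𝓝[<] 1) (𝓝 (1 ^ n * ρ)) :=
      (((continuous_pow n).mul continuous_const).tendsto 1).mono_left nhdsWithin_le_nhds
    rw [one_pow, one_mul] at h1
    have h2 := h1.eventually (lt_mem_nhds hρ')
    have h3 : ∀ᶠ β : ℝ in 𝓝[<] 1, 0 < β ∧ β < 1 :=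
      (Ioo_mem_nhdsLT zero_lt_one : Set.Ioo (0 : ℝ) 1 ∈ _)
    exact (h3.and h2).exists
  set γ := β ^ n with hγ
  have hγ0 : 0 < γ := by positivity
  have hγ1 : γ < 1 := pow_lt_one₀ hβ0.le hβ1 hn.ne'
  -- The fixed point of `L = γ * (n * ρ + L)`, a lower bound for the value of infinitely many blocks
  -- of `n` steps.
  set L := γ * n * ρ / (1 - γ) with hL
  have hLγ : L * (1 - γ) = γ * n * ρ := div_mul_cancel₀ _ (by linarith)
  have hL0 : 0 ≤ L := div_nonneg (by positivity) (by linarith)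
  -- Bernoulli's inequality, which yields `γ * ρ ≤ (1 - β) * L`.
  have hbern : 1 - γ ≤ n * (1 - β) := by
    have := one_add_mul_le_pow (a := β - 1) (by linarith) n
    rw [add_sub_cancel] at this
    linarith
  have hgap : ρ' < (1 - β) * L := by
    have h1 : γ * ρ * (1 - γ) ≤ (1 - β) * L * (1 - γ) := by
      rw [mul_assoc (1 - β), hLγ]
      nlinarith [mul_nonneg hγ0.le hρ]
    have h2 : γ * ρ ≤ (1 - β) * L := le_of_mul_le_mul_right h1 (by linarith)
    linarith
  obtain ⟨k, hk⟩ : ∃ k : ℕ, ρ' < (1 - β) * (L * (1 - γ ^ k)) := by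
    have h1 : Tendsto (fun k : ℕ => (1 - β) * (L * (1 - γ ^ k))) atTop
        (𝓝 ((1 - β) * (L * (1 - 0)))) :=
      ((tendsto_const_nhds.sub (tendsto_pow_atTop_nhds_zero_of_lt_one hγ0.le hγ1)).const_mul
        L).const_mul _
    rw [sub_zero, mul_one] at h1
    exact (h1.eventually (lt_mem_nhds hgap)).exists
  refine ⟨β, hβ0.le, hβ1, n * k, fun q hq G hG hval x m => ?_⟩
  have key : ∀ k : ℕ, ∀ x m, L * (1 - γ ^ k) * G ≤ value p r β q (n * k) x m := by
    intro k
    induction k with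
    | zero => intro x m; simp [value]
    | succ k ih =>
      intro x m
      have h1 := pow_mul_value_add_le hp hp1 hr hβ0.le hβ1.le hq ih n x m
      rw [mul_add_one, add_comm (n * k)]
      refine le_trans (le_trans ?_ (mul_le_mul_of_nonneg_left
        (add_le_add (hval x m) le_rfl) hγ0.le)) h1
      have : L = L * γ + γ * n * ρ := by rw [← hLγ]; ring
      calc L * (1 - γ ^ (k + 1)) * G = (L - L * γ * γ ^ k) * G := by ring
        _ = (L * γ + γ * n * ρ - L * γ * γ ^ k) * G := by rw [← this]
        _ ≤ _ := le_of_eq (by ring)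
  have := mul_le_mul_of_nonneg_left (key k x m) (by linarith : 0 ≤ 1 - β)
  nlinarith [mul_le_mul_of_nonneg_right hk.le hG]

end Values

/-! ### Necessary conditions for a capacity factor -/

section Chain

variable {S : Type*} {P : S → S → ℝ≥0∞}

theorem iterate_stepMean_mono {f g : S → ℝ≥0∞} (h : ∀ s, f s ≤ g s) (n : ℕ) (w : S) :
    (stepMean P)^[n] f w ≤ (stepMean P)^[n] g w := by
  induction n generalizing w with
  | zero => exact h w
  | succ n ih =>
    rw [Function.iterate_succ_apply', Function.iterate_succ_apply']
    exact stepMean_mono fun s _ => ih s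

theorem iterate_stepMean_const_mul (c : ℝ≥0∞) (f : S → ℝ≥0∞) (n : ℕ) (w : S) :
    (stepMean P)^[n] (fun s => c * f s) w = c * (stepMean P)^[n] f w := by
  induction n generalizing w with
  | zero => rfl
  | succ n ih =>
    rw [Function.iterate_succ_apply', Function.iterate_succ_apply']
    simp only [stepMean, ih, ← ENNReal.tsum_mul_left]
    exact tsum_congr fun s => by ring

end Chain

section Converse

variable {N : ℕ} {Sch : Finset (Fin N → ℕ)} {X Y : Type*} [Fintype Y] {k v : ℕ}
  (C : Channel X Y) (ψ : AllocationPolicy Sch Y v)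

/-- For all weights, the mean service per slot over some horizon can be made `ρ` times the largest
weight of a schedule. -/
def Achieves [Fintype X] [Nonempty X] (ρ : ℝ) : Prop :=
  ∃ n : ℕ, 0 < n ∧ ∀ q : Fin N → ℝ, (∀ i, 0 ≤ q i) → ∀ d ∈ Sch, ∀ x m,
    n * (ρ * ∑ i, q i * d i) ≤ value (recTrans C ψ) (allocMean C ψ) 1 q n x m

/-- The pairs of last signal and receiver memory which can follow each other. -/
def RecStep (s s' : X × Memory v) : Prop := recTrans C ψ s.1 s.2 s'.2 ≠ 0

/-- Some pair of last signal and receiver memory can be reached from all others. -/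
def HasReachableMemory : Prop :=
  ∃ z : X × Memory v, ∀ s, Relation.ReflTransGen (RecStep C ψ) s z

theorem recTrans_ne_zero_of_jointWeight {x x' : X} {m m' : Memory v} {d : Fin N → ℕ}
    (hd : d ∈ Sch) (h : jointWeight C ψ x m x' m' d ≠ 0) : recTrans C ψ x m m' ≠ 0 := by
  rw [← sum_jointWeight_alloc C ψ x m x' m']
  intro h0
  exact h ((Finset.sum_eq_zero_iff_of_nonneg fun d _ => jointWeight_nonneg C ψ _ _ _ _ _).1 h0 d hd)

theorem hasReachableMemory_of_mem_capacityRegion [Fintype X] {φ : EncodingPolicy N X k v}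
    {rate : Fin N → ℝ} (h : rate ∈ capacityRegion C φ ψ) : HasReachableMemory C ψ := by
  obtain ⟨hr, z, hz⟩ := h
  have key : ∀ w : State N X k v,
      Relation.ReflTransGen (RecStep C ψ) (w.signal, w.recMem) (z.signal, z.recMem) := by
    intro w
    refine of_meanHittingTime_lt_top (P := transitionProb C φ ψ rate) (z := z)
      (R := fun w => Relation.ReflTransGen (RecStep C ψ) (w.signal, w.recMem)
        (z.signal, z.recMem)) (tsum_transitionProb C ψ φ hr)
      Relation.ReflTransGen.refl (fun w s hws hs => ?_) (hz w)
    obtain ⟨a, e, m', d, hd, hs', _, hj⟩ := exists_of_transitionProb_ne_zero C ψ φ hr hws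
    refine Relation.ReflTransGen.head (b := (s.signal, s.recMem)) ?_ hs
    rw [hs']
    exact recTrans_ne_zero_of_jointWeight C ψ hd hj
  exact ⟨(z.signal, z.recMem), fun s => key ⟨fun _ => 0, fun _ => false, fun _ => false, s.1, s.2⟩⟩

theorem allocMean_eq_sum_mul (q : Fin N → ℝ) (x : X) (m : Memory v) :
    ∑ i, q i * allocMean C ψ x m i = ∑ d ∈ Sch, allocProb C ψ x m d * ∑ i, q i * d i := by
  simp only [allocMean, Finset.mul_sum]
  rw [Finset.sum_comm]
  exact Finset.sum_congr rfl fun d _ => Finset.sum_congr rfl fun i _ => by ring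

theorem sum_arrivalWeight_mul_sum (rate q : Fin N → ℝ) :
    ∑ a, arrivalWeight rate a * ∑ i, q i * (a i).toNat = ∑ i, q i * rate i := by
  simp only [Finset.mul_sum]
  rw [Finset.sum_comm]
  refine Finset.sum_congr rfl fun i _ => ?_
  rw [← sum_arrivalWeight_mul rate i, Finset.mul_sum]
  exact Finset.sum_congr rfl fun a _ => by ring

/-- Weighted queues after `n` slots are at least the initial ones plus arrivals minus offered
service, truncation only adding to them. Whatever the encoder knows, it extracts at most the optimal
`value`. Service stands on the right as a sum because the iterated mean may a priori be infinite. -/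
theorem le_value_add_iterate_stepMean [Fintype X] [Nonempty X] (φ : EncodingPolicy N X k v)
    {rate : Fin N → ℝ} (hr : ∀ i, 0 ≤ rate i ∧ rate i ≤ 1) {q : Fin N → ℝ} (hq : ∀ i, 0 ≤ q i)
    (n : ℕ) (w : State N X k v) :
    ENNReal.ofReal (∑ i, q i * w.queue i + n * ∑ i, q i * rate i) ≤
      ENNReal.ofReal (value (recTrans C ψ) (allocMean C ψ) 1 q n w.signal w.recMem) +
      (stepMean (transitionProb C φ ψ rate))^[n]
        (fun s => ENNReal.ofReal (∑ i, q i * s.queue i)) w := by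
  have hlam : 0 ≤ ∑ i, q i * rate i := Finset.sum_nonneg fun i _ => mul_nonneg (hq i) (hr i).1
  have hqq : ∀ s : State N X k v, 0 ≤ ∑ i, q i * (s.queue i : ℝ) := fun s =>
    Finset.sum_nonneg fun i _ => mul_nonneg (hq i) (Nat.cast_nonneg _)
  have hval : ∀ n x m, 0 ≤ value (recTrans C ψ) (allocMean C ψ) 1 q n x m := fun n x m =>
    value_nonneg (recTrans_nonneg C ψ) (allocMean_nonneg C ψ) zero_le_one hq n x m
  induction n generalizing w with
  | zero => simp
  | succ n ih =>
    rw [Function.iterate_succ_apply']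
    set Z := (stepMean (transitionProb C φ ψ rate))^[n]
      (fun s => ENNReal.ofReal (∑ i, q i * (s.queue i : ℝ)))
    have h1 : stepMean (transitionProb C φ ψ rate) (fun s =>
        ENNReal.ofReal (∑ i, q i * (s.queue i : ℝ) + n * ∑ i, q i * rate i)) w ≤
        stepMean (transitionProb C φ ψ rate) (fun s => ENNReal.ofReal
          (value (recTrans C ψ) (allocMean C ψ) 1 q n s.signal s.recMem)) w +
        stepMean (transitionProb C φ ψ rate) Z w := by
      refine (stepMean_mono fun s _ => ih s).trans (le_of_eq ?_)
      simp only [stepMean, mul_add, ENNReal.tsum_add]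
    rw [stepMean_transitionProb C ψ φ hr w (V := fun s =>
        ∑ i, q i * (s.queue i : ℝ) + n * ∑ i, q i * rate i) fun s => add_nonneg (hqq s)
          (mul_nonneg (Nat.cast_nonneg n) hlam),
      stepMean_transitionProb C ψ φ hr w (V := fun s =>
        value (recTrans C ψ) (allocMean C ψ) 1 q n s.signal s.recMem) fun s => hval _ _ _] at h1
    have h2 := slotMean_add_add C ψ φ rate w (fun _ => 0) (fun _ => 0) (fun e m' =>
      value (recTrans C ψ) (allocMean C ψ) 1 q n e.1 m')
    simp only [mul_zero, zero_add, Finset.sum_const_zero] at h2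
    rw [h2] at h1
    have h3 : ∑ i, q i * (w.queue i : ℝ) + n * ∑ i, q i * rate i + ∑ i, q i * rate i -
        ∑ e, encWeight φ w e * ∑ i, q i * allocMean C ψ e.1 w.recMem i ≤
        slotMean C ψ φ rate w fun a e m' d =>
          ∑ i, q i * (nextQueue w.queue d a i : ℝ) + n * ∑ i, q i * rate i := by
      have h4 := slotMean_add_add C ψ φ rate w (fun a => ∑ i, q i * ((a i).toNat : ℝ))
        (fun d => - ∑ i, q i * (d i : ℝ))
        (fun _ _ => ∑ i, q i * (w.queue i : ℝ) + n * ∑ i, q i * rate i)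
      simp only [sum_arrivalWeight_mul_sum, mul_neg, Finset.sum_neg_distrib,
        ← allocMean_eq_sum_mul, ← Finset.sum_mul, sum_recTrans, sum_encWeight, one_mul] at h4
      refine le_trans (le_of_eq ?_) (h4.ge.trans (slotMean_mono C ψ φ hr w
        fun a e m' d _ _ => ?_))
      · ring
      · have : ∑ i, q i * ((a i).toNat : ℝ) + -∑ i, q i * (d i : ℝ) + ∑ i, q i * (w.queue i : ℝ) ≤
            ∑ i, q i * (nextQueue w.queue d a i : ℝ) := by
          rw [← Finset.sum_neg_distrib, ← Finset.sum_add_distrib, ← Finset.sum_add_distrib]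
          refine Finset.sum_le_sum fun i _ => ?_
          have h5 : (w.queue i : ℝ) ≤ ((w.queue i - d i : ℕ) : ℝ) + d i := by
            exact_mod_cast Nat.sub_le_iff_le_add.1 le_rfl
          simp only [nextQueue]
          push_cast
          nlinarith [hq i]
        linarith
    have h6 : ∑ e, encWeight φ w e * ∑ i, q i * allocMean C ψ e.1 w.recMem i +
        ∑ e, encWeight φ w e * ∑ m', recTrans C ψ w.signal w.recMem m' *
          value (recTrans C ψ) (allocMean C ψ) 1 q n e.1 m' ≤
        value (recTrans C ψ) (allocMean C ψ) 1 q (n + 1) w.signal w.recMem := by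
      rw [← Finset.sum_add_distrib, value_succ]
      calc _ ≤ ∑ e, encWeight φ w e * bellman (recTrans C ψ) (allocMean C ψ) 1 q
            (value (recTrans C ψ) (allocMean C ψ) 1 q n) w.signal w.recMem := by
            refine Finset.sum_le_sum fun e _ => ?_
            rw [← mul_add]
            refine mul_le_mul_of_nonneg_left ?_ ENNReal.toReal_nonneg
            have := objective_le_bellman (p := recTrans C ψ) (r := allocMean C ψ) (β := 1) (q := q)
              (value (recTrans C ψ) (allocMean C ψ) 1 q n) w.signal w.recMem e.1
            rwa [objective, one_mul] at this
        _ = _ := by rw [← Finset.sum_mul, sum_encWeight, one_mul]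
    set s₁ := ∑ e, encWeight φ w e * ∑ i, q i * allocMean C ψ e.1 w.recMem i
    set s₂ := ∑ e, encWeight φ w e * ∑ m', recTrans C ψ w.signal w.recMem m' *
          value (recTrans C ψ) (allocMean C ψ) 1 q n e.1 m'
    have hs₁ : 0 ≤ s₁ := Finset.sum_nonneg fun e _ => mul_nonneg ENNReal.toReal_nonneg
      (Finset.sum_nonneg fun i _ => mul_nonneg (hq i) (allocMean_nonneg C ψ _ _ _))
    have hs₂ : 0 ≤ s₂ := Finset.sum_nonneg fun e _ => mul_nonneg ENNReal.toReal_nonneg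
      (Finset.sum_nonneg fun m' _ => mul_nonneg (recTrans_nonneg C ψ _ _ _) (hval _ _ _))
    set s₃ := slotMean C ψ φ rate w fun a e m' d =>
          ∑ i, q i * (nextQueue w.queue d a i : ℝ) + n * ∑ i, q i * rate i
    calc _ ≤ ENNReal.ofReal (s₁ + s₃) := ENNReal.ofReal_le_ofReal (by push_cast; linarith)
      _ ≤ ENNReal.ofReal s₁ + ENNReal.ofReal s₃ := ENNReal.ofReal_add_le
      _ ≤ ENNReal.ofReal s₁ + (ENNReal.ofReal s₂ + stepMean (transitionProb C φ ψ rate) Z w) := by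
        gcongr
      _ = ENNReal.ofReal (s₁ + s₂) + stepMean (transitionProb C φ ψ rate) Z w := by
        rw [ENNReal.ofReal_add hs₁ hs₂, add_assoc]
      _ ≤ _ := by gcongr

/-- Stability under the arrival rates `rate` bounds the values of the controlled receiver. -/
theorem eventually_le_value [Fintype X] [Nonempty X] {φ : EncodingPolicy N X k v}
    {rate : Fin N → ℝ} (h : rate ∈ capacityRegion C φ ψ) {δ : ℝ} (hδ : 0 < δ) :
    ∀ᶠ n : ℕ in atTop, ∀ q : Fin N → ℝ, (∀ i, 0 ≤ q i) → ∀ x m,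
      n * (∑ i, q i * rate i - δ * ∑ i, q i) ≤
        value (recTrans C ψ) (allocMean C ψ) 1 q n x m := by
  obtain ⟨hr, z, hz⟩ := h
  -- The longest queue grows by at most one per slot, as arrivals are Bernoulli; hence its mean is
  -- sublinear.
  set f : State N X k v → ℝ≥0∞ := fun w => (Finset.univ.sup w.queue : ℕ) with hf
  set w₀ : X × Memory v → State N X k v := fun s =>
    ⟨fun _ => 0, fun _ => false, fun _ => false, s.1, s.2⟩ with hw₀
  have hlim := fun s : X × Memory v => tendsto_iterate_stepMean_div
    (P := transitionProb C φ ψ rate) (z := z) (f := f) (tsum_transitionProb C ψ φ hr)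
    (fun w s hws => by
      obtain ⟨a, e, m', d, hd, rfl, _, _⟩ := exists_of_transitionProb_ne_zero C ψ φ hr hws
      simp only [hf]
      norm_cast
      refine Finset.sup_le fun i _ => ?_
      have : w.queue i ≤ Finset.univ.sup w.queue := Finset.le_sup (Finset.mem_univ i)
      have := Bool.toNat_le (a i)
      simp only [nextQueue]
      omega) (fun w => ENNReal.natCast_ne_top _) hz (w₀ s)
  -- There are finitely many empty start states, and the weighted queue is at most `∑ i, q i` times
  -- the longest one, so the horizon is uniform in `q`.
  have hev : ∀ᶠ n : ℕ in atTop, ∀ s : X × Memory v,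
      ((stepMean (transitionProb C φ ψ rate))^[n] f (w₀ s)).toReal / n < δ :=
    eventually_all.2 fun s => (hlim s).2.eventually (gt_mem_nhds hδ)
  filter_upwards [hev, eventually_gt_atTop 0] with n hn hn0 q hq x m
  have h1 := le_value_add_iterate_stepMean C ψ φ hr hq n (w₀ (x, m))
  have hσ : 0 ≤ ∑ i, q i := Finset.sum_nonneg fun i _ => hq i
  have hval : 0 ≤ value (recTrans C ψ) (allocMean C ψ) 1 q n x m :=
    value_nonneg (recTrans_nonneg C ψ) (allocMean_nonneg C ψ) zero_le_one hq n x m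
  have h2 : (stepMean (transitionProb C φ ψ rate))^[n]
      (fun s => ENNReal.ofReal (∑ i, q i * s.queue i)) (w₀ (x, m)) ≤
      ENNReal.ofReal ((∑ i, q i) *
        ((stepMean (transitionProb C φ ψ rate))^[n] f (w₀ (x, m))).toReal) := by
    rw [ENNReal.ofReal_mul hσ, ENNReal.ofReal_toReal ((hlim (x, m)).1 n),
      ← iterate_stepMean_const_mul]
    refine iterate_stepMean_mono (fun s => ?_) n _
    rw [hf]
    simp only
    rw [← ENNReal.ofReal_natCast, ← ENNReal.ofReal_mul hσ, Finset.sum_mul]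
    refine ENNReal.ofReal_le_ofReal (Finset.sum_le_sum fun i _ => ?_)
    exact mul_le_mul_of_nonneg_left (by exact_mod_cast Finset.le_sup (Finset.mem_univ i)) (hq i)
  have h3 := h1.trans (add_le_add le_rfl h2)
  rw [← ENNReal.ofReal_add hval (mul_nonneg hσ ENNReal.toReal_nonneg),
    ENNReal.ofReal_le_ofReal_iff (add_nonneg hval (mul_nonneg hσ ENNReal.toReal_nonneg))] at h3
  simp only [hw₀, Nat.cast_zero, mul_zero, Finset.sum_const_zero, zero_add] at h3
  have h4 := (div_lt_iff₀ (by exact_mod_cast hn0 : (0 : ℝ) < n)).1 (hn (x, m))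
  have h5 := mul_le_mul_of_nonneg_left h4.le hσ
  simp only [hw₀] at h5
  linarith

/-- The factor `1 - η` leaves room to mix in the average of the schedules `c e⁽ⁱ⁾`, which is
positive in every coordinate. -/
theorem mul_schedule_mem_maxCapacityRegion (hserve : ServesEachQueue Sch) {d : Fin N → ℕ}
    (hd : d ∈ Sch) {η : ℝ} (hη : 0 < η) (hη1 : η ≤ 1) :
    (fun i => (1 - η) * (d i : ℝ)) ∈ maxCapacityRegion Sch := by
  obtain ⟨c, hc, hserve⟩ := hserve
  refine ⟨fun i => mul_nonneg (by linarith) (Nat.cast_nonneg _), ?_⟩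
  set A := (fun (d : Fin N → ℕ) (i : Fin N) => (d i : ℝ)) '' (Sch : Set (Fin N → ℕ)) with hA
  rcases isEmpty_or_nonempty (Fin N) with hN | hN
  · exact ⟨_, subset_convexHull ℝ A ⟨d, hd, rfl⟩, fun i => isEmptyElim i⟩
  have hN0 : (0 : ℝ) < Fintype.card (Fin N) := by exact_mod_cast Fintype.card_pos
  have hw : ∑ j : Fin N, (1 / (Fintype.card (Fin N) : ℝ)) •
      (fun i : Fin N => ((Pi.single j c : Fin N → ℕ) i : ℝ)) ∈ convexHull ℝ A := by
    refine (convex_convexHull ℝ A).sum_mem (fun _ _ => by positivity) ?_ fun j _ =>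
      subset_convexHull ℝ A ⟨_, hserve j, rfl⟩
    rw [Finset.sum_const, nsmul_eq_mul, Finset.card_univ]
    field_simp
  refine ⟨_, (convex_convexHull ℝ A) (subset_convexHull ℝ A ⟨d, hd, rfl⟩) hw
    (by linarith : 0 ≤ 1 - η) hη.le (by ring), fun i => ?_⟩
  simp only [Pi.add_apply, Pi.smul_apply, smul_eq_mul, Finset.sum_apply]
  rw [lt_add_iff_pos_right]
  refine mul_pos hη (Finset.sum_pos' (fun j _ => by positivity) ⟨i, Finset.mem_univ i, ?_⟩)
  rw [Pi.single_eq_same]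
  positivity

/-- Some schedule maximizes the weight and serves a proportion `1 / N` of the total weight. -/
theorem exists_max_schedule (hserve : ServesEachQueue Sch) (hSch : Sch.Nonempty) {q : Fin N → ℝ}
    (hq : ∀ i, 0 ≤ q i) :
    ∃ d ∈ Sch, (∀ d' ∈ Sch, ∑ i, q i * (d' i : ℝ) ≤ ∑ i, q i * (d i : ℝ)) ∧
      ∑ i, q i ≤ N * ∑ i, q i * (d i : ℝ) := by
  obtain ⟨d, hd, hmax⟩ := Finset.exists_max_image Sch (fun d => ∑ i, q i * (d i : ℝ)) hSch
  refine ⟨d, hd, hmax, ?_⟩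
  obtain ⟨c, hc, hserve⟩ := hserve
  have h1 : ∀ i ∈ Finset.univ, q i ≤ ∑ i, q i * (d i : ℝ) := by
    intro i _
    refine le_trans ?_ (hmax _ (hserve i))
    rw [Finset.sum_eq_single i (fun j _ hj => by simp [hj]) (by simp), Pi.single_eq_same]
    exact le_mul_of_one_le_right (hq i) (by exact_mod_cast hc)
  simpa using Finset.sum_le_card_nsmul _ _ _ h1

/-- The conditions on the receiver which are necessary for a capacity factor above `ρ₀`. -/
theorem achieves_of_smul_mem_capacityRegion [Fintype X] [Nonempty X] {φ : EncodingPolicy N X k v}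
    (hserve : ServesEachQueue Sch) (hSch : Sch.Nonempty) {ρ ρ₀ : ℝ} (hρ₀ : ρ₀ < ρ) (hρ0 : 0 ≤ ρ₀)
    (h : ∀ r ∈ maxCapacityRegion Sch, ρ • r ∈ capacityRegion C φ ψ) :
    Achieves C ψ ρ₀ ∧ HasReachableMemory C ψ ∧ ∀ d ∈ Sch, ∀ i, ρ * d i ≤ 1 := by
  have hρ : 0 < ρ := hρ0.trans_lt hρ₀
  have hmem : ∀ d ∈ Sch, ∀ η : ℝ, 0 < η → η ≤ 1 →
      ρ • (fun i => (1 - η) * (d i : ℝ)) ∈ capacityRegion C φ ψ := fun d hd η h0 h1 =>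
    h _ (mul_schedule_mem_maxCapacityRegion hserve hd h0 h1)
  refine ⟨?_, ?_, fun d hd i => ?_⟩
  -- One half of the gap `ρ - ρ₀` pays for strict domination (`hρη`), the other for the error `δ * ∑
  -- i, q i`, which is controlled by the maximal weight of a schedule.
  · set η := (ρ - ρ₀) / (2 * ρ) with hη
    have hη0 : 0 < η := div_pos (by linarith) (by linarith)
    have hη1 : η ≤ 1 := by rw [hη, div_le_one (by linarith)]; linarith
    have hρη : ρ * (1 - η) = (ρ + ρ₀) / 2 := by rw [hη]; field_simp; ring
    have hev : ∀ᶠ n : ℕ in atTop, ∀ d : Sch, ∀ q : Fin N → ℝ, (∀ i, 0 ≤ q i) → ∀ x m,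
        n * (∑ i, q i * (ρ • (fun i => (1 - η) * (d.1 i : ℝ))) i -
          ((ρ - ρ₀) / (2 * (N + 1))) * ∑ i, q i) ≤
        value (recTrans C ψ) (allocMean C ψ) 1 q n x m :=
      eventually_all.2 fun d => eventually_le_value C ψ (hmem d d.2 η hη0 hη1)
        (div_pos (by linarith) (by positivity))
    obtain ⟨n, hn, hn0⟩ := (hev.and (eventually_gt_atTop 0)).exists
    refine ⟨n, hn0, fun q hq d hd x m => ?_⟩
    obtain ⟨d', hd', hmax, hN⟩ := exists_max_schedule hserve hSch hq
    refine le_trans ?_ (hn ⟨d', hd'⟩ q hq x m)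
    refine mul_le_mul_of_nonneg_left ?_ (Nat.cast_nonneg n)
    have h1 : ∑ i, q i * (ρ • (fun i => (1 - η) * (d' i : ℝ))) i =
        (ρ + ρ₀) / 2 * ∑ i, q i * (d' i : ℝ) := by
      rw [← hρη, Finset.mul_sum]
      refine Finset.sum_congr rfl fun i _ => ?_
      simp only [Pi.smul_apply, smul_eq_mul]
      ring
    simp only at h1 ⊢
    rw [h1]
    set W := ∑ i, q i * (d' i : ℝ)
    have hW : 0 ≤ W := Finset.sum_nonneg fun i _ => mul_nonneg (hq i) (Nat.cast_nonneg _)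
    have h2 : (ρ - ρ₀) / (2 * (N + 1)) * ∑ i, q i ≤ (ρ - ρ₀) / 2 * W := by
      rw [div_mul_eq_mul_div, div_le_iff₀ (by positivity)]
      have h3 : ∑ i, q i ≤ (N + 1) * W := by linarith
      calc _ ≤ (ρ - ρ₀) * ((N + 1) * W) := mul_le_mul_of_nonneg_left h3 (by linarith)
        _ = _ := by ring
    have h4 := mul_le_mul_of_nonneg_left (hmax d hd) hρ0
    linarith
  · obtain ⟨d, hd⟩ := hSch
    exact hasReachableMemory_of_mem_capacityRegion C ψ (hmem d hd 1 one_pos le_rfl)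
  · by_contra hlt
    rw [not_le] at hlt
    -- With this `η` the rate of queue `i` is `(ρ * d i + 1) / 2 > 1`, impossible for Bernoulli
    -- arrivals.
    set η := (ρ * d i - 1) / (2 * (ρ * d i)) with hη
    have hη0 : 0 < η := div_pos (by linarith) (by linarith)
    have hη1 : η ≤ 1 := by rw [hη, div_le_one (by linarith)]; linarith
    have h1 := ((hmem d hd η hη0 hη1).1 i).2
    simp only [Pi.smul_apply, smul_eq_mul] at h1
    have h2 : ρ * ((1 - η) * d i) = (ρ * d i + 1) / 2 := by
      have : ρ * ((1 - η) * d i) = ρ * d i - η * (ρ * d i) := by ring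
      rw [this, hη]
      have h3 : ρ * (d i : ℝ) ≠ 0 := by linarith
      generalize ρ * (d i : ℝ) = t at *
      field_simp
      ring
    linarith

end Converse

/-! ### Sufficient conditions for a capacity factor -/

/-- The interval is cut into equal pieces, one for each element. The default value in `T` is reached
at the endpoint `1` only. -/
theorem exists_random_selection (A : Type*) [Fintype A] [Nonempty A] :
    ∃ g : unitInterval → A, (∀ a, MeasurableSet {u | g u = a}) ∧
      ∀ a, volume {u | g u = a} ≠ 0 := by
  classical
  set n := Fintype.card A with hn
  have hn0 : (0 : ℝ) < n := by exact_mod_cast Fintype.card_pos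
  set e := Fintype.equivFin A
  set T : ℕ → A := fun j => if h : j < n then e.symm ⟨j, h⟩ else Classical.arbitrary A with hT
  set fl : unitInterval → ℕ := fun u => ⌊(u : ℝ) * n⌋₊ with hfl
  have hmeas : Measurable fl := Nat.measurable_floor.comp (measurable_subtype_coe.mul_const _)
  refine ⟨fun u => T (fl u), fun a => hmeas (MeasurableSet.of_discrete (s := {j | T j = a})),
    fun a => ?_⟩
  have hi := (e a).2
  set i : ℕ := (e a : ℕ) with hi'
  have hin : (i : ℝ) + 1 ≤ n := by exact_mod_cast hi
  set l : unitInterval := ⟨i / n, by positivity, by rw [div_le_one hn0]; linarith⟩ with hl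
  set s : unitInterval := ⟨(i + 1) / n, by positivity, by rw [div_le_one hn0]; linarith⟩ with hs
  have hsub : Set.Ioo l s ⊆ {u | T (fl u) = a} := by
    intro u hu
    have h1 : (i : ℝ) / n < u := hu.1
    have h2 : (u : ℝ) < (i + 1) / n := hu.2
    rw [div_lt_iff₀ hn0] at h1
    rw [lt_div_iff₀ hn0] at h2
    have h3 : fl u = i := (Nat.floor_eq_iff (mul_nonneg u.2.1 hn0.le)).2 ⟨h1.le, h2⟩
    change T (fl u) = a
    rw [h3, hT]
    simp only
    rw [dif_pos hi]
    exact e.symm_apply_apply a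
  refine ne_bot_of_le_ne_bot ?_ (measure_mono hsub)
  rw [unitInterval.volume_Ioo, hl, hs]
  simp only [bot_eq_zero', ne_eq, ENNReal.ofReal_eq_zero, not_le, sub_pos]
  gcongr
  linarith

section Achievability

variable {N : ℕ} {Sch : Finset (Fin N → ℕ)} {X Y : Type*} [Fintype Y] {k v : ℕ}
  (C : Channel X Y) (ψ : AllocationPolicy Sch Y v)

theorem sum_mul_le_of_mem_convexHull {q y : Fin N → ℝ} {W : ℝ}
    (hW : ∀ d ∈ Sch, ∑ i, q i * (d i : ℝ) ≤ W)
    (hy : y ∈ convexHull ℝ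
      ((fun (d : Fin N → ℕ) (i : Fin N) => (d i : ℝ)) '' (Sch : Set (Fin N → ℕ)))) :
    ∑ i, q i * y i ≤ W := by
  have h : convexHull ℝ ((fun (d : Fin N → ℕ) (i : Fin N) => (d i : ℝ)) ''
      (Sch : Set (Fin N → ℕ))) ⊆ {y | ∑ i, q i * y i ≤ W} := by
    refine convexHull_min ?_ ?_
    · rintro _ ⟨d, hd, rfl⟩
      exact hW d hd
    · refine convex_halfSpace_le ⟨fun x y => ?_, fun c x => ?_⟩ W
      · simp [mul_add, Finset.sum_add_distrib]
      · simp only [Pi.smul_apply, smul_eq_mul, Finset.mul_sum]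
        exact Finset.sum_congr rfl fun i _ => by ring
  exact h hy

/-- An encoder memory of `k` bits can hold what an optimal controller has to know about the last
signal. -/
def IsImplementable [Fintype X] [Nonempty X] (k : ℕ) : Prop :=
  ∃ enc : X → Memory k, ∀ (β : ℝ) (q : Fin N → ℝ) (n : ℕ) (e : Memory k) (m : Memory v),
    ∃ x', ∀ x, enc x = e →
      objective (recTrans C ψ) (allocMean C ψ) β q
        (value (recTrans C ψ) (allocMean C ψ) β q n) x m x' =
      bellman (recTrans C ψ) (allocMean C ψ) β q
        (value (recTrans C ψ) (allocMean C ψ) β q n) x m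

/-- The moves of queues, signal and receiver memory which are possible without arrivals, for a
suitable choice of the next signal. -/
def DrainStep (t t' : (Fin N → ℕ) × X × Memory v) : Prop :=
  ∃ d ∈ Sch, jointWeight C ψ t.2.1 t.2.2 t'.2.1 t'.2.2 d ≠ 0 ∧
    t'.1 = nextQueue t.1 d fun _ => false

theorem nextQueue_false_le (q d : Fin N → ℕ) : nextQueue q d (fun _ => false) ≤ q := by
  intro i
  simp [nextQueue]

theorem exists_jointWeight_ne_zero_of_recTrans {x x' : X} {m m' : Memory v}
    (h : recTrans C ψ x m m' ≠ 0) : ∃ d ∈ Sch, jointWeight C ψ x m x' m' d ≠ 0 := by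
  rw [← sum_jointWeight_alloc C ψ x m x' m'] at h
  exact Finset.exists_ne_zero_of_sum_ne_zero h

theorem sum_lt_sum_of_le_of_ne {q q' : Fin N → ℕ} (h : q' ≤ q) (hne : q' ≠ q) :
    ∑ i, q' i < ∑ i, q i := by
  obtain ⟨i, hi⟩ := Function.ne_iff.1 hne
  exact Finset.sum_lt_sum (fun i _ => h i) ⟨i, Finset.mem_univ i, lt_of_le_of_ne (h i) hi⟩

/-- A positive value means that suitable signals offer service to a nonempty queue with positive
probability. Either the immediate reward is positive, or one moves to a memory with positive
remaining value; if that move changes the queues, it has already served one. -/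
theorem exists_drain_of_value_pos [Fintype X] [Nonempty X] (q : Fin N → ℕ) (n : ℕ) (x : X)
    (m : Memory v) (h : 0 < value (recTrans C ψ) (allocMean C ψ) 1 (fun i => (q i : ℝ)) n x m) :
    ∃ t, Relation.ReflTransGen (DrainStep C ψ) (q, x, m) t ∧ ∑ i, t.1 i < ∑ i, q i := by
  induction n generalizing x m with
  | zero => exact absurd h (by simp [value])
  | succ n ih =>
    rw [value_succ] at h
    obtain ⟨x', hx'⟩ := exists_objective_eq_bellman (p := recTrans C ψ) (r := allocMean C ψ)
      (β := 1) (q := fun i => (q i : ℝ))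
      (value (recTrans C ψ) (allocMean C ψ) 1 (fun i => (q i : ℝ)) n) x m
    rw [← hx', objective, one_mul] at h
    have hstep : ∀ m', ∀ d ∈ Sch, jointWeight C ψ x m x' m' d ≠ 0 →
        DrainStep C ψ (q, x, m) (nextQueue q d fun _ => false, x', m') :=
      fun m' d hd hj => ⟨d, hd, hj, rfl⟩
    by_cases h0 : ∑ i, (q i : ℝ) * allocMean C ψ x' m i = 0
    · rw [h0, zero_add] at h
      obtain ⟨m', _, hm'⟩ := Finset.exists_ne_zero_of_sum_ne_zero h.ne'
      obtain ⟨d, hd, hj⟩ := exists_jointWeight_ne_zero_of_recTrans C ψ (x' := x')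
        (left_ne_zero_of_mul hm')
      have hs := hstep m' d hd hj
      by_cases hq : nextQueue q d (fun _ => false) = q
      · rw [hq] at hs
        have hpos := (value_nonneg (recTrans_nonneg C ψ) (allocMean_nonneg C ψ) zero_le_one
          (q := fun i => (q i : ℝ)) (fun i => Nat.cast_nonneg _) n x' m').lt_of_ne'
            (right_ne_zero_of_mul hm')
        obtain ⟨t, ht, hlt⟩ := ih x' m' hpos
        exact ⟨t, ht.head hs, hlt⟩
      · exact ⟨_, Relation.ReflTransGen.single hs,
          sum_lt_sum_of_le_of_ne (nextQueue_false_le q d) hq⟩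
    · rw [allocMean_eq_sum_mul] at h0
      obtain ⟨d, hd, hne⟩ := Finset.exists_ne_zero_of_sum_ne_zero h0
      obtain ⟨i, _, hi⟩ := Finset.exists_ne_zero_of_sum_ne_zero (right_ne_zero_of_mul hne)
      have ha := left_ne_zero_of_mul hne
      rw [← sum_jointWeight_update C ψ x m x' d] at ha
      obtain ⟨m', _, hj⟩ := Finset.exists_ne_zero_of_sum_ne_zero ha
      refine ⟨_, Relation.ReflTransGen.single (hstep m' d hd hj),
        sum_lt_sum_of_le_of_ne (nextQueue_false_le q d) fun heq => ?_⟩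
      have h1 := congrFun heq i
      have h2 : q i ≠ 0 := fun h => hi (by simp [h])
      have h3 : d i ≠ 0 := fun h => hi (by simp [h])
      simp only [nextQueue, Bool.toNat_false] at h1
      omega

/-- Drain until the queues are empty, by induction on their total; then steer the memory to `z`
while they stay empty. -/
theorem reflTransGen_drainStep [Fintype X] [Nonempty X] {n : ℕ}
    (hval : ∀ q : Fin N → ℕ, q ≠ 0 → ∀ x m,
      0 < value (recTrans C ψ) (allocMean C ψ) 1 (fun i => (q i : ℝ)) n x m)
    {z : X × Memory v} (hz : ∀ s, Relation.ReflTransGen (RecStep C ψ) s z)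
    (t : (Fin N → ℕ) × X × Memory v) :
    Relation.ReflTransGen (DrainStep C ψ) t (0, z) := by
  obtain ⟨q, s⟩ := t
  induction hn : ∑ i, q i using Nat.strong_induction_on generalizing q s with
  | _ b ih =>
    by_cases hq : q = 0
    · subst hq
      refine Relation.ReflTransGen.lift (fun s => ((0 : Fin N → ℕ), s)) (fun s s' hs => ?_) s z (hz s)
      obtain ⟨d, hd, hj⟩ := exists_jointWeight_ne_zero_of_recTrans C ψ (x' := s'.1) hs
      exact ⟨d, hd, hj, by funext i; simp [nextQueue]⟩
    · obtain ⟨⟨q', s'⟩, ht, hlt⟩ := exists_drain_of_value_pos C ψ q n s.1 s.2 (hval q hq s.1 s.2)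
      exact ht.trans (ih _ (hn ▸ hlt) q' s' rfl)

theorem finite_setOf_sum_queue_le [Finite X] (B : ℕ) :
    {w : State N X k v | ∑ i, w.queue i ≤ B}.Finite := by
  have h1 : {q : Fin N → ℕ | ∑ i, q i ≤ B}.Finite :=
    (Set.finite_Iic fun _ : Fin N => B).subset fun q hq i =>
      (Finset.single_le_sum (fun _ _ => Nat.zero_le _) (Finset.mem_univ i)).trans hq
  have h2 := h1.prod (Set.finite_univ (α := (Fin N → Bool) × Memory k × X × Memory v))
  refine (h2.preimage (f := fun w : State N X k v =>
    (w.queue, w.arrival, w.encMem, w.signal, w.recMem)) ?_).subset fun w hw => ⟨hw, trivial⟩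
  rintro ⟨⟩ _ ⟨⟩ _ h
  simpa using h

open Classical in
/-- The encoding policy that selects a random signal for short queues, and the signal `f` for long
ones. The last signal is stored in the memory by `enc`. -/
noncomputable def thresholdPolicy (B : ℕ) (enc : X → Memory k) (g : unitInterval → X)
    (hg : ∀ x, MeasurableSet {u | g u = x}) (f : (Fin N → ℕ) → Memory k → Memory v → X) :
    EncodingPolicy N X k v where
  encode q _ e m u :=
    if ∑ i, q i ≤ B then (g u, enc (g u)) else (f q e m, enc (f q e m))
  measurable_encode q _ e m p := by
    by_cases h : ∑ i, q i ≤ B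
    · simp only [h, if_true]
      by_cases hp : enc p.1 = p.2
      · convert hg p.1 using 3 with u
        constructor
        · rintro rfl; rfl
        · rintro hu; rw [hu, hp]
      · convert MeasurableSet.empty using 1
        ext u
        simp only [Set.mem_ofPred_eq, Set.mem_empty_iff_false, iff_false]
        rintro rfl
        exact hp rfl
    · simp only [h, if_false]
      exact MeasurableSet.const _

theorem sq_nextQueue_le (q d : ℕ) (b : Bool) :
    ((q - d + b.toNat : ℕ) : ℝ) ^ 2 ≤
      (q : ℝ) ^ 2 + 2 * q * ((b.toNat : ℝ) - d) + d ^ 2 + 1 := by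
  have hb : (b.toNat : ℝ) ^ 2 ≤ 1 := by cases b <;> simp
  have hb0 : (0 : ℝ) ≤ b.toNat := Nat.cast_nonneg _
  have hd0 : (0 : ℝ) ≤ d := Nat.cast_nonneg _
  have hq0 : (0 : ℝ) ≤ q := Nat.cast_nonneg _
  rcases le_total d q with h | h
  · push_cast [Nat.cast_sub h]
    nlinarith [mul_nonneg hb0 hd0]
  · rw [Nat.sub_eq_zero_of_le h]
    push_cast
    nlinarith [mul_nonneg hq0 hb0, sq_nonneg ((q : ℝ) - d)]

theorem abs_sub_nextQueue_le (q d : ℕ) (b : Bool) :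
    |(q : ℝ) - ((q - d + b.toNat : ℕ) : ℝ)| ≤ d + 1 := by
  have hb : b.toNat ≤ 1 := Bool.toNat_le b
  have h1 : q ≤ (q - d + b.toNat) + (d + 1) := by omega
  have h2 : q - d + b.toNat ≤ q + (d + 1) := by omega
  have h1' : (q : ℝ) ≤ ((q - d + b.toNat : ℕ) : ℝ) + (d + 1) := by exact_mod_cast h1
  have h2' : ((q - d + b.toNat : ℕ) : ℝ) ≤ q + (d + 1) := by exact_mod_cast h2
  rw [abs_le]
  constructor <;> linarith

end Achievability

section Achievability

variable {N : ℕ} {Sch : Finset (Fin N → ℕ)} {X Y : Type*} [Fintype Y] {k v : ℕ}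
  (C : Channel X Y) (ψ : AllocationPolicy Sch Y v)

/-- Draining never lengthens queues, so the path stays where every signal has positive probability;
slots without arrivals have positive probability because rates are below one. -/
theorem transGen_of_reflTransGen_drainStep [Fintype X] (φ : EncodingPolicy N X k v)
    {rate : Fin N → ℝ} (hr : ∀ i, 0 ≤ rate i ∧ rate i < 1) {B : ℕ} (enc : X → Memory k)
    (hφ : ∀ w : State N X k v, ∑ i, w.queue i ≤ B → ∀ x, encWeight φ w (x, enc x) ≠ 0)
    {z : X × Memory v}
    (h : ∀ t, Relation.ReflTransGen (DrainStep C ψ) t ((0 : Fin N → ℕ), z))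
    (w : State N X k v) (hw : ∑ i, w.queue i ≤ B) :
    Relation.TransGen (fun w s => transitionProb C φ ψ rate w s ≠ 0) w
      ⟨fun _ => 0, fun _ => false, enc z.1, z.1, z.2⟩ := by
  have hr' : ∀ i, 0 ≤ rate i ∧ rate i ≤ 1 := fun i => ⟨(hr i).1, (hr i).2.le⟩
  have ha : arrivalWeight rate (fun _ => false) ≠ 0 := by
    refine Finset.prod_ne_zero_iff.2 fun i _ => ?_
    simp only [Bool.false_eq_true, if_false]
    linarith [(hr i).2]
  set st : (Fin N → ℕ) × X × Memory v → State N X k v := fun t =>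
    ⟨t.1, fun _ => false, enc t.2.1, t.2.1, t.2.2⟩ with hst
  have hstep : ∀ (w : State N X k v) t', ∑ i, w.queue i ≤ B →
      DrainStep C ψ (w.queue, w.signal, w.recMem) t' →
      transitionProb C φ ψ rate w (st t') ≠ 0 ∧ ∑ i, t'.1 i ≤ B := by
    rintro w ⟨q', x', m'⟩ hw ⟨d, hd, hj, hq⟩
    simp only at hq hj
    subst hq
    exact ⟨transitionProb_ne_zero C ψ φ hr' (e := (x', enc x')) hd ha (hφ w hw x') hj,
      (Finset.sum_le_sum fun i _ => nextQueue_false_le w.queue d i).trans hw⟩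
  have hlift : ∀ t, ∑ i, t.1 i ≤ B → Relation.ReflTransGen
      (fun w s => transitionProb C φ ψ rate w s ≠ 0) (st t) (st ((0 : Fin N → ℕ), z)) := by
    intro t
    induction h t using Relation.ReflTransGen.head_induction_on with
    | refl => exact fun _ => Relation.ReflTransGen.refl
    | head hs _ ih =>
      intro ht
      obtain ⟨h1, h2⟩ := hstep (st _) _ ht hs
      exact Relation.ReflTransGen.head h1 (ih h2)
  -- The arrivals and encoder memory of `w` are arbitrary; one preliminary step brings the state
  -- into the form `st`.
  obtain ⟨m', _, hm'⟩ : ∃ m' ∈ Finset.univ, recTrans C ψ w.signal w.recMem m' ≠ 0 :=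
    Finset.exists_ne_zero_of_sum_ne_zero (by rw [sum_recTrans]; exact one_ne_zero)
  obtain ⟨d, hd, hj⟩ := exists_jointWeight_ne_zero_of_recTrans C ψ (x' := w.signal) hm'
  obtain ⟨h1, h2⟩ := hstep w (nextQueue w.queue d fun _ => false, w.signal, m') hw ⟨d, hd, hj, rfl⟩
  exact Relation.TransGen.head' h1 (hlift _ h2)

theorem encWeight_thresholdPolicy_of_le {B : ℕ} {enc : X → Memory k} {g : unitInterval → X}
    (hg : ∀ x, MeasurableSet {u | g u = x}) (hg0 : ∀ x, volume {u | g u = x} ≠ 0)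
    (f : (Fin N → ℕ) → Memory k → Memory v → X) (w : State N X k v)
    (hw : ∑ i, w.queue i ≤ B) (x : X) :
    encWeight (thresholdPolicy B enc g hg f) w (x, enc x) ≠ 0 := by
  have : {u : unitInterval | (thresholdPolicy B enc g hg f).encode w.queue w.arrival w.encMem
      w.recMem u = (x, enc x)} = {u | g u = x} := by
    ext u
    simp only [thresholdPolicy, hw, if_true, Set.mem_ofPred_eq, Prod.mk.injEq]
    exact ⟨fun h => h.1, fun h => ⟨h, by rw [h]⟩⟩
  rw [encWeight, this]
  exact ENNReal.toReal_ne_zero.2 ⟨hg0 x, measure_ne_top _ _⟩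

theorem eq_of_encWeight_thresholdPolicy_ne_zero {B : ℕ} {enc : X → Memory k}
    {g : unitInterval → X} (hg : ∀ x, MeasurableSet {u | g u = x})
    (f : (Fin N → ℕ) → Memory k → Memory v → X) (w : State N X k v) {e : X × Memory k}
    (he : encWeight (thresholdPolicy B enc g hg f) w e ≠ 0) :
    e.2 = enc e.1 ∧ (B < ∑ i, w.queue i → e.1 = f w.queue w.encMem w.recMem) := by
  obtain ⟨u, hu⟩ : {u : unitInterval | (thresholdPolicy B enc g hg f).encode w.queue w.arrival
      w.encMem w.recMem u = e}.Nonempty := by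
    rw [Set.nonempty_iff_ne_empty]
    intro h0
    exact he (by rw [encWeight, h0]; simp)
  simp only [thresholdPolicy, Set.mem_ofPred_eq] at hu
  split_ifs at hu with h
  · subst hu
    exact ⟨rfl, fun h' => absurd h (not_le.2 h')⟩
  · subst hu
    exact ⟨rfl, fun _ => rfl⟩

/-- The quadratic Lyapunov function, corrected by the values of the controlled receiver. -/
noncomputable def lyapunov [Fintype X] [Nonempty X] (β : ℝ) (n : ℕ) (c : ℝ)
    (w : State N X k v) : ℝ :=
  ∑ i, (w.queue i : ℝ) ^ 2 / 2 - value (recTrans C ψ) (allocMean C ψ) β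
    (fun i => (w.queue i : ℝ)) n w.signal w.recMem + c

theorem allocMean_le {D : ℕ} (hD : ∀ d ∈ Sch, ∀ i, d i ≤ D) (x : X) (m : Memory v) (i : Fin N) :
    allocMean C ψ x m i ≤ D := by
  calc allocMean C ψ x m i ≤ ∑ d ∈ Sch, allocProb C ψ x m d * D :=
        Finset.sum_le_sum fun d hd => mul_le_mul_of_nonneg_left (by exact_mod_cast hD d hd i)
          (allocProb_nonneg C ψ x m d)
    _ = D := by rw [← Finset.sum_mul, sum_allocProb, one_mul]

/-- The value is at most `n * D` times the total queue, and the constant completes the squares. -/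
theorem lyapunov_nonneg [Fintype X] [Nonempty X] {D : ℕ} (hD : ∀ d ∈ Sch, ∀ i, d i ≤ D)
    {β : ℝ} (hβ : 0 ≤ β) (hβ1 : β ≤ 1) (n : ℕ) (w : State N X k v) :
    0 ≤ lyapunov C ψ β n (∑ _i : Fin N, ((n * D : ℕ) : ℝ) ^ 2 / 2) w := by
  have h1 := value_le (recTrans_nonneg C ψ) (sum_recTrans C ψ) (allocMean_nonneg C ψ)
    (allocMean_le C ψ hD) hβ hβ1 (q := fun i => (w.queue i : ℝ)) (fun i => Nat.cast_nonneg _) n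
    w.signal w.recMem
  have h2 : 0 ≤ ∑ i, ((w.queue i : ℝ) ^ 2 / 2 - n * (D * w.queue i) + ((n * D : ℕ) : ℝ) ^ 2 / 2) :=
    Finset.sum_nonneg fun i _ => by
      push_cast
      nlinarith [sq_nonneg ((w.queue i : ℝ) - n * D)]
  rw [Finset.sum_add_distrib, Finset.sum_sub_distrib, ← Finset.mul_sum, ← Finset.mul_sum] at h2
  rw [lyapunov]
  linarith

/-- Freezing the weights of the value at the old queues costs a constant, by `value_le_value_add`.
The bound is then a sum of functions of arrivals, allocation and memory, as in `slotMean_add_add`.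
-/
theorem lyapunov_next_le [Fintype X] [Nonempty X] {D : ℕ} (hD : ∀ d ∈ Sch, ∀ i, d i ≤ D)
    {β : ℝ} (hβ : 0 ≤ β) (hβ1 : β ≤ 1) (n : ℕ) (c : ℝ) (q : Fin N → ℕ) (a : Fin N → Bool)
    (me : Memory k) (x' : X) (m' : Memory v) {d : Fin N → ℕ} (hd : d ∈ Sch) :
    lyapunov C ψ β n c ⟨nextQueue q d a, a, me, x', m'⟩ ≤
      ∑ i, (q i : ℝ) * (a i).toNat + -∑ i, (q i : ℝ) * d i +
      (-value (recTrans C ψ) (allocMean C ψ) β (fun i => (q i : ℝ)) n x' m' +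
        (∑ i, (q i : ℝ) ^ 2 / 2 + c + (N * ((D : ℝ) ^ 2 + 1) / 2 + n * (D * (N * (D + 1)))))) := by
  have h1 := value_le_value_add (recTrans_nonneg C ψ) (sum_recTrans C ψ) (allocMean_nonneg C ψ)
    (allocMean_le C ψ hD) hβ hβ1 (fun i => (q i : ℝ)) (fun i => (nextQueue q d a i : ℝ)) n x' m'
  have h2 : ∑ i, |(q i : ℝ) - (nextQueue q d a i : ℝ)| ≤ N * (D + 1) := by
    calc _ ≤ ∑ _i : Fin N, ((D : ℝ) + 1) := Finset.sum_le_sum fun i _ =>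
          (abs_sub_nextQueue_le (q i) (d i) (a i)).trans
            (by have : (d i : ℝ) ≤ D := by exact_mod_cast hD d hd i
                linarith)
      _ = _ := by
        simp only [Finset.sum_const, Finset.card_univ, Fintype.card_fin, nsmul_eq_mul]
  have h3 : ∑ i, ((nextQueue q d a i : ℕ) : ℝ) ^ 2 / 2 ≤ ∑ i, ((q i : ℝ) ^ 2 / 2 +
      (q i : ℝ) * (a i).toNat + -((q i : ℝ) * d i) + ((D : ℝ) ^ 2 + 1) / 2) := by
    refine Finset.sum_le_sum fun i _ => ?_
    have h4 := sq_nextQueue_le (q i) (d i) (a i)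
    have h5 : (d i : ℝ) ≤ D := by exact_mod_cast hD d hd i
    have h6 : (d i : ℝ) ^ 2 ≤ (D : ℝ) ^ 2 := by gcongr
    simp only [nextQueue]
    linarith
  have h7 : (n : ℝ) * (D * ∑ i, |(q i : ℝ) - (nextQueue q d a i : ℝ)|) ≤
      n * (D * (N * (D + 1))) := by gcongr
  simp only [Finset.sum_add_distrib, Finset.sum_neg_distrib, Finset.sum_const, Finset.card_univ,
    Fintype.card_fin, nsmul_eq_mul] at h3
  simp only [lyapunov]
  linarith

/-- The drift of the Lyapunov function under the threshold policy, for long queues. -/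
theorem slotMean_lyapunov_le [Fintype X] [Nonempty X] {D : ℕ} (hD : ∀ d ∈ Sch, ∀ i, d i ≤ D)
    {β : ℝ} (hβ : 0 ≤ β) (hβ1 : β ≤ 1) (n : ℕ) (c : ℝ) {B : ℕ} {enc : X → Memory k}
    {g : unitInterval → X} (hg : ∀ x, MeasurableSet {u | g u = x})
    {f : (Fin N → ℕ) → Memory k → Memory v → X}
    (hf : ∀ q x m, objective (recTrans C ψ) (allocMean C ψ) β (fun i => (q i : ℝ))
        (value (recTrans C ψ) (allocMean C ψ) β (fun i => (q i : ℝ)) n) x m (f q (enc x) m) =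
      bellman (recTrans C ψ) (allocMean C ψ) β (fun i => (q i : ℝ))
        (value (recTrans C ψ) (allocMean C ψ) β (fun i => (q i : ℝ)) n) x m)
    {rate : Fin N → ℝ} (hr : ∀ i, 0 ≤ rate i ∧ rate i ≤ 1) (w : State N X k v)
    (hw : B < ∑ i, w.queue i) (hwG : w.encMem = enc w.signal) {W : ℝ}
    (hW : ∀ x m, W ≤ (1 - β) * value (recTrans C ψ) (allocMean C ψ) β
      (fun i => (w.queue i : ℝ)) n x m) :
    slotMean C ψ (thresholdPolicy B enc g hg f) rate w
        (fun a e m' d => lyapunov C ψ β n c ⟨nextQueue w.queue d a, a, e.2, e.1, m'⟩) ≤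
      lyapunov C ψ β n c w + (∑ i, w.queue i * rate i - W +
        (N * ((D : ℝ) ^ 2 + 1) / 2 + n * (D * (N * (D + 1))))) := by
  set φ := thresholdPolicy B enc g hg f
  set q : Fin N → ℝ := fun i => (w.queue i : ℝ) with hq
  set x' := f w.queue (enc w.signal) w.recMem with hx'
  set u := value (recTrans C ψ) (allocMean C ψ) β q n with hu
  set c' := ∑ i, q i ^ 2 / 2 + c + (N * ((D : ℝ) ^ 2 + 1) / 2 + n * (D * (N * (D + 1)))) with hc'
  refine (slotMean_mono C ψ φ hr w (G := fun a e m' d => ∑ i, q i * (a i).toNat +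
    -∑ i, q i * d i + (-u e.1 m' + c')) fun a e m' d hd _ =>
      lyapunov_next_le C ψ hD hβ hβ1 n c w.queue a e.2 e.1 m' hd).trans ?_
  rw [slotMean_add_add C ψ φ rate w (fun a => ∑ i, q i * ((a i).toNat : ℝ))
    (fun d => - ∑ i, q i * (d i : ℝ)) (fun e m' => -u e.1 m' + c')]
  simp only [sum_arrivalWeight_mul_sum, mul_neg, Finset.sum_neg_distrib, mul_add,
    Finset.sum_add_distrib, ← allocMean_eq_sum_mul, ← Finset.sum_mul, sum_recTrans,
    sum_encWeight, one_mul]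
  -- Above the threshold the policy is deterministic, and by `hwG` the encoder memory is the code of
  -- the last signal, so the optimal signal is sent.
  have hconc : ∀ h : X → ℝ, ∑ e, encWeight φ w e * h e.1 = h x' := by
    intro h
    rw [← one_mul (h x'), ← sum_encWeight φ w, Finset.sum_mul]
    refine Finset.sum_congr rfl fun e _ => ?_
    by_cases he : encWeight φ w e = 0
    · simp [he]
    · rw [(eq_of_encWeight_thresholdPolicy_ne_zero hg f w he).2 hw, hx', hwG]
  rw [hconc (fun x => ∑ i, q i * allocMean C ψ x w.recMem i),
    hconc (fun x => ∑ m', recTrans C ψ w.signal w.recMem m' * u x m')]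
  -- The Bellman inequality: present value minus service minus mean next value is at most `-(1 - β)`
  -- times the mean next value, which `h3` bounds by `-W`.
  have h1 : u w.signal w.recMem ≤ ∑ i, q i * allocMean C ψ x' w.recMem i +
      β * ∑ m', recTrans C ψ w.signal w.recMem m' * u x' m' := by
    have h2 := hf w.queue w.signal w.recMem
    rw [← hq, ← hu, objective] at h2
    rw [h2, hu, ← value_succ]
    exact value_le_value_succ (recTrans_nonneg C ψ) (allocMean_nonneg C ψ) hβ
      (fun i => Nat.cast_nonneg _) n _ _
  have h3 : W ≤ (1 - β) * ∑ m', recTrans C ψ w.signal w.recMem m' * u x' m' := by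
    calc W = ∑ m', recTrans C ψ w.signal w.recMem m' * W := by
          rw [← Finset.sum_mul, sum_recTrans, one_mul]
      _ ≤ ∑ m', recTrans C ψ w.signal w.recMem m' * ((1 - β) * u x' m') :=
          Finset.sum_le_sum fun m' _ =>
            mul_le_mul_of_nonneg_left (hW x' m') (recTrans_nonneg C ψ _ _ _)
      _ = _ := by
          rw [Finset.mul_sum]
          exact Finset.sum_congr rfl fun m' _ => by ring
  have h4 : lyapunov C ψ β n c w = ∑ i, q i ^ 2 / 2 - u w.signal w.recMem + c := rfl
  have h5 : ∑ i, (w.queue i : ℝ) * rate i = ∑ i, q i * rate i := rfl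
  rw [h4, h5, hc']
  linarith

/-- A receiver that achieves more than `ρ'` has an encoder that stabilizes `ρ' Λ`. -/
theorem exists_policy_of_achieves [Fintype X] [Nonempty X] (hserve : ServesEachQueue Sch)
    (hSch : Sch.Nonempty) {ρ ρ' : ℝ} (hρ0 : 0 ≤ ρ') (hρ : ρ' < ρ) (hach : Achieves C ψ ρ)
    (hreach : HasReachableMemory C ψ) (himp : IsImplementable C ψ k)
    (hrate : ∀ d ∈ Sch, ∀ i, ρ' * d i ≤ 1) :
    ∃ φ : EncodingPolicy N X k v, ∀ r ∈ maxCapacityRegion Sch, ρ' • r ∈ capacityRegion C φ ψ := by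
  obtain ⟨n₀, hn₀, hach⟩ := hach
  obtain ⟨z, hz⟩ := hreach
  obtain ⟨enc, himp⟩ := himp
  obtain ⟨D, hD⟩ : ∃ D : ℕ, ∀ d ∈ Sch, ∀ i, d i ≤ D := by
    refine ⟨∑ d ∈ Sch, ∑ i, d i, fun d hd i => ?_⟩
    exact (Finset.single_le_sum (f := d) (fun _ _ => Nat.zero_le _) (Finset.mem_univ i)).trans
      (Finset.single_le_sum (f := fun d : Fin N → ℕ => ∑ i, d i) (fun _ _ => Nat.zero_le _) hd)
  -- Discount factor and horizon are fixed for all weights, with a target halfway between `ρ'` and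
  -- `ρ`.
  obtain ⟨β, hβ, hβ1, n, hval⟩ := exists_discount_le_value (recTrans_nonneg C ψ)
    (sum_recTrans C ψ) (allocMean_nonneg C ψ) hn₀ (hρ0.trans hρ.le)
    (show (ρ' + ρ) / 2 < ρ by linarith)
  choose f hf using fun (q : Fin N → ℕ) (e : Memory k) (m : Memory v) =>
    himp β (fun i => (q i : ℝ)) n e m
  obtain ⟨g, hg, hg0⟩ := exists_random_selection X
  set C₁ : ℝ := N * ((D : ℝ) ^ 2 + 1) / 2 + n * (D * (N * (D + 1))) with hC₁
  have hC₁0 : 0 ≤ C₁ := by positivity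
  -- The maximal weight `W` is at least a proportion `1 / N` of the total queue, so a total above
  -- `B` gives `C₁ + 1 ≤ (ρ - ρ') / 2 * W`.
  obtain ⟨B, hB⟩ := exists_nat_ge (N * (C₁ + 1) / ((ρ - ρ') / 2))
  refine ⟨thresholdPolicy B enc g hg f, fun r hr => ?_⟩
  obtain ⟨hr0, y, hy, hry⟩ := hr
  have hrate0 : ∀ i, 0 ≤ (ρ' • r) i := fun i => mul_nonneg hρ0 (hr0 i)
  have hrate1 : ∀ i, (ρ' • r) i < 1 := by
    intro i
    simp only [Pi.smul_apply, smul_eq_mul]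
    rcases hρ0.eq_or_lt with h0 | h0
    · simp [← h0]
    · have h1 := sum_mul_le_of_mem_convexHull (q := Pi.single i ρ') (W := 1) (fun d hd => by
        rw [Finset.sum_eq_single i (fun j _ hj => by simp [hj]) (by simp), Pi.single_eq_same]
        exact hrate d hd i) hy
      rw [Finset.sum_eq_single i (fun j _ hj => by simp [hj]) (by simp), Pi.single_eq_same] at h1
      exact (mul_lt_mul_of_pos_left (hry i) h0).trans_le h1
  have hrate' : ∀ i, 0 ≤ (ρ' • r) i ∧ (ρ' • r) i ≤ 1 := fun i => ⟨hrate0 i, (hrate1 i).le⟩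
  set φ := thresholdPolicy B enc g hg f with hφ
  set V : State N X k v → ℝ :=
    lyapunov C ψ β n (∑ _i : Fin N, ((n * D : ℕ) : ℝ) ^ 2 / 2) with hV
  have hV0 : ∀ w, 0 ≤ V w := lyapunov_nonneg C ψ hD hβ hβ1.le n
  have hpos : ∀ q : Fin N → ℕ, q ≠ 0 → ∀ x m,
      0 < value (recTrans C ψ) (allocMean C ψ) 1 (fun i => (q i : ℝ)) n₀ x m := by
    intro q hq x m
    have hq0 : ∀ i, (0 : ℝ) ≤ (q i : ℝ) := fun i => Nat.cast_nonneg _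
    obtain ⟨d, hd, _, hN⟩ := exists_max_schedule hserve hSch hq0
    refine lt_of_lt_of_le ?_ (hach _ hq0 d hd x m)
    have h1 : 0 < ∑ i, (q i : ℝ) := by
      obtain ⟨i, hi⟩ := Function.ne_iff.1 hq
      exact Finset.sum_pos' (fun i _ => hq0 i) ⟨i, Finset.mem_univ i,
        by exact_mod_cast Nat.pos_of_ne_zero hi⟩
    have h2 : 0 < ∑ i, (q i : ℝ) * d i := by
      by_contra h
      nlinarith [Nat.cast_nonneg (α := ℝ) N]
    have h3 : 0 < ρ := hρ0.trans_lt hρ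
    positivity
  refine ⟨hrate', ⟨fun _ => 0, fun _ => false, enc z.1, z.1, z.2⟩, fun w => ?_⟩
  refine meanHittingTime_lt_top_of_drift (tsum_transitionProb C ψ φ hrate')
    (V := fun s => ENNReal.ofReal (V s)) (fun _ => ENNReal.ofReal_lt_top) (fun w => ?_)
    (G := {w | w.encMem = enc w.signal}) (finite_setOf_sum_queue_le B)
    (fun w s hws => ?_) (fun w hwG hwK => ?_) (fun w hw => ?_) w
  · rw [stepMean_transitionProb C ψ φ hrate' w hV0]
    exact ENNReal.ofReal_lt_top
  · obtain ⟨a, e, m', d, hd, rfl, he, _⟩ := exists_of_transitionProb_ne_zero C ψ φ hrate' hws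
    exact (eq_of_encWeight_thresholdPolicy_ne_zero hg f w he).1
  · rw [stepMean_transitionProb C ψ φ hrate' w hV0, ← ENNReal.ofReal_one, ← ENNReal.ofReal_add
      (slotMean_nonneg C ψ φ hrate' w fun _ _ _ _ => hV0 _) zero_le_one]
    refine ENNReal.ofReal_le_ofReal ?_
    have hwK' : B < ∑ i, w.queue i := not_le.1 hwK
    have hq0 : ∀ i, (0 : ℝ) ≤ (w.queue i : ℝ) := fun i => Nat.cast_nonneg _
    obtain ⟨d, hd, hmax, hN⟩ := exists_max_schedule hserve hSch hq0
    set W := ∑ i, (w.queue i : ℝ) * d i with hWdef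
    have hW0 : 0 ≤ W := Finset.sum_nonneg fun i _ => mul_nonneg (hq0 i) (Nat.cast_nonneg _)
    have hdrift := slotMean_lyapunov_le C ψ hD hβ hβ1.le n
      (∑ _i : Fin N, ((n * D : ℕ) : ℝ) ^ 2 / 2) hg
      (fun q x m => hf q (enc x) m x rfl) hrate' w hwK' hwG
      (hval _ hq0 W hW0 fun x m => hach _ hq0 d hd x m)
    have hload : ∑ i, (w.queue i : ℝ) * (ρ' • r) i ≤ ρ' * W := by
      have h1 := sum_mul_le_of_mem_convexHull (fun d hd => hmax d hd) hy
      calc ∑ i, (w.queue i : ℝ) * (ρ' • r) i = ρ' * ∑ i, (w.queue i : ℝ) * r i := by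
            rw [Finset.mul_sum]
            refine Finset.sum_congr rfl fun i _ => ?_
            simp only [Pi.smul_apply, smul_eq_mul]
            ring
        _ ≤ ρ' * ∑ i, (w.queue i : ℝ) * y i := by
            gcongr with i
            exact (hry i).le
        _ ≤ ρ' * W := mul_le_mul_of_nonneg_left h1 hρ0
    have hBW : C₁ + 1 ≤ (ρ - ρ') / 2 * W := by
      rw [div_le_iff₀ (by linarith)] at hB
      have h1 : (B : ℝ) < ∑ i, (w.queue i : ℝ) := by exact_mod_cast hwK'
      have hρρ : 0 < (ρ - ρ') / 2 := by linarith
      have h2 : (N : ℝ) * (C₁ + 1) ≤ N * ((ρ - ρ') / 2 * W) := by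
        calc (N : ℝ) * (C₁ + 1) ≤ B * ((ρ - ρ') / 2) := hB
          _ ≤ (N * W) * ((ρ - ρ') / 2) :=
            mul_le_mul_of_nonneg_right (h1.le.trans hN) hρρ.le
          _ = _ := by ring
      have hN0 : (0 : ℝ) < N := by
        rcases Nat.eq_zero_or_pos N with h0 | h0
        · subst h0
          simp only [Nat.cast_zero, zero_mul] at hN
          linarith [Nat.cast_nonneg (α := ℝ) B]
        · exact_mod_cast h0
      exact le_of_mul_le_mul_left h2 hN0
    linarith
  · refine survival_lt_one_of_transGen (tsum_transitionProb C ψ φ hrate') ?_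
    exact transGen_of_reflTransGen_drainStep C ψ φ (fun i => ⟨hrate0 i, hrate1 i⟩) enc
      (fun w hw x => encWeight_thresholdPolicy_of_le hg hg0 f w hw x)
      (reflTransGen_drainStep C ψ hpos hz) w hw

end Achievability

/-! ### The effect of the encoder memory -/

section EncoderMemory

variable {N : ℕ} {Sch : Finset (Fin N → ℕ)} {X Y : Type*} [Fintype X] [Nonempty X] [Fintype Y]
  {k v : ℕ} {C : Channel X Y}

omit [Fintype X] [Nonempty X] in
theorem le_capacityFactor {φ : EncodingPolicy N X k v} {ψ : AllocationPolicy Sch Y v} {ρ : ℝ≥0}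
    (h : ∀ r ∈ maxCapacityRegion Sch, (ρ : ℝ) • r ∈ capacityRegion C φ ψ) :
    (ρ : ℝ≥0∞) ≤ capacityFactor Sch C k v :=
  (le_iSup₂_of_le (f := fun (ρ : ℝ≥0) (_ : ∀ r ∈ maxCapacityRegion Sch,
    (ρ : ℝ) • r ∈ capacityRegion C φ ψ) => (ρ : ℝ≥0∞)) ρ h le_rfl).trans
    (le_iSup₂_of_le (f := fun (φ : EncodingPolicy N X k v) (ψ : AllocationPolicy Sch Y v) =>
      policyCapacityFactor C φ ψ) φ ψ le_rfl)

/-- The necessary conditions involve the receiver only, so the encoder and its memory size drop out.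
The detour through `s < ρ₀ < ρ` leaves the gap that the construction of a new encoder needs. -/
theorem capacityFactor_le_of_forall (hserve : ServesEachQueue Sch) (hSch : Sch.Nonempty)
    {b : ℝ≥0∞} (h : ∀ (ψ : AllocationPolicy Sch Y v) (ρ ρ₀ : ℝ≥0), ρ < ρ₀ → Achieves C ψ ρ₀ →
      HasReachableMemory C ψ → (∀ d ∈ Sch, ∀ i, (ρ : ℝ) * d i ≤ 1) → (ρ : ℝ≥0∞) ≤ b) :
    capacityFactor Sch C k v ≤ b := by
  refine iSup₂_le fun φ ψ => iSup₂_le fun ρ hρ => ENNReal.le_of_forall_nnreal_lt fun s hs => ?_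
  have hs' : s < ρ := by exact_mod_cast hs
  obtain ⟨ρ₀, h1, h2⟩ := exists_between hs'
  obtain ⟨h3, h4, h5⟩ := achieves_of_smul_mem_capacityRegion C ψ hserve hSch
    (ρ₀ := ρ₀) (NNReal.coe_lt_coe.2 h2) ρ₀.2 hρ
  refine h ψ s ρ₀ h1 h3 h4 fun d hd i => le_trans ?_ (h5 d hd i)
  exact mul_le_mul_of_nonneg_right (NNReal.coe_le_coe.2 hs'.le) (Nat.cast_nonneg _)

/-- If an encoder memory of `k'` bits suffices for optimal control, no other size is better. -/
theorem capacityFactor_le_of_isImplementable (hserve : ServesEachQueue Sch)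
    (hSch : Sch.Nonempty) (k : ℕ) {k' : ℕ}
    (h : ∀ ψ : AllocationPolicy Sch Y v, IsImplementable C ψ k') :
    capacityFactor Sch C k v ≤ capacityFactor Sch C k' v := by
  refine capacityFactor_le_of_forall hserve hSch fun ψ ρ ρ₀ hρ hach hreach hrate => ?_
  obtain ⟨φ, hφ⟩ := exists_policy_of_achieves C ψ hserve hSch ρ.2 (NNReal.coe_lt_coe.2 hρ) hach
    hreach (h ψ) hrate
  exact le_capacityFactor hφ

theorem isImplementable_of_independent {ψ : AllocationPolicy Sch Y v}
    (h : ∀ (β : ℝ) (q : Fin N → ℝ) (n : ℕ) (m : Memory v), ∃ x', ∀ x,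
      objective (recTrans C ψ) (allocMean C ψ) β q
        (value (recTrans C ψ) (allocMean C ψ) β q n) x m x' =
      bellman (recTrans C ψ) (allocMean C ψ) β q
        (value (recTrans C ψ) (allocMean C ψ) β q n) x m) (k : ℕ) : IsImplementable C ψ k :=
  ⟨fun _ _ => false, fun β q n _ m => (h β q n m).imp fun _ hx x _ => hx x⟩

/-- Without receiver memory, no encoder memory is needed. -/
theorem isImplementable_of_memoryless (ψ : AllocationPolicy Sch Y 0) (k : ℕ) :
    IsImplementable C ψ k := by
  refine isImplementable_of_independent (fun β q n m => ?_) k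
  -- A memory of zero bits has a single state, so the last signal has no influence on the objective.
  have hp : ∀ x m', recTrans C ψ x m m' = 1 := by
    intro x m'
    have := sum_recTrans C ψ x m
    rwa [Fintype.sum_subsingleton _ m'] at this
  set u := value (recTrans C ψ) (allocMean C ψ) β q n
  have hobj : ∀ x₁ x₂, objective (recTrans C ψ) (allocMean C ψ) β q u x₁ m =
      objective (recTrans C ψ) (allocMean C ψ) β q u x₂ m := by
    intro x₁ x₂
    funext x'
    simp only [objective, hp]
  obtain ⟨x', hx'⟩ := exists_objective_eq_bellman (p := recTrans C ψ) (r := allocMean C ψ)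
    (β := β) (q := q) u (Classical.arbitrary X) m
  refine ⟨x', fun x => ?_⟩
  rw [hobj x (Classical.arbitrary X), hx', bellman, bellman, hobj x (Classical.arbitrary X)]

/-- An encoder memory that can hold the last signal suffices. -/
theorem isImplementable_of_card_le (ψ : AllocationPolicy Sch Y v) {k : ℕ}
    (hk : Fintype.card X ≤ 2 ^ k) : IsImplementable C ψ k := by
  obtain ⟨enc⟩ : Nonempty (X ↪ Memory k) := by
    refine Function.Embedding.nonempty_of_card_le ?_
    simpa using hk
  refine ⟨enc, fun β q n e m => ?_⟩
  by_cases he : ∃ x, enc x = e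
  · obtain ⟨x, rfl⟩ := he
    obtain ⟨x', hx'⟩ := exists_objective_eq_bellman (p := recTrans C ψ) (r := allocMean C ψ)
      (β := β) (q := q) (value (recTrans C ψ) (allocMean C ψ) β q n) x m
    refine ⟨x', fun x₂ h => ?_⟩
    rw [enc.injective h, hx']
  · exact ⟨Classical.arbitrary X, fun x hx => absurd ⟨x, hx⟩ he⟩

theorem capacityFactor_memoryless_eq (hserve : ServesEachQueue Sch) (hSch : Sch.Nonempty)
    (k k' : ℕ) : capacityFactor Sch C k 0 = capacityFactor Sch C k' 0 :=
  le_antisymm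
    (capacityFactor_le_of_isImplementable hserve hSch k fun ψ => isImplementable_of_memoryless ψ k')
    (capacityFactor_le_of_isImplementable hserve hSch k' fun ψ => isImplementable_of_memoryless ψ k)

theorem capacityFactor_eq_of_card_le (hserve : ServesEachQueue Sch) (hSch : Sch.Nonempty)
    {k k' : ℕ} (hk : Fintype.card X ≤ 2 ^ k) (hk' : Fintype.card X ≤ 2 ^ k') :
    capacityFactor Sch C k v = capacityFactor Sch C k' v :=
  le_antisymm
    (capacityFactor_le_of_isImplementable hserve hSch k fun ψ => isImplementable_of_card_le ψ hk')
    (capacityFactor_le_of_isImplementable hserve hSch k' fun ψ => isImplementable_of_card_le ψ hk)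

omit [Nonempty X] in
theorem card_le_two_pow_memoryThreshold (hmax : HasTwoMaximal Sch) :
    Fintype.card X ≤ 2 ^ memoryThreshold Sch X := by
  obtain ⟨d, hd, _⟩ := hmax
  have hfin : (maximalSchedules Sch).Finite := Sch.finite_toSet.subset fun d hd => hd.1
  have hpos : 0 < (maximalSchedules Sch).ncard := (Set.ncard_pos hfin).2 ⟨d, hd⟩
  exact (Nat.le_mul_of_pos_left _ hpos).trans (Nat.le_pow_clog one_lt_two _)

/-- Some schedule offers `c ≥ 1` to a queue, and the condition `ρ * c ≤ 1` from Bernoulli rates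
already gives `ρ ≤ 1`. -/
theorem capacityFactor_le_one (hserve : ServesEachQueue Sch) (hSch : Sch.Nonempty)
    (hN : 0 < N) (k v : ℕ) : capacityFactor Sch C k v ≤ 1 := by
  refine capacityFactor_le_of_forall hserve hSch fun ψ ρ ρ₀ _ _ _ hrate => ?_
  obtain ⟨c, hc, hserve⟩ := hserve
  have h1 := hrate _ (hserve ⟨0, hN⟩) ⟨0, hN⟩
  rw [Pi.single_eq_same] at h1
  have h2 : (ρ : ℝ) ≤ 1 := (le_mul_of_one_le_right ρ.2 (by exact_mod_cast hc)).trans h1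
  exact_mod_cast h2

omit [Fintype X] [Nonempty X] in
/-- If all sizes of encoder memory from `K` on are equivalent, infinite memory is also equivalent
to them. -/
theorem isCapacityFactor_of_forall_ge {K v : ℕ} {r : ℝ≥0∞}
    (h : ∀ k, K ≤ k → capacityFactor Sch C k v = r) {k : ℕ∞} (hk : (K : ℕ∞) ≤ k) :
    IsCapacityFactor Sch C k v r := by
  induction k with
  | top =>
    change Tendsto (fun k : ℕ => capacityFactor Sch C k v) atTop (𝓝 r)
    refine tendsto_const_nhds.congr' ?_
    filter_upwards [eventually_ge_atTop K] with k hk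
    exact (h k hk).symm
  | coe k =>
    change capacityFactor Sch C k v = r
    exact h k (by exact_mod_cast hk)

end EncoderMemory

/-! ### Controlled finite chains with comparable transition probabilities -/

section Comparison

variable {M : Type*} [Fintype M]

/-- `μ` with flow `T` is a stationary law of a chain whose transition weights lie between `c p₀`
and `p₀`. -/
structure IsComparableFlow (p₀ : M → M → ℝ) (c : ℝ) (μ : M → ℝ) (T : M → M → ℝ) : Prop where
  nonneg : ∀ m, 0 ≤ μ m
  lower : ∀ m m', c * (μ m * p₀ m m') ≤ T m m'
  upper : ∀ m m', T m m' ≤ μ m * p₀ m m'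
  outflow : ∀ m, ∑ m', T m m' = μ m
  inflow : ∀ m, ∑ m', T m' m = μ m
  sum_eq_one : ∑ m, μ m = 1

variable {p₀ : M → M → ℝ} {c : ℝ} {μ₁ μ₂ : M → ℝ} {T₁ T₂ : M → M → ℝ} {R : Finset M}

/-- Add the balance equations over `A`; the flow inside `A` cancels. -/
theorem IsComparableFlow.cut [DecidableEq M] (h : IsComparableFlow p₀ c μ₁ T₁) (A : Finset M) :
    ∑ i ∈ A, ∑ j ∈ Aᶜ, T₁ i j = ∑ i ∈ A, ∑ j ∈ Aᶜ, T₁ j i := by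
  have h1 : ∑ i ∈ A, ∑ j, T₁ i j = ∑ i ∈ A, ∑ j, T₁ j i :=
    Finset.sum_congr rfl fun i _ => by rw [h.outflow, h.inflow]
  simp only [← Finset.sum_add_sum_compl A, Finset.sum_add_distrib] at h1
  rw [Finset.sum_comm (s := A) (t := A)] at h1
  linarith

/-- Otherwise the states of positive mass form a proper nonempty part of `R`, and irreducibility
carries mass out of it. -/
theorem IsComparableFlow.pos (h : IsComparableFlow p₀ c μ₁ T₁) (hc : 0 < c)
    (hp₀ : ∀ m m', 0 ≤ p₀ m m')
    (hirr : ∀ A ⊆ R, A.Nonempty → A ≠ R → ∃ i ∈ A, ∃ j ∈ R, j ∉ A ∧ p₀ i j ≠ 0)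
    (hsupp : ∀ m, m ∉ R → μ₁ m = 0) : ∀ m ∈ R, 0 < μ₁ m := by
  classical
  by_contra! hcon
  obtain ⟨m, hm, hm0⟩ := hcon
  obtain ⟨i, hi, j, hjR, hj, hij⟩ := hirr (R.filter fun m => 0 < μ₁ m) (Finset.filter_subset _ _)
    (by
      by_contra hempty
      rw [Finset.not_nonempty_iff_eq_empty] at hempty
      have : ∑ m, μ₁ m = 0 := Finset.sum_eq_zero fun m _ => by
        by_cases hmR : m ∈ R
        · by_contra h0
          have : m ∈ R.filter fun m => 0 < μ₁ m :=
            Finset.mem_filter.2 ⟨hmR, (h.nonneg m).lt_of_ne' h0⟩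
          rw [hempty] at this
          exact absurd this (Finset.notMem_empty m)
        · exact hsupp m hmR
      rw [h.sum_eq_one] at this
      exact one_ne_zero this)
    (fun heq => by
      have := (Finset.mem_filter.1 (heq ▸ hm)).2
      linarith)
  have hi' := (Finset.mem_filter.1 hi).2
  have hT0 : ∀ m m', 0 ≤ T₁ m m' := fun m m' =>
    (mul_nonneg hc.le (mul_nonneg (h.nonneg m) (hp₀ m m'))).trans (h.lower m m')
  have h1 : T₁ i j ≤ μ₁ j := by
    rw [← h.inflow j]
    exact Finset.single_le_sum (f := fun i => T₁ i j) (fun _ _ => hT0 _ _) (Finset.mem_univ i)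
  have h2 := h.lower i j
  have h3 : 0 < p₀ i j := (hp₀ i j).lt_of_ne' hij
  have h4 : 0 < c * (μ₁ i * p₀ i j) := by positivity
  exact hj (Finset.mem_filter.2 ⟨hjR, by linarith⟩)

/-- Compare flows across the cut. With `F` the reference flow of `μ₁` out of `A`, the second flow
out of `A` is at least `c * t * F`, while its flow into `A` is at most `t' / c` times that of the
first, which by balance is at most `F`. The two laws thus cannot have a large jump of ratio across a
cut. -/
theorem IsComparableFlow.gap (h₁ : IsComparableFlow p₀ c μ₁ T₁) (h₂ : IsComparableFlow p₀ c μ₂ T₂)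
    (hc : 0 < c) (hp₀ : ∀ m m', 0 ≤ p₀ m m')
    (hirr : ∀ A ⊆ R, A.Nonempty → A ≠ R → ∃ i ∈ A, ∃ j ∈ R, j ∉ A ∧ p₀ i j ≠ 0)
    (hs₁ : ∀ m, m ∉ R → μ₁ m = 0) (hs₂ : ∀ m, m ∉ R → μ₂ m = 0) {A : Finset M} (hAR : A ⊆ R)
    (hA : A.Nonempty) (hne : A ≠ R) {t t' : ℝ} (ht' : 0 ≤ t')
    (hin : ∀ i ∈ A, t * μ₁ i ≤ μ₂ i) (hout : ∀ j ∈ R, j ∉ A → μ₂ j ≤ t' * μ₁ j) :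
    c ^ 2 * t ≤ t' := by
  classical
  set F := ∑ i ∈ A, ∑ j ∈ Aᶜ, μ₁ i * p₀ i j with hF
  have hFpos : 0 < F := by
    obtain ⟨i, hi, j, hjR, hj, hij⟩ := hirr A hAR hA hne
    have h0 : ∀ i j, 0 ≤ μ₁ i * p₀ i j := fun i j => mul_nonneg (h₁.nonneg i) (hp₀ i j)
    refine Finset.sum_pos' (fun i _ => Finset.sum_nonneg fun j _ => h0 i j) ⟨i, hi, ?_⟩
    refine Finset.sum_pos' (fun j _ => h0 i j) ⟨j, Finset.mem_compl.2 hj, ?_⟩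
    exact mul_pos (h₁.pos hc hp₀ hirr hs₁ i (hAR hi)) ((hp₀ i j).lt_of_ne' hij)
  have hout' : ∀ j ∈ Aᶜ, μ₂ j ≤ t' * μ₁ j := by
    intro j hj
    by_cases hjR : j ∈ R
    · exact hout j hjR (Finset.mem_compl.1 hj)
    · rw [hs₁ j hjR, hs₂ j hjR, mul_zero]
  have e1 : c * (t * F) ≤ ∑ i ∈ A, ∑ j ∈ Aᶜ, T₂ i j := by
    simp only [hF, Finset.mul_sum]
    refine Finset.sum_le_sum fun i hi => Finset.sum_le_sum fun j _ => ?_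
    refine le_trans ?_ (h₂.lower i j)
    rw [← mul_assoc t]
    exact mul_le_mul_of_nonneg_left (mul_le_mul_of_nonneg_right (hin i hi) (hp₀ i j)) hc.le
  have e2 : c * ∑ i ∈ A, ∑ j ∈ Aᶜ, T₂ j i ≤ t' * ∑ i ∈ A, ∑ j ∈ Aᶜ, T₁ j i := by
    simp only [Finset.mul_sum]
    refine Finset.sum_le_sum fun i hi => Finset.sum_le_sum fun j hj => ?_
    calc c * T₂ j i ≤ c * (t' * μ₁ j * p₀ j i) := by
          refine mul_le_mul_of_nonneg_left ((h₂.upper j i).trans ?_) hc.le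
          exact mul_le_mul_of_nonneg_right (hout' j hj) (hp₀ j i)
      _ = t' * (c * (μ₁ j * p₀ j i)) := by ring
      _ ≤ t' * T₁ j i := mul_le_mul_of_nonneg_left (h₁.lower j i) ht'
  have e3 : ∑ i ∈ A, ∑ j ∈ Aᶜ, T₁ i j ≤ F :=
    Finset.sum_le_sum fun i _ => Finset.sum_le_sum fun j _ => h₁.upper i j
  rw [← h₂.cut, ← h₁.cut] at e2
  have e4 : c ^ 2 * t * F ≤ t' * F := by
    calc c ^ 2 * t * F = c * (c * (t * F)) := by ring
      _ ≤ c * ∑ i ∈ A, ∑ j ∈ Aᶜ, T₂ i j := mul_le_mul_of_nonneg_left e1 hc.le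
      _ ≤ t' * ∑ i ∈ A, ∑ j ∈ Aᶜ, T₁ i j := e2
      _ ≤ t' * F := mul_le_mul_of_nonneg_left e3 ht'
  exact le_of_mul_le_mul_right e4 hFpos

/-- Stationary laws of chains with comparable transition probabilities are comparable, with a
constant that only depends on the number of states. -/
theorem IsComparableFlow.comparable (h₁ : IsComparableFlow p₀ c μ₁ T₁)
    (h₂ : IsComparableFlow p₀ c μ₂ T₂) (hc : 0 < c) (hp₀ : ∀ m m', 0 ≤ p₀ m m')
    (hirr : ∀ A ⊆ R, A.Nonempty → A ≠ R → ∃ i ∈ A, ∃ j ∈ R, j ∉ A ∧ p₀ i j ≠ 0)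
    (hs₁ : ∀ m, m ∉ R → μ₁ m = 0) (hs₂ : ∀ m, m ∉ R → μ₂ m = 0) (m : M) :
    (c ^ 2 / 2) ^ Fintype.card M * μ₁ m ≤ μ₂ m := by
  classical
  by_cases hm : m ∉ R
  · rw [hs₁ m hm, hs₂ m hm, mul_zero]
  rw [not_not] at hm
  set κ := c ^ 2 / 2 with hκ
  have hκ0 : 0 < κ := by positivity
  -- Level sets of the ratio at geometric thresholds. Until `R` is exhausted each contains a new
  -- state: otherwise `gap` gives `c ^ 2 * κ ^ j ≤ κ ^ (j + 1)`, against `c ^ 2 = 2 * κ`.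
  set A : ℕ → Finset M := fun j => R.filter fun m => κ ^ j * μ₁ m ≤ μ₂ m with hA
  have hκc : c ^ 2 = 2 * κ := by rw [hκ]; ring
  have hout : ∀ j m, m ∈ R → m ∉ A j → μ₂ m ≤ κ ^ j * μ₁ m := fun j m hmR hmA => by
    by_contra hlt
    exact hmA (Finset.mem_filter.2 ⟨hmR, (not_le.1 hlt).le⟩)
  have hin : ∀ j, ∀ m ∈ A j, κ ^ j * μ₁ m ≤ μ₂ m := fun j m hm => (Finset.mem_filter.1 hm).2
  have h0 : (A 0).Nonempty := by
    by_contra hempty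
    have hlt : ∀ m ∈ R, μ₂ m < μ₁ m := by
      intro m hmR
      by_contra hle
      exact hempty ⟨m, Finset.mem_filter.2 ⟨hmR, by simpa using hle⟩⟩
    have : ∑ m, μ₂ m < ∑ m, μ₁ m := by
      refine Finset.sum_lt_sum (fun m _ => ?_) ⟨m, Finset.mem_univ m, hlt m hm⟩
      by_cases hmR : m ∈ R
      · exact (hlt m hmR).le
      · rw [hs₁ m hmR, hs₂ m hmR]
    rw [h₁.sum_eq_one, h₂.sum_eq_one] at this
    exact lt_irrefl _ this
  have hc1 : c ≤ 1 := by
    obtain ⟨m, hmA⟩ := h0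
    have hmR := (Finset.mem_filter.1 hmA).1
    have hpos := h₁.pos hc hp₀ hirr hs₁ m hmR
    have h1 : c * (μ₁ m * ∑ m', p₀ m m') ≤ μ₁ m := by
      calc _ = ∑ m', c * (μ₁ m * p₀ m m') := by simp only [Finset.mul_sum]
        _ ≤ ∑ m', T₁ m m' := Finset.sum_le_sum fun m' _ => h₁.lower m m'
        _ = μ₁ m := h₁.outflow m
    have h2 : μ₁ m ≤ μ₁ m * ∑ m', p₀ m m' := by
      calc μ₁ m = ∑ m', T₁ m m' := (h₁.outflow m).symm
        _ ≤ ∑ m', μ₁ m * p₀ m m' := Finset.sum_le_sum fun m' _ => h₁.upper m m'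
        _ = _ := by rw [Finset.mul_sum]
    have h3 : c * μ₁ m ≤ 1 * μ₁ m :=
      (mul_le_mul_of_nonneg_left h2 hc.le).trans (h1.trans (one_mul _).ge)
    exact le_of_mul_le_mul_right h3 hpos
  have hκ1 : κ ≤ 1 := by rw [hκ]; nlinarith
  have hmono : ∀ j, A j ⊆ A (j + 1) := by
    intro j m hmA
    refine Finset.mem_filter.2 ⟨(Finset.mem_filter.1 hmA).1, le_trans ?_ (hin j m hmA)⟩
    refine mul_le_mul_of_nonneg_right ?_ (h₁.nonneg m)
    rw [pow_succ]
    exact mul_le_of_le_one_right (by positivity) hκ1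
  have hgrow : ∀ j, A j = R ∨ j + 1 ≤ (A j).card := by
    intro j
    induction j with
    | zero => exact Or.inr (Finset.card_pos.2 h0)
    | succ j ih =>
      rcases ih with ih | ih
      · exact Or.inl (Finset.Subset.antisymm (Finset.filter_subset _ _) (ih ▸ hmono j))
      · by_cases hR : A j = R
        · exact Or.inl (Finset.Subset.antisymm (Finset.filter_subset _ _) (hR ▸ hmono j))
        right
        have hss : A j ⊂ A (j + 1) := by
          refine (hmono j).ssubset_of_ne fun heq => ?_
          have := h₁.gap h₂ hc hp₀ hirr hs₁ hs₂ (Finset.filter_subset _ _)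
            (Finset.card_pos.1 (by omega : 0 < (A j).card)) hR (by positivity) (hin j)
            fun m hmR hmA => hout (j + 1) m hmR (heq ▸ hmA)
          rw [hκc, pow_succ] at this
          have h4 : 0 < κ ^ j * κ := by positivity
          linarith
        have := Finset.card_lt_card hss
        omega
  have hfinal : A (Fintype.card M) = R := by
    refine (hgrow _).resolve_right fun h => ?_
    have := Finset.card_le_univ (A (Fintype.card M))
    omega
  exact hin _ m (hfinal ▸ hm)

/-- A nonempty closed set of least cardinality; a proper part without exit would be a smaller one.
-/
theorem exists_irreducible_class [Nonempty M] (p₀ : M → M → ℝ) :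
    ∃ R : Finset M, R.Nonempty ∧ (∀ i ∈ R, ∀ j, p₀ i j ≠ 0 → j ∈ R) ∧
      ∀ A ⊆ R, A.Nonempty → A ≠ R → ∃ i ∈ A, ∃ j ∈ R, j ∉ A ∧ p₀ i j ≠ 0 := by
  classical
  obtain ⟨R, hR, hmin⟩ := Finset.exists_min_image
    (Finset.univ.filter fun R : Finset M => R.Nonempty ∧ ∀ i ∈ R, ∀ j, p₀ i j ≠ 0 → j ∈ R)
    Finset.card ⟨Finset.univ, by simp⟩
  obtain ⟨hne, hcl⟩ := (Finset.mem_filter.1 hR).2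
  refine ⟨R, hne, hcl, fun A hAR hA hneq => ?_⟩
  by_contra! hcon
  have h1 := hmin A (Finset.mem_filter.2 ⟨Finset.mem_univ _, hA, fun i hi j hij => by
    by_contra hj
    exact hij (hcon i hi j (hcl i (hAR hi) j hij) hj)⟩)
  exact hneq (Finset.eq_of_subset_of_card_le hAR h1)

end Comparison

/-! ### Stationary laws from rewards over long horizons -/

section Occupation

variable {N : ℕ} {X M : Type*} [Fintype X] [Nonempty X] [Fintype M]
  {p : X → M → M → ℝ} {r : X → M → Fin N → ℝ} {q : Fin N → ℝ} {p₀ : M → M → ℝ} {c : ℝ}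
  {R : Finset M}

/-- The occupation counts and transition counts of an optimal control over `n` steps. -/
theorem exists_occupation [DecidableEq M] (hp : ∀ x m m', 0 ≤ p x m m')
    (hp1 : ∀ x m, ∑ m', p x m m' = 1) (hlow : ∀ x m m', c * p₀ m m' ≤ p x m m')
    (hup : ∀ x m m', p x m m' ≤ p₀ m m') (hR : ∀ i ∈ R, ∀ j, p₀ i j ≠ 0 → j ∈ R)
    {s : M → ℝ} (hs : ∀ x m, ∑ i, q i * r x m i ≤ s m) (n : ℕ) (x : X) (m : M) (hm : m ∈ R) :
    ∃ (μ : M → ℝ) (T : M → M → ℝ) (κ : M → ℝ),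
      (∀ m, 0 ≤ μ m) ∧ (∀ m m', c * (μ m * p₀ m m') ≤ T m m') ∧
      (∀ m m', T m m' ≤ μ m * p₀ m m') ∧ (∀ m, ∑ m', T m m' = μ m) ∧
      (∀ m', μ m' + κ m' = (if m' = m then 1 else 0) + ∑ m₀, T m₀ m') ∧
      (∀ m, 0 ≤ κ m ∧ κ m ≤ 1) ∧ ∑ m, μ m = n ∧ (∀ m, m ∉ R → μ m = 0) ∧
      value p r 1 q n x m ≤ ∑ m, μ m * s m := by
  induction n generalizing x m with
  | zero =>
    refine ⟨fun _ => 0, fun _ _ => 0, fun m' => if m' = m then 1 else 0, ?_, ?_, ?_, ?_, ?_, ?_,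
      ?_, ?_, ?_⟩ <;> simp [value]
    intro m'
    split_ifs <;> norm_num
  | succ n ih =>
    obtain ⟨x', hx'⟩ := exists_objective_eq_bellman (p := p) (r := r) (β := 1) (q := q)
      (value p r 1 q n) x m
    -- Here `κ` is the law of the final state. The claim is guarded because successors of
    -- probability zero may lie outside `R`.
    have ih' : ∀ m', ∃ (μ : M → ℝ) (T : M → M → ℝ) (κ : M → ℝ), p x m m' ≠ 0 →
      (∀ m, 0 ≤ μ m) ∧ (∀ m m', c * (μ m * p₀ m m') ≤ T m m') ∧
      (∀ m m', T m m' ≤ μ m * p₀ m m') ∧ (∀ m, ∑ m', T m m' = μ m) ∧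
      (∀ m₁, μ m₁ + κ m₁ = (if m₁ = m' then 1 else 0) + ∑ m₀, T m₀ m₁) ∧
      (∀ m, 0 ≤ κ m ∧ κ m ≤ 1) ∧ ∑ m, μ m = n ∧ (∀ m, m ∉ R → μ m = 0) ∧
      value p r 1 q n x' m' ≤ ∑ m, μ m * s m := by
      intro m'
      by_cases h0 : p x m m' = 0
      · exact ⟨0, 0, 0, fun h => absurd h0 h⟩
      · have hm' : m' ∈ R := hR m hm m' fun h => h0 (le_antisymm (h ▸ hup x m m') (hp x m m'))
        obtain ⟨μ, T, κ, h⟩ := ih x' m' hm'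
        exact ⟨μ, T, κ, fun _ => h⟩
    choose μ T κ h using ih'
    have hmul : ∀ m' (a b : ℝ), (p x m m' ≠ 0 → a ≤ b) → p x m m' * a ≤ p x m m' * b := by
      intro m' a b hab
      by_cases h0 : p x m m' = 0
      · simp [h0]
      · exact mul_le_mul_of_nonneg_left (hab h0) (hp x m m')
    have hmul' : ∀ m' (a b : ℝ), (p x m m' ≠ 0 → a = b) → p x m m' * a = p x m m' * b := by
      intro m' a b hab
      by_cases h0 : p x m m' = 0
      · simp [h0]
      · rw [hab h0]
    refine ⟨fun a => (if a = m then 1 else 0) + ∑ m', p x m m' * μ m' a,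
      fun a b => (if a = m then p x m b else 0) + ∑ m', p x m m' * T m' a b,
      fun a => ∑ m', p x m m' * κ m' a, ?_, ?_, ?_, ?_, ?_, ?_, ?_, ?_, ?_⟩
    · intro a
      refine add_nonneg (by split_ifs <;> norm_num) (Finset.sum_nonneg fun m' _ => ?_)
      have := hmul m' 0 (μ m' a) fun h0 => (h m' h0).1 a
      simpa using this
    · intro a b
      have e1 : c * ((if a = m then 1 else 0) * p₀ a b) ≤ if a = m then p x m b else 0 := by
        split_ifs with ha
        · rw [one_mul, ha]; exact hlow x m b
        · simp
      have e2 : ∑ m', p x m m' * (c * (μ m' a * p₀ a b)) ≤ ∑ m', p x m m' * T m' a b :=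
        Finset.sum_le_sum fun m' _ => hmul m' _ _ fun h0 => (h m' h0).2.1 a b
      have e3 : ∑ m', p x m m' * (c * (μ m' a * p₀ a b)) =
          c * ((∑ m', p x m m' * μ m' a) * p₀ a b) := by
        rw [Finset.sum_mul, Finset.mul_sum]
        exact Finset.sum_congr rfl fun m' _ => by ring
      rw [add_mul, mul_add]
      linarith
    · intro a b
      have e1 : (if a = m then p x m b else 0) ≤ (if a = m then 1 else 0) * p₀ a b := by
        split_ifs with ha
        · rw [one_mul, ha]; exact hup x m b
        · simp
      have e2 : ∑ m', p x m m' * T m' a b ≤ ∑ m', p x m m' * (μ m' a * p₀ a b) :=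
        Finset.sum_le_sum fun m' _ => hmul m' _ _ fun h0 => (h m' h0).2.2.1 a b
      have e3 : ∑ m', p x m m' * (μ m' a * p₀ a b) = (∑ m', p x m m' * μ m' a) * p₀ a b := by
        rw [Finset.sum_mul]
        exact Finset.sum_congr rfl fun m' _ => by ring
      rw [add_mul]
      linarith
    · intro a
      rw [Finset.sum_add_distrib, Finset.sum_comm]
      congr 1
      · split_ifs <;> simp [hp1]
      · refine Finset.sum_congr rfl fun m' _ => ?_
        rw [← Finset.mul_sum]
        exact hmul' m' _ _ fun h0 => (h m' h0).2.2.2.1 a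
    · intro a
      have e1 : ∑ m', p x m m' * (μ m' a + κ m' a) =
          ∑ m', p x m m' * ((if a = m' then 1 else 0) + ∑ m₀, T m' m₀ a) :=
        Finset.sum_congr rfl fun m' _ => hmul' m' _ _ fun h0 => (h m' h0).2.2.2.2.1 a
      simp only [mul_add, Finset.sum_add_distrib, mul_ite, mul_one, mul_zero,
        Finset.sum_ite_eq, Finset.mem_univ, if_true] at e1
      rw [Finset.sum_add_distrib, Finset.sum_comm (f := fun m₀ m' => p x m m' * T m' m₀ a)]
      simp only [← Finset.mul_sum, Finset.sum_ite_eq', Finset.mem_univ, if_true]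
      linarith
    · intro a
      constructor
      · refine Finset.sum_nonneg fun m' _ => ?_
        have := hmul m' 0 (κ m' a) fun h0 => ((h m' h0).2.2.2.2.2.1 a).1
        simpa using this
      · rw [← hp1 x m]
        refine Finset.sum_le_sum fun m' _ => ?_
        have := hmul m' (κ m' a) 1 fun h0 => ((h m' h0).2.2.2.2.2.1 a).2
        simpa using this
    · rw [Finset.sum_add_distrib, Finset.sum_comm]
      simp only [← Finset.mul_sum]
      rw [Finset.sum_congr rfl fun m' _ => hmul' m' _ _ fun h0 => (h m' h0).2.2.2.2.2.2.1,
        ← Finset.sum_mul, hp1]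
      simp [add_comm]
    · intro a ha
      have e1 : a ≠ m := fun h => ha (h ▸ hm)
      simp only [if_neg e1, zero_add]
      refine Finset.sum_eq_zero fun m' _ => ?_
      have := hmul' m' (μ m' a) 0 fun h0 => (h m' h0).2.2.2.2.2.2.2.1 a ha
      simpa using this
    · rw [value_succ, ← hx', objective, one_mul]
      have e1 : ∑ m', p x m m' * value p r 1 q n x' m' ≤
          ∑ m', p x m m' * ∑ a, μ m' a * s a :=
        Finset.sum_le_sum fun m' _ => hmul m' _ _ fun h0 => (h m' h0).2.2.2.2.2.2.2.2
      have e2 : ∑ m', p x m m' * ∑ a, μ m' a * s a = ∑ a, (∑ m', p x m m' * μ m' a) * s a := by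
        simp only [Finset.mul_sum, Finset.sum_mul]
        rw [Finset.sum_comm]
        exact Finset.sum_congr rfl fun a _ => Finset.sum_congr rfl fun m' _ => by ring
      have e3 := hs x' m
      simp only [add_mul, Finset.sum_add_distrib, ite_mul, one_mul, zero_mul, Finset.sum_ite_eq',
        Finset.mem_univ, if_true]
      linarith

/-- A lower bound on the mean reward over long horizons is achieved by a stationary law. -/
theorem exists_isComparableFlow (hp : ∀ x m m', 0 ≤ p x m m')
    (hp1 : ∀ x m, ∑ m', p x m m' = 1) (hc : 0 ≤ c) (hp₀ : ∀ m m', 0 ≤ p₀ m m')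
    (hlow : ∀ x m m', c * p₀ m m' ≤ p x m m')
    (hup : ∀ x m m', p x m m' ≤ p₀ m m') (hRne : R.Nonempty)
    (hR : ∀ i ∈ R, ∀ j, p₀ i j ≠ 0 → j ∈ R)
    {s : M → ℝ} (hs : ∀ x m, ∑ i, q i * r x m i ≤ s m) {n : ℕ} (hn : 0 < n) {g : ℝ}
    (hg : ∀ (k : ℕ) x m, k * (n * g) ≤ value p r 1 q (n * k) x m) :
    ∃ μ T, IsComparableFlow p₀ c μ T ∧ (∀ m, m ∉ R → μ m = 0) ∧ g ≤ ∑ m, μ m * s m := by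
  classical
  -- All requirements except the inflow balance; its total defect is then minimized over this
  -- compact set.
  set K : Set ((M → ℝ) × (M → M → ℝ)) := {a | (∀ m, 0 ≤ a.1 m) ∧
    (∀ m m', c * (a.1 m * p₀ m m') ≤ a.2 m m') ∧ (∀ m m', a.2 m m' ≤ a.1 m * p₀ m m') ∧
    (∀ m, ∑ m', a.2 m m' = a.1 m) ∧ ∑ m, a.1 m = 1 ∧ (∀ m, m ∉ R → a.1 m = 0) ∧
    g ≤ ∑ m, a.1 m * s m} with hK
  have hKclosed : IsClosed K := by
    simp only [hK, Set.ofPred_and, Set.ofPred_forall]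
    refine IsClosed.inter ?_ (IsClosed.inter ?_ (IsClosed.inter ?_ (IsClosed.inter ?_
      (IsClosed.inter ?_ (IsClosed.inter ?_ ?_)))))
    · exact isClosed_iInter fun m => isClosed_le (by fun_prop) (by fun_prop)
    · exact isClosed_iInter fun m => isClosed_iInter fun m' =>
        isClosed_le (by fun_prop) (by fun_prop)
    · exact isClosed_iInter fun m => isClosed_iInter fun m' =>
        isClosed_le (by fun_prop) (by fun_prop)
    · exact isClosed_iInter fun m => isClosed_eq (by fun_prop) (by fun_prop)
    · exact isClosed_eq (by fun_prop) (by fun_prop)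
    · exact isClosed_iInter fun m => isClosed_iInter fun _ => isClosed_eq (by fun_prop) (by fun_prop)
    · exact isClosed_le (by fun_prop) (by fun_prop)
  have hKcompact : IsCompact K := by
    refine (isCompact_Icc (a := ((0 : M → ℝ), (0 : M → M → ℝ)))
      (b := ((1 : M → ℝ), (1 : M → M → ℝ)))).of_isClosed_subset hKclosed ?_
    rintro ⟨μ, T⟩ ⟨h1, h2, h3, h4, h5, -, -⟩
    have hT0 : ∀ m m', 0 ≤ T m m' := fun m m' =>
      (mul_nonneg hc (mul_nonneg (h1 m) (hp₀ m m'))).trans (h2 m m')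
    have hμ1 : ∀ m, μ m ≤ 1 := fun m => by
      rw [← h5]
      exact Finset.single_le_sum (fun m _ => h1 m) (Finset.mem_univ m)
    refine ⟨⟨h1, hT0⟩, ⟨hμ1, fun m m' => le_trans ?_ (hμ1 m)⟩⟩
    have := h4 m
    simp only at this ⊢
    rw [← this]
    exact Finset.single_le_sum (fun m' _ => hT0 m m') (Finset.mem_univ m')
  -- Counts over `n * k` steps are balanced up to the initial and final state, so after
  -- normalization the defect is at most `1 / (n * k)`.
  have happrox : ∀ k : ℕ, 0 < k → ∃ a ∈ K,
      ∀ m, |a.1 m - ∑ m', a.2 m' m| ≤ 1 / k := by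
    intro k hk
    obtain ⟨m₀, hm₀⟩ := hRne
    obtain ⟨μ, T, κ, h1, h2, h3, h4, h5, h6, h7, h8, h9⟩ := exists_occupation hp hp1 hlow hup hR hs
      (n * k) (Classical.arbitrary X) m₀ hm₀
    have hnk : (0 : ℝ) < (n * k : ℕ) := by exact_mod_cast Nat.mul_pos hn hk
    set b : ℝ := ((n * k : ℕ) : ℝ)⁻¹ with hb
    have hb0 : 0 ≤ b := by positivity
    have hbn : b * (n * k : ℕ) = 1 := inv_mul_cancel₀ hnk.ne'
    refine ⟨(fun m => b * μ m, fun m m' => b * T m m'), ⟨fun m => mul_nonneg hb0 (h1 m),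
      fun m m' => ?_, fun m m' => ?_, fun m => ?_, ?_, fun m hm => ?_, ?_⟩, fun m => ?_⟩
    · calc c * (b * μ m * p₀ m m') = b * (c * (μ m * p₀ m m')) := by ring
        _ ≤ _ := mul_le_mul_of_nonneg_left (h2 m m') hb0
    · calc b * T m m' ≤ b * (μ m * p₀ m m') := mul_le_mul_of_nonneg_left (h3 m m') hb0
        _ = _ := by ring
    · simp only
      rw [← Finset.mul_sum, h4]
    · simp only
      rw [← Finset.mul_sum, h7, hbn]
    · simp only
      rw [h8 m hm, mul_zero]
    · have e1 := (hg k (Classical.arbitrary X) m₀).trans h9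
      have e2 : ∑ m, b * μ m * s m = b * ∑ m, μ m * s m := by
        rw [Finset.mul_sum]
        exact Finset.sum_congr rfl fun m _ => by ring
      simp only
      rw [e2]
      calc g = b * (n * k : ℕ) * g := by rw [hbn, one_mul]
        _ = b * (k * (n * g)) := by push_cast; ring
        _ ≤ _ := mul_le_mul_of_nonneg_left e1 hb0
    · simp only
      rw [← Finset.mul_sum, ← mul_sub, abs_mul, abs_of_nonneg hb0]
      have e1 : |μ m - ∑ m', T m' m| ≤ 1 := by
        have e2 := h5 m
        have e3 := h6 m
        rw [abs_le]
        split_ifs at e2 <;> constructor <;> linarith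
      have e4 : b ≤ 1 / k := by
        rw [hb, ← one_div]
        have : (k : ℝ) ≤ (n * k : ℕ) := by exact_mod_cast Nat.le_mul_of_pos_left k hn
        exact one_div_le_one_div_of_le (by exact_mod_cast hk) this
      calc b * |μ m - ∑ m', T m' m| ≤ b * 1 := mul_le_mul_of_nonneg_left e1 hb0
        _ ≤ 1 / k := by rw [mul_one]; exact e4
  set Fun : (M → ℝ) × (M → M → ℝ) → ℝ := fun a => ∑ m, |a.1 m - ∑ m', a.2 m' m| with hFun
  obtain ⟨a, haK, hamin⟩ := hKcompact.exists_isMinOn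
    ((happrox 1 one_pos).imp fun _ h => h.1) (f := Fun) (by fun_prop)
  have hzero : Fun a ≤ 0 := by
    have hlim : Tendsto (fun k : ℕ => (Fintype.card M : ℝ) / (k : ℝ)) atTop (𝓝 0) :=
      tendsto_const_div_atTop_nhds_zero_nat _
    refine ge_of_tendsto hlim ?_
    filter_upwards [eventually_gt_atTop 0] with k hk
    obtain ⟨a', ha', hle⟩ := happrox k hk
    refine (hamin ha').trans ?_
    calc Fun a' ≤ ∑ _m : M, (1 / k : ℝ) := Finset.sum_le_sum fun m _ => hle m
      _ = _ := by
        rw [Finset.sum_const, Finset.card_univ, nsmul_eq_mul, mul_one_div]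
  have hbal : ∀ m, ∑ m', a.2 m' m = a.1 m := by
    intro m
    have h1 : |a.1 m - ∑ m', a.2 m' m| ≤ 0 := le_trans
      (Finset.single_le_sum (f := fun m => |a.1 m - ∑ m', a.2 m' m|)
        (fun _ _ => abs_nonneg _) (Finset.mem_univ m)) hzero
    have h2 := abs_nonpos_iff.1 h1
    linarith
  obtain ⟨h1, h2, h3, h4, h5, h6, h7⟩ := haK
  exact ⟨a.1, a.2, ⟨h1, h2, h3, h4, hbal, h5⟩, h6, h7⟩

end Occupation

/-! ### Noisy channels -/

section Noisy

variable {N : ℕ} {Sch : Finset (Fin N → ℕ)} {X Y : Type*} [Fintype X] [Nonempty X] [Fintype Y]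
  {v : ℕ} {C : Channel X Y}

/-- The largest service which a schedule offers to queue `i`. -/
def maxService (Sch : Finset (Fin N → ℕ)) (i : Fin N) : ℕ := Sch.sup fun d => d i

theorem le_maxService {d : Fin N → ℕ} (hd : d ∈ Sch) (i : Fin N) : d i ≤ maxService Sch i :=
  Finset.le_sup (f := fun d : Fin N → ℕ => d i) hd

/-- If there are two maximal schedules, no schedule offers the largest service to all queues. -/
theorem exists_lt_maxService (hmax : HasTwoMaximal Sch) {d : Fin N → ℕ} (hd : d ∈ Sch) :
    ∃ i, d i < maxService Sch i := by
  by_contra! hcon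
  obtain ⟨d₁, h₁, d₂, h₂, hne⟩ := hmax
  have hle : ∀ e ∈ Sch, e ≤ d := fun e he i => (le_maxService he i).trans (hcon i)
  have e₁ := h₁.eq_of_le hd (hle d₁ h₁.1)
  have e₂ := h₂.eq_of_le hd (hle d₂ h₂.1)
  exact hne (e₁.trans e₂.symm)

omit [Fintype X] [Nonempty X] in
theorem Channel.prob_le_one (C : Channel X Y) (x : X) (y : Y) : C.prob x y ≤ 1 := by
  rw [← C.sum_prob x]
  exact Finset.single_le_sum (fun y _ => C.prob_nonneg x y) (Finset.mem_univ y)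

/-- The weight, over all messages, of the schedules that do not offer the largest service to
queue `i`. -/
noncomputable def lossWeight (ψ : AllocationPolicy Sch Y v) (m : Memory v) (i : Fin N) : ℝ :=
  ∑ d ∈ Sch with d i < maxService Sch i,
    ∑ y, (volume {u : unitInterval | ψ.alloc y m u = d}).toReal

omit [Fintype X] in
-- Every schedule falls short of `maxService` in some queue, so each message contributes at least
-- one.
theorem one_le_sum_lossWeight (C : Channel X Y) (hmax : HasTwoMaximal Sch)
    (ψ : AllocationPolicy Sch Y v) (m : Memory v) : 1 ≤ ∑ i, lossWeight ψ m i := by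
  have hY : 1 ≤ Fintype.card Y := by
    have : Nonempty Y := by
      by_contra h
      rw [not_nonempty_iff] at h
      have := C.sum_prob (Classical.arbitrary X)
      simp at this
    exact Fintype.card_pos
  have h1 : ∑ d ∈ Sch, ∑ y, (volume {u : unitInterval | ψ.alloc y m u = d}).toReal =
      Fintype.card Y := by
    rw [Finset.sum_comm]
    simp [sum_volume_alloc]
  have h2 : (1 : ℝ) ≤ Fintype.card Y := by exact_mod_cast hY
  rw [← h1] at h2
  refine h2.trans ?_
  simp only [lossWeight, Finset.sum_filter]
  conv_rhs => rw [Finset.sum_comm]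
  refine Finset.sum_le_sum fun d hd => ?_
  have h0 : ∀ d, 0 ≤ ∑ y, (volume {u : unitInterval | ψ.alloc y m u = d}).toReal := fun d =>
    Finset.sum_nonneg fun y _ => ENNReal.toReal_nonneg
  obtain ⟨i, hi⟩ := exists_lt_maxService hmax hd
  refine le_trans ?_ (Finset.single_le_sum (f := fun i => if d i < maxService Sch i then
    ∑ y, (volume {u : unitInterval | ψ.alloc y m u = d}).toReal else 0)
    (fun i _ => ?_) (Finset.mem_univ i))
  · rw [if_pos hi]
  · split_ifs
    · exact h0 d
    · exact le_rfl

omit [Fintype X] [Nonempty X] in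
-- Whatever the signal, each message has probability at least `c`, and a schedule short of the
-- maximum loses at least one unit.
theorem allocMean_le_maxService_sub {c : ℝ} (hC : ∀ x y, c ≤ C.prob x y)
    (ψ : AllocationPolicy Sch Y v) (x : X) (m : Memory v) (i : Fin N) :
    allocMean C ψ x m i ≤ maxService Sch i - c * lossWeight ψ m i := by
  have h1 : c * lossWeight ψ m i ≤ ∑ d ∈ Sch, allocProb C ψ x m d * (maxService Sch i - d i) := by
    simp only [lossWeight, Finset.sum_filter, Finset.mul_sum]
    refine Finset.sum_le_sum fun d hd => ?_
    have h0 : (d i : ℝ) ≤ maxService Sch i := by exact_mod_cast le_maxService hd i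
    split_ifs with h
    · have h2 : (d i : ℝ) + 1 ≤ maxService Sch i := by exact_mod_cast h
      refine le_trans ?_ (le_mul_of_one_le_right (allocProb_nonneg C ψ x m d) (by linarith))
      rw [allocProb, Finset.mul_sum]
      exact Finset.sum_le_sum fun y _ =>
        mul_le_mul_of_nonneg_right (hC x y) ENNReal.toReal_nonneg
    · rw [mul_zero]
      exact mul_nonneg (allocProb_nonneg C ψ x m d) (by linarith)
  simp only [mul_sub, Finset.sum_sub_distrib, ← Finset.sum_mul, sum_allocProb, one_mul] at h1
  rw [allocMean]
  linarith

/-- A receiver with finite memory cannot come arbitrarily close to the full capacity region, if all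
messages are possible on all signals. -/
theorem exists_forall_not_achieves (hN : 0 < N) (hmax : HasTwoMaximal Sch)
    {c : ℝ} (hc : 0 < c) (hC : ∀ x y, c ≤ C.prob x y) (v : ℕ) :
    ∃ ρ : ℝ, 0 ≤ ρ ∧ ρ < 1 ∧ ∀ ψ : AllocationPolicy Sch Y v, ¬ Achieves C ψ ρ := by
  classical
  set n := Fintype.card (Memory v) with hn
  have hn0 : (0 : ℝ) < n := by exact_mod_cast Fintype.card_pos
  have hN0 : (0 : ℝ) < N := by exact_mod_cast hN
  set D : ℝ := 1 + ∑ i, (maxService Sch i : ℝ) with hD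
  have hD0 : 0 < D := by positivity
  -- The service lost: a mass `1 / n` transferred between stationary laws, times a loss weight `1 /
  -- N`, times `c`. The choice of `τ` makes the tolerated loss at most `L / 2`.
  set L : ℝ := c * ((c ^ 2 / 2) ^ n * (1 / n) * (1 / N)) with hL
  have hL0 : 0 < L := by positivity
  set τ : ℝ := min (1 / 2) (L / (2 * D)) with hτ
  have hτ0 : 0 < τ := lt_min (by norm_num) (by positivity)
  refine ⟨1 - τ, by linarith [min_le_left (1 / 2) (L / (2 * D))], by linarith, ?_⟩
  rintro ψ ⟨n₁, hn₁, hach⟩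
  -- Dropping the message probabilities gives a reference independent of the signal, with `c * p₀ ≤
  -- recTrans ≤ p₀`.
  set p₀ : Memory v → Memory v → ℝ := fun m m' =>
    ∑ y, (volume {u : unitInterval | ψ.update y m u = m'}).toReal with hp₀
  have hp₀0 : ∀ m m', 0 ≤ p₀ m m' := fun m m' =>
    Finset.sum_nonneg fun y _ => ENNReal.toReal_nonneg
  have hlow : ∀ x m m', c * p₀ m m' ≤ recTrans C ψ x m m' := by
    intro x m m'
    rw [hp₀, recTrans, Finset.mul_sum]
    exact Finset.sum_le_sum fun y _ => mul_le_mul_of_nonneg_right (hC x y) ENNReal.toReal_nonneg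
  have hup : ∀ x m m', recTrans C ψ x m m' ≤ p₀ m m' := fun x m m' =>
    Finset.sum_le_sum fun y _ =>
      mul_le_of_le_one_left ENNReal.toReal_nonneg (C.prob_le_one x y)
  obtain ⟨R, hRne, hRcl, hirr⟩ := exists_irreducible_class p₀
  have hSch : Sch.Nonempty := by
    obtain ⟨d, hd, _⟩ := hmax
    exact ⟨d, hd.1⟩
  -- Put all the weight on queue `i`: the achieved reward yields a stationary law under which this
  -- queue loses little.
  have hflow : ∀ i, ∃ μ T, IsComparableFlow p₀ c μ T ∧ (∀ m, m ∉ R → μ m = 0) ∧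
      (1 - τ) * maxService Sch i ≤
        ∑ m, μ m * (maxService Sch i - c * lossWeight ψ m i) := by
    intro i
    have hq : ∀ j, 0 ≤ (Pi.single i 1 : Fin N → ℝ) j := fun j => by
      by_cases h : j = i
      · subst h; simp
      · simp [h]
    refine exists_isComparableFlow (recTrans_nonneg C ψ) (sum_recTrans C ψ) hc.le hp₀0 hlow hup
      hRne hRcl (q := Pi.single i 1) (r := allocMean C ψ) (fun x m => ?_) hn₁ (fun k x m => ?_)
    · rw [Finset.sum_eq_single i (fun j _ hj => by simp [hj]) (by simp), Pi.single_eq_same, one_mul]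
      exact allocMean_le_maxService_sub hC ψ x m i
    · refine mul_le_value_mul (recTrans_nonneg C ψ) (sum_recTrans C ψ) (allocMean_nonneg C ψ) hq
        (fun x m => ?_) k x m
      obtain ⟨d, hd, hdi⟩ := Finset.exists_mem_eq_sup Sch hSch fun d => d i
      have := hach _ hq d hd x m
      rw [Finset.sum_eq_single i (fun j _ hj => by simp [hj]) (by simp), Pi.single_eq_same,
        one_mul] at this
      rw [maxService, hdi]
      exact this
  choose μ T hμ hsupp hrew using hflow
  set i₀ : Fin N := ⟨0, hN⟩
  -- Pigeonhole twice: a memory frequent under the law of `i₀`, and a queue `i` losing there. By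
  -- comparability this memory is also frequent under the law of `i`, contradicting `hrew i`.
  obtain ⟨m, hm⟩ : ∃ m, 1 / (n : ℝ) ≤ μ i₀ m := by
    by_contra! hcon
    have h1 : ∑ m, μ i₀ m < ∑ _m : Memory v, 1 / (n : ℝ) :=
      Finset.sum_lt_sum_of_nonempty Finset.univ_nonempty fun m _ => hcon m
    rw [(hμ i₀).sum_eq_one, Finset.sum_const, Finset.card_univ, nsmul_eq_mul, ← hn,
      mul_one_div_cancel hn0.ne'] at h1
    exact lt_irrefl _ h1
  obtain ⟨i, hi⟩ : ∃ i, 1 / (N : ℝ) ≤ lossWeight ψ m i := by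
    by_contra! hcon
    have h1 : ∑ i, lossWeight ψ m i < ∑ _i : Fin N, 1 / (N : ℝ) :=
      Finset.sum_lt_sum_of_nonempty ⟨i₀, Finset.mem_univ _⟩ fun i _ => hcon i
    rw [Finset.sum_const, Finset.card_univ, nsmul_eq_mul, Fintype.card_fin,
      mul_one_div_cancel hN0.ne'] at h1
    exact not_le.2 h1 (one_le_sum_lossWeight C hmax ψ m)
  have hcomp := (hμ i₀).comparable (hμ i) hc hp₀0 hirr (hsupp i₀) (hsupp i) m
  have h1 : (c ^ 2 / 2) ^ n * (1 / n) ≤ μ i m :=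
    (mul_le_mul_of_nonneg_left hm (by positivity)).trans hcomp
  have h2 : (c ^ 2 / 2) ^ n * (1 / n) * (1 / N) ≤ ∑ m, μ i m * lossWeight ψ m i := by
    have h0 : ∀ m, 0 ≤ lossWeight ψ m i := fun m =>
      Finset.sum_nonneg fun d _ => Finset.sum_nonneg fun y _ => ENNReal.toReal_nonneg
    refine le_trans ?_ (Finset.single_le_sum (f := fun m => μ i m * lossWeight ψ m i)
      (fun m _ => mul_nonneg ((hμ i).nonneg m) (h0 m)) (Finset.mem_univ m))
    exact mul_le_mul h1 hi (by positivity) ((hμ i).nonneg m)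
  have h3 : ∑ m, μ i m * (maxService Sch i - c * lossWeight ψ m i) =
      maxService Sch i - c * ∑ m, μ i m * lossWeight ψ m i := by
    simp only [mul_sub, Finset.sum_sub_distrib, ← Finset.sum_mul, (hμ i).sum_eq_one, one_mul]
    congr 1
    rw [Finset.mul_sum]
    exact Finset.sum_congr rfl fun m _ => by ring
  have h4 := hrew i
  rw [h3] at h4
  have h5 : L ≤ c * ∑ m, μ i m * lossWeight ψ m i := mul_le_mul_of_nonneg_left h2 hc.le
  have h6 : (maxService Sch i : ℝ) ≤ D := by
    have := Finset.single_le_sum (f := fun i => (maxService Sch i : ℝ))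
      (fun _ _ => Nat.cast_nonneg _) (Finset.mem_univ i)
    linarith
  have h7 : τ * maxService Sch i ≤ L / 2 := by
    calc τ * maxService Sch i ≤ L / (2 * D) * D := by
          gcongr
          exact min_le_right _ _
      _ = L / 2 := by field_simp
  linarith

omit [Fintype X] [Nonempty X] in
theorem Channel.PositivelyMajorizing.exists_le_prob [Finite X] {C : Channel X Y} {ε : ℝ}
    (hε : 0 < ε) (hε1 : ε < 1) (h : C.PositivelyMajorizing ε) :
    ∃ c : ℝ, 0 < c ∧ ∀ x y, c ≤ C.prob x y := by
  obtain ⟨C₀, C₁, hC, -, -, hpos⟩ := h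
  have hCpos : ∀ a : X × Y, 0 < C.prob a.1 a.2 := by
    intro a
    rw [hC]
    simp only [Matrix.add_apply, Matrix.smul_apply, smul_eq_mul]
    have h1 := mul_pos hε (hpos a.1 a.2)
    have h2 := mul_nonneg (by linarith : 0 ≤ 1 - ε) (C₁.prob_nonneg a.1 a.2)
    linarith
  rcases isEmpty_or_nonempty (X × Y) with he | he
  · exact ⟨1, one_pos, fun x y => isEmptyElim (x, y)⟩
  · obtain ⟨a, ha⟩ := Finite.exists_min fun a : X × Y => C.prob a.1 a.2
    exact ⟨_, hCpos a, fun x y => ha (x, y)⟩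

theorem exists_capacityFactor_le (hserve : ServesEachQueue Sch) (hN : 0 < N)
    (hmax : HasTwoMaximal Sch) {c : ℝ} (hc : 0 < c) (hC : ∀ x y, c ≤ C.prob x y) (v : ℕ) :
    ∃ b : ℝ≥0∞, b < 1 ∧ ∀ k, capacityFactor Sch C k v ≤ b := by
  obtain ⟨ρ, hρ0, hρ1, hρ⟩ := exists_forall_not_achieves hN hmax hc hC v
  have hSch : Sch.Nonempty := by
    obtain ⟨d, hd, _⟩ := hmax
    exact ⟨d, hd.1⟩
  lift ρ to ℝ≥0 using hρ0
  refine ⟨ρ, by exact_mod_cast hρ1, fun k => iSup₂_le fun φ ψ => iSup₂_le fun s hs => ?_⟩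
  by_contra hlt
  have hlt' : ρ < s := by exact_mod_cast not_le.1 hlt
  exact hρ ψ (achieves_of_smul_mem_capacityRegion C ψ hserve hSch (NNReal.coe_lt_coe.2 hlt')
    ρ.2 hs).1

end Noisy

/-! ### A receiver with large memory

The receiver keeps a schedule and a counter of consecutive occurrences of a message `y₀`. When the
counter overflows, it draws a new schedule at random. Messages are only read in every second slot,
so that the encoder need not know the last signal. -/

section RunReceiver

variable {N : ℕ} {Sch : Finset (Fin N → ℕ)} {X Y : Type*} [Fintype Y] {v L : ℕ}

/-- The memory of the receiver: the parity of the slot, the schedule in use and the counter. -/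
abbrev RunMemory (Sch : Finset (Fin N → ℕ)) (L : ℕ) : Type := Bool × Sch × Fin (L + 1)

/-- The counter overflows when the message `y₀` is received at its largest value. -/
def runSuccess (t : Sch × Fin (L + 1)) (d' : Sch) : RunMemory Sch L :=
  if h : (t.2 : ℕ) < L then (false, t.1, ⟨t.2 + 1, Nat.succ_lt_succ h⟩) else (false, d', 0)

open Classical in
/-- The next memory, on the message `y` and with `d'` the schedule drawn at random. -/
noncomputable def runNext (y₀ y : Y) (t : RunMemory Sch L) (d' : Sch) : RunMemory Sch L :=
  if t.1 then (if y = y₀ then runSuccess t.2 d' else (false, t.2.1, 0)) else (true, t.2)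

/-- The receiver which changes its schedule after a run of messages `y₀`. -/
noncomputable def runReceiver (y₀ : Y) (dec : Memory v → RunMemory Sch L)
    (ι : RunMemory Sch L → Memory v) (g : unitInterval → Sch)
    (hg : ∀ d, MeasurableSet {u | g u = d}) : AllocationPolicy Sch Y v where
  alloc _ m _ := (dec m).2.1
  update y m u := ι (runNext y₀ y (dec m) (g u))
  alloc_mem _ m _ := (dec m).2.1.2
  measurable_alloc _ _ _ := MeasurableSet.const _
  measurable_update y m m' := by
    have : {u | ι (runNext y₀ y (dec m) (g u)) = m'} =
        ⋃ d ∈ {d | ι (runNext y₀ y (dec m) d) = m'}, {u | g u = d} := by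
      ext u
      simp
    rw [this]
    exact MeasurableSet.biUnion (Set.to_countable _) fun d _ => hg d

variable {y₀ : Y} {dec : Memory v → RunMemory Sch L} {ι : RunMemory Sch L → Memory v}
  {g : unitInterval → Sch} {hg : ∀ d, MeasurableSet {u | g u = d}}

theorem sum_volume_comp {A B : Type*} [Fintype A] [Fintype B] {g : unitInterval → A}
    (hg : ∀ a, MeasurableSet {u | g u = a}) (F : A → B) (h : B → ℝ) :
    ∑ b, (volume {u | F (g u) = b}).toReal * h b =
      ∑ a, (volume {u | g u = a}).toReal * h (F a) := by
  classical
  have h1 : ∀ b, (volume {u | F (g u) = b}).toReal =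
      ∑ a, if F a = b then (volume {u | g u = a}).toReal else 0 := by
    intro b
    rw [← Finset.sum_filter]
    symm
    refine sum_volume_toReal_eq _ _ _ (fun a _ => hg a) ?_ ?_
    · have := pairwiseDisjoint_fiber g ((Finset.univ.filter fun a => F a = b : Finset A) : Set A)
        Set.univ
      simpa using this
    · ext u; simp
  simp only [h1, Finset.sum_mul, ite_mul, zero_mul]
  rw [Finset.sum_comm]
  simp

theorem sum_volume_fiber {A : Type*} [Fintype A] {g : unitInterval → A}
    (hg : ∀ a, MeasurableSet {u | g u = a}) : ∑ a, (volume {u | g u = a}).toReal = 1 := by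
  rw [sum_volume_toReal_eq Finset.univ Set.univ _ fun a _ => hg a]
  · simp
  · have := pairwiseDisjoint_fiber g Set.univ Set.univ
    simpa using this
  · ext u; simp

/-- Passage to decoded states; memories outside the range of `ι` carry no weight. -/
theorem sum_recTrans_runReceiver (C : Channel X Y) (hdec : ∀ t, dec (ι t) = t) (x : X)
    (m : Memory v) (Φ : RunMemory Sch L → ℝ) :
    ∑ m', recTrans C (runReceiver y₀ dec ι g hg) x m m' * Φ (dec m') =
      ∑ y, C.prob x y * ∑ d, (volume {u | g u = d}).toReal * Φ (runNext y₀ y (dec m) d) := by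
  simp only [recTrans, Finset.sum_mul]
  rw [Finset.sum_comm]
  refine Finset.sum_congr rfl fun y _ => ?_
  have := sum_volume_comp hg (fun d => ι (runNext y₀ y (dec m) d)) fun m' => Φ (dec m')
  simp only [hdec] at this
  rw [← this, Finset.mul_sum]
  exact Finset.sum_congr rfl fun m' _ => by rw [← mul_assoc]; rfl

theorem sum_recTrans_of_parity_false (C : Channel X Y) (hdec : ∀ t, dec (ι t) = t) (x : X)
    {m : Memory v} (hm : (dec m).1 = false) (Φ : RunMemory Sch L → ℝ) :
    ∑ m', recTrans C (runReceiver y₀ dec ι g hg) x m m' * Φ (dec m') = Φ (true, (dec m).2) := by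
  rw [sum_recTrans_runReceiver C hdec]
  simp only [runNext, hm, Bool.false_eq_true, if_false, ← Finset.sum_mul, sum_volume_fiber hg,
    one_mul, C.sum_prob]

theorem sum_recTrans_of_parity_true (C : Channel X Y) (hdec : ∀ t, dec (ι t) = t) (x : X)
    {m : Memory v} (hm : (dec m).1 = true) (Φ : RunMemory Sch L → ℝ) :
    ∑ m', recTrans C (runReceiver y₀ dec ι g hg) x m m' * Φ (dec m') =
      C.prob x y₀ * ∑ d, (volume {u | g u = d}).toReal * Φ (runSuccess (dec m).2 d) +
        (1 - C.prob x y₀) * Φ (false, (dec m).2.1, 0) := by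
  classical
  rw [sum_recTrans_runReceiver C hdec, ← C.sum_prob x, ← Finset.add_sum_erase _ _
    (Finset.mem_univ y₀), ← Finset.add_sum_erase (a := y₀) Finset.univ (fun y => C.prob x y)
    (Finset.mem_univ y₀), add_sub_cancel_left, Finset.sum_mul]
  congr 1
  · simp [runNext, hm]
  · refine Finset.sum_congr rfl fun y hy => ?_
    simp only [runNext, hm, if_true, if_neg (Finset.ne_of_mem_erase hy), ← Finset.sum_mul,
      sum_volume_fiber hg, one_mul]

theorem allocMean_runReceiver (C : Channel X Y) (x : X) (m : Memory v) (i : Fin N) :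
    allocMean C (runReceiver y₀ dec ι g hg) x m i = ((dec m).2.1 : Fin N → ℕ) i := by
  classical
  have h1 : ∀ d : Fin N → ℕ, allocProb C (runReceiver y₀ dec ι g hg) x m d =
      if ((dec m).2.1 : Fin N → ℕ) = d then 1 else 0 := by
    intro d
    rw [allocProb]
    simp only [runReceiver]
    split_ifs with h
    · simp [h, C.sum_prob]
    · simp [h]
  rw [allocMean]
  simp [h1]

theorem recTrans_eq_of_parity_false (C : Channel X Y) (x₁ x₂ : X) {m : Memory v}
    (hm : (dec m).1 = false) (m' : Memory v) :
    recTrans C (runReceiver y₀ dec ι g hg) x₁ m m' =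
      recTrans C (runReceiver y₀ dec ι g hg) x₂ m m' := by
  simp only [recTrans, runReceiver, runNext, hm, Bool.false_eq_true, if_false, ← Finset.sum_mul,
    C.sum_prob]

theorem recTrans_eq_zero_of_parity_true (C : Channel X Y) (hdec : ∀ t, dec (ι t) = t) (x : X)
    {m m' : Memory v} (hm : (dec m).1 = true) (hm' : (dec m').1 = true) :
    recTrans C (runReceiver y₀ dec ι g hg) x m m' = 0 := by
  refine Finset.sum_eq_zero fun y _ => ?_
  have : {u : unitInterval | (runReceiver y₀ dec ι g hg).update y m u = m'} = ∅ := by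
    ext u
    simp only [runReceiver, Set.mem_ofPred_eq, Set.mem_empty_iff_false, iff_false]
    intro h
    have h2 : (runNext y₀ y (dec m) (g u)).1 = true := by rw [← hdec (runNext _ _ _ _), h, hm']
    simp only [runNext, hm, if_true, runSuccess] at h2
    split_ifs at h2
  rw [this]
  simp

/-- The encoder needs no memory to control this receiver optimally. -/
theorem isImplementable_runReceiver [Fintype X] [Nonempty X] (C : Channel X Y)
    (hdec : ∀ t, dec (ι t) = t) (k : ℕ) :
    IsImplementable C (runReceiver y₀ dec ι g hg) k := by
  set ψ := runReceiver y₀ dec ι g hg with hψ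
  have hobj : ∀ (β : ℝ) (q : Fin N → ℝ) (u : X → Memory v → ℝ) (x₁ x₂ : X) (m : Memory v),
      (dec m).1 = false → objective (recTrans C ψ) (allocMean C ψ) β q u x₁ m =
        objective (recTrans C ψ) (allocMean C ψ) β q u x₂ m := by
    intro β q u x₁ x₂ m hm
    funext x'
    simp only [objective, hψ, recTrans_eq_of_parity_false C x₁ x₂ hm]
  have hval : ∀ (β : ℝ) (q : Fin N → ℝ) n (x₁ x₂ : X) (m : Memory v), (dec m).1 = false →
      value (recTrans C ψ) (allocMean C ψ) β q n x₁ m =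
        value (recTrans C ψ) (allocMean C ψ) β q n x₂ m := by
    intro β q n x₁ x₂ m hm
    cases n with
    | zero => rfl
    | succ n => rw [value_succ, bellman, bellman, hobj β q _ x₁ x₂ m hm]
  -- With parity `false` the message of the last signal is not read, so the best next signal does
  -- not depend on it. With parity `true` the next signal will not be read and the service ignores
  -- it, so any choice is optimal.
  refine isImplementable_of_independent (fun β q n m => ?_) k
  cases hm : (dec m).1 with
  | false =>
    obtain ⟨x', hx'⟩ := exists_objective_eq_bellman (p := recTrans C ψ) (r := allocMean C ψ)
      (β := β) (q := q) (value (recTrans C ψ) (allocMean C ψ) β q n) (Classical.arbitrary X) m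
    refine ⟨x', fun x => ?_⟩
    rw [hobj β q _ x (Classical.arbitrary X) m hm, hx', bellman, bellman,
      hobj β q _ x (Classical.arbitrary X) m hm]
  | true =>
    refine ⟨Classical.arbitrary X, fun x => ?_⟩
    obtain ⟨x', hx'⟩ := exists_objective_eq_bellman (p := recTrans C ψ) (r := allocMean C ψ)
      (β := β) (q := q) (value (recTrans C ψ) (allocMean C ψ) β q n) x m
    rw [← hx']
    simp only [objective]
    congr 1
    · simp only [hψ, allocMean_runReceiver]
    · congr 1
      refine Finset.sum_congr rfl fun m' _ => ?_
      cases hm' : (dec m').1 with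
      | false => rw [hval β q n _ x' m' hm']
      | true => simp only [hψ, recTrans_eq_zero_of_parity_true C hdec x hm hm', zero_mul]

theorem recStep_runReceiver (C : Channel X Y) (hg0 : ∀ d, volume {u | g u = d} ≠ 0) (x x' : X)
    (m : Memory v) {y : Y} (hy : C.prob x y ≠ 0) (d : Sch) :
    RecStep C (runReceiver y₀ dec ι g hg) (x, m) (x', ι (runNext y₀ y (dec m) d)) := by
  intro h0
  simp only [recTrans] at h0
  rw [Finset.sum_eq_zero_iff_of_nonneg fun y _ =>
    mul_nonneg (C.prob_nonneg x y) ENNReal.toReal_nonneg] at h0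
  have h1 := (mul_eq_zero.1 (h0 y (Finset.mem_univ y))).resolve_left hy
  rw [ENNReal.toReal_eq_zero_iff] at h1
  have h2 := h1.resolve_right (measure_ne_top _ _)
  refine hg0 d (measure_mono_null ?_ h2)
  rintro u rfl
  rfl

/-- If `x₀` is always sent, all messages read may be `y₀`; the counter then overflows and `d₀` may
be drawn. -/
theorem hasReachableMemory_runReceiver (C : Channel X Y) (hdec : ∀ t, dec (ι t) = t)
    (hg0 : ∀ d, volume {u | g u = d} ≠ 0) {x₀ : X} (hx₀ : C.prob x₀ y₀ ≠ 0) (d₀ : Sch) :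
    HasReachableMemory C (runReceiver y₀ dec ι g hg) := by
  have hstep := recStep_runReceiver (y₀ := y₀) (dec := dec) (ι := ι) (hg := hg) C hg0
  have heven : ∀ (j : ℕ) (d : Sch) (c : Fin (L + 1)), L - (c : ℕ) = j →
      Relation.ReflTransGen (RecStep C (runReceiver y₀ dec ι g hg)) (x₀, ι (false, d, c))
        (x₀, ι (false, d₀, 0)) := by
    intro j
    induction j with
    | zero =>
      intro d c hc
      have h1 := hstep x₀ x₀ (ι (false, d, c)) hx₀ d₀
      have h2 := hstep x₀ x₀ (ι (true, d, c)) hx₀ d₀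
      rw [hdec] at h1 h2
      have hcL : ¬ (c : ℕ) < L := by omega
      simp only [runNext, Bool.false_eq_true, if_false, if_true, runSuccess, hcL, dif_neg,
        not_false_eq_true] at h1 h2
      exact (Relation.ReflTransGen.single h2).head h1
    | succ j ih =>
      intro d c hc
      have h1 := hstep x₀ x₀ (ι (false, d, c)) hx₀ d₀
      have h2 := hstep x₀ x₀ (ι (true, d, c)) hx₀ d₀
      rw [hdec] at h1 h2
      have hcL : (c : ℕ) < L := by omega
      simp only [runNext, Bool.false_eq_true, if_false, if_true, runSuccess, hcL, dif_pos] at h1 h2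
      exact ((ih d _ (by simp only; omega)).head h2).head h1
  have hall : ∀ t : RunMemory Sch L,
      Relation.ReflTransGen (RecStep C (runReceiver y₀ dec ι g hg)) (x₀, ι t)
        (x₀, ι (false, d₀, 0)) := by
    rintro ⟨b, d, c⟩
    cases b with
    | false => exact heven _ d c rfl
    | true =>
      have h2 := hstep x₀ x₀ (ι (true, d, c)) hx₀ d₀
      rw [hdec] at h2
      simp only [runNext, if_true, runSuccess] at h2
      split_ifs at h2 with h
      · exact (heven _ d _ rfl).head h2
      · exact (heven _ d₀ 0 rfl).head h2
  -- A memory outside the range of `ι` enters it after one step.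
  refine ⟨(x₀, ι (false, d₀, 0)), fun s => ?_⟩
  obtain ⟨y, _, hy⟩ : ∃ y ∈ Finset.univ, C.prob s.1 y ≠ 0 :=
    Finset.exists_ne_zero_of_sum_ne_zero (by rw [C.sum_prob]; exact one_ne_zero)
  exact (hall _).head (hstep s.1 x₀ s.2 hy d₀)

/-! ### Waiting times for runs of successes -/

/-- The mean number of trials with success probability `a` until `c` consecutive successes. -/
noncomputable def runTime (a : ℝ) : ℕ → ℝ
  | 0 => 0
  | c + 1 => (1 + runTime a c) / a

theorem mul_runTime_succ {a : ℝ} (ha : a ≠ 0) (c : ℕ) : a * runTime a (c + 1) = 1 + runTime a c :=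
  mul_div_cancel₀ _ ha

theorem runTime_nonneg {a : ℝ} (ha : 0 < a) (c : ℕ) : 0 ≤ runTime a c := by
  induction c with
  | zero => exact le_rfl
  | succ c ih => exact div_nonneg (by linarith) ha.le

theorem inv_pow_le_runTime {a : ℝ} (ha : 0 < a) (c : ℕ) : (a⁻¹) ^ (c + 1) ≤ runTime a (c + 1) := by
  induction c with
  | zero => simp [runTime]
  | succ c ih =>
    rw [pow_succ, runTime, div_eq_mul_inv]
    exact mul_le_mul_of_nonneg_right (by linarith) (by positivity)

theorem runTime_le {a : ℝ} (ha : 0 < a) (ha1 : a ≤ 1) (c : ℕ) : runTime a c ≤ c * (a⁻¹) ^ c := by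
  induction c with
  | zero => simp [runTime]
  | succ c ih =>
    rw [pow_succ, runTime, div_eq_mul_inv, ← mul_assoc]
    refine mul_le_mul_of_nonneg_right ?_ (by positivity)
    have : 1 ≤ (a⁻¹) ^ c := one_le_pow₀ ((one_le_inv₀ ha).2 ha1)
    push_cast
    linarith

/-- Long runs are exponentially more frequent for the larger success probability. -/
theorem exists_mul_runTime_le {a b : ℝ} (ha : 0 < a) (hab : a < b) (hb : b ≤ 1) {K : ℝ}
    (hK : 0 ≤ K) : ∃ L : ℕ, K * runTime b (L + 1) ≤ runTime a (L + 1) := by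
  have hb0 : 0 < b := ha.trans hab
  -- The bounds `(a⁻¹) ^ n` from below and `n * (b⁻¹) ^ n` from above reduce the claim to `K * (n *
  -- (a / b) ^ n) < 1`.
  have hθ : a / b < 1 := (div_lt_one hb0).2 hab
  have hlim := (tendsto_self_mul_const_pow_of_lt_one (div_nonneg ha.le hb0.le) hθ).const_mul K
  rw [mul_zero] at hlim
  obtain ⟨n, hn, hn0⟩ := ((hlim.eventually (gt_mem_nhds one_pos)).and
    (eventually_gt_atTop 0)).exists
  obtain ⟨L, rfl⟩ := Nat.exists_eq_succ_of_ne_zero hn0.ne'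
  refine ⟨L, ?_⟩
  calc K * runTime b (L + 1) ≤ K * ((L + 1 : ℕ) * (b⁻¹) ^ (L + 1)) :=
        mul_le_mul_of_nonneg_left (runTime_le hb0 hb (L + 1)) hK
    _ = K * ((L + 1 : ℕ) * (a / b) ^ (L + 1)) * (a⁻¹) ^ (L + 1) := by
        rw [div_eq_mul_inv, mul_pow]
        have : a ^ (L + 1) * (a⁻¹) ^ (L + 1) = 1 := by
          rw [← mul_pow, mul_inv_cancel₀ ha.ne', one_pow]
        linear_combination (-(K * ((L + 1 : ℕ) * (b⁻¹) ^ (L + 1)))) * this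
    _ ≤ 1 * (a⁻¹) ^ (L + 1) := mul_le_mul_of_nonneg_right hn.le (by positivity)
    _ ≤ runTime a (L + 1) := by rw [one_mul]; exact inv_pow_le_runTime ha L

open Classical in
/-- The relative value of a schedule and a counter, if `target` is the schedule to be used. -/
noncomputable def runBias (γ A a b : ℝ) (target : Sch) (d : Sch) (c : ℕ) : ℝ :=
  if d = target then A - (1 - γ) * runTime a c else γ * runTime b c

-- An average reward inequality with gain `γ`. Off the target the bias rises by `γ` per trial
-- towards `γ * runTime b (L + 1)` at overflow, which the redraw matches: the target comes with
-- probability at least `η` and is worth `A`. On the target the reward is one and the bias falls by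
-- at most `1 - γ` per trial; by `hA2` it would be nonpositive at overflow, so a redraw does no
-- harm.
open Classical in
theorem le_runBias_step {γ A a b η : ℝ} (hγ0 : 0 ≤ γ) (hγ1 : γ ≤ 1) (ha : 0 < a) (hb : 0 < b)
    (hg : ∀ d, MeasurableSet {u | g u = d}) (hη : 0 < η)
    (hgη : ∀ d, η ≤ (volume {u | g u = d}).toReal) (hA : η * A = γ * runTime b (L + 1))
    (hA2 : A ≤ (1 - γ) * runTime a (L + 1)) (target : Sch) (t : Sch × Fin (L + 1)) {s : ℝ}
    (hs0 : 0 ≤ s) (hs : if t.1 = target then s ≤ a else s = b) :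
    γ + runBias γ A a b target t.1 t.2 ≤ (if t.1 = target then 1 else 0) +
      (s * ∑ d, (volume {u | g u = d}).toReal * runBias γ A a b target
        (runSuccess (L := L) t d).2.1 (runSuccess (L := L) t d).2.2 +
      (1 - s) * runBias γ A a b target t.1 0) := by
  have hA0 : 0 ≤ A := by
    have h0 : 0 ≤ η * A := hA ▸ mul_nonneg hγ0 (runTime_nonneg hb _)
    exact nonneg_of_mul_nonneg_right h0 hη
  have hexit : γ * runTime b (L + 1) ≤
      ∑ d, (volume {u | g u = d}).toReal * runBias γ A a b target d 0 := by
    have h1 : ∀ d, 0 ≤ (volume {u | g u = d}).toReal * runBias γ A a b target d 0 := by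
      intro d
      refine mul_nonneg ENNReal.toReal_nonneg ?_
      simp only [runBias, runTime, mul_zero, sub_zero]
      split_ifs
      · exact hA0
      · exact le_rfl
    refine le_trans ?_ (Finset.single_le_sum (fun d _ => h1 d) (Finset.mem_univ target))
    rw [← hA]
    simp only [runBias, if_true, runTime, mul_zero, sub_zero]
    exact mul_le_mul_of_nonneg_right (hgη target) hA0
  obtain ⟨d, c⟩ := t
  by_cases hc : (c : ℕ) < L
  · simp only [runSuccess, hc, dif_pos, ← Finset.sum_mul, sum_volume_fiber hg, one_mul]
    by_cases hd : d = target
    · simp only [hd, if_true, runBias] at hs ⊢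
      have h1 := mul_runTime_succ ha.ne' (c : ℕ)
      have h2 : s * runTime a (c + 1) ≤ 1 + runTime a c := by
        rw [← h1]
        exact mul_le_mul_of_nonneg_right hs (runTime_nonneg ha _)
      have h3 := mul_le_mul_of_nonneg_left h2 (by linarith : 0 ≤ 1 - γ)
      have h0 : runTime a 0 = 0 := rfl
      rw [h0]
      linarith
    · simp only [hd, if_false, runBias] at hs ⊢
      have h1 := mul_runTime_succ hb.ne' (c : ℕ)
      have h0 : runTime b 0 = 0 := rfl
      rw [h0, hs]
      linear_combination (-γ) * h1
  · have hcL : (c : ℕ) = L := by have := c.2; omega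
    have hsucc : ∀ d', runSuccess (L := L) (d, c) d' = (false, d', 0) := fun d' => by
      simp [runSuccess, hc]
    simp only [hsucc, Fin.val_zero, hcL]
    set e := ∑ d, (volume {u | g u = d}).toReal * runBias γ A a b target d 0
    by_cases hd : d = target
    · simp only [hd, if_true, runBias] at hs ⊢
      have h1 := mul_runTime_succ ha.ne' L
      have h0 : runTime a 0 = 0 := rfl
      have h4 : 0 ≤ e := (mul_nonneg hγ0 (runTime_nonneg hb _)).trans hexit
      have h2 : s * A ≤ (1 - γ) * (1 + runTime a L) := by
        calc s * A ≤ a * ((1 - γ) * runTime a (L + 1)) := mul_le_mul hs hA2 hA0 ha.le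
          _ = _ := by rw [← h1]; ring
      have h5 := mul_nonneg hs0 h4
      rw [h0]
      linarith
    · simp only [hd, if_false, runBias] at hs ⊢
      have h1 := mul_runTime_succ hb.ne' L
      have h0 : runTime b 0 = 0 := rfl
      have h2 := mul_le_mul_of_nonneg_left hexit hb.le
      rw [h0, hs]
      linear_combination h2 - γ * h1

end RunReceiver

/-! ### Capacity factor of receivers with large memory -/

section RunReceiverCapacity

variable {N : ℕ} {Sch : Finset (Fin N → ℕ)} {X Y : Type*} [Fintype X] [Nonempty X] [Fintype Y]
  {v L : ℕ} {y₀ : Y} {dec : Memory v → RunMemory Sch L} {ι : RunMemory Sch L → Memory v}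
  {g : unitInterval → Sch}

/-- With long runs, the receiver uses the schedule chosen by the encoder most of the time. -/
theorem achieves_runReceiver (C : Channel X Y) (hdec : ∀ t, dec (ι t) = t)
    (hg : ∀ d, MeasurableSet {u | g u = d}) {x₀ x₁ : X} {γ ρ A a η : ℝ} (hγ0 : 0 ≤ γ)
    (hγ1 : γ ≤ 1) (hργ : ρ < γ) (ha : 0 < a) (hx₁ : C.prob x₁ y₀ ≤ a)
    (hx₀ : 0 < C.prob x₀ y₀) (hη : 0 < η) (hgη : ∀ d, η ≤ (volume {u | g u = d}).toReal)
    (hA : η * A = γ * runTime (C.prob x₀ y₀) (L + 1)) (hA2 : A ≤ (1 - γ) * runTime a (L + 1)) :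
    Achieves C (runReceiver y₀ dec ι g hg) ρ := by
  classical
  set B : Sch → Sch → ℕ → ℝ := runBias γ A a (C.prob x₀ y₀) with hB
  set E : Sch → X → Sch × Fin (L + 1) → ℝ := fun s x t =>
    C.prob x y₀ * ∑ d, (volume {u | g u = d}).toReal *
      B s (runSuccess (L := L) t d).2.1 (runSuccess (L := L) t d).2.2 +
      (1 - C.prob x y₀) * B s t.1 0 with hE
  set I : Sch → Sch → ℝ := fun s d => if d = s then 1 else 0 with hI
  -- The counter moves in every second slot, whence the factor 2. With parity `true` the last signal
  -- `x` is fixed and its message is about to be read.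
  set h₀ : Sch → X → RunMemory Sch L → ℝ := fun s x t =>
    if t.1 then I s t.2.1 - γ + 2 * E s x t.2 else 2 * B s t.2.1 t.2.2 with hh₀
  obtain ⟨K, hK⟩ := Finite.exists_le fun t : Sch × X × RunMemory Sch L => |h₀ t.1 t.2.1 t.2.2|
  have hK1 : ∀ s x t, h₀ s x t ≤ K := fun s x t => (le_abs_self _).trans (hK (s, x, t))
  have hK2 : ∀ s x t, -K ≤ h₀ s x t := fun s x t => (abs_le.1 (hK (s, x, t))).1
  -- The bounded bias costs at most `2 * K`, repaid at `γ - ρ` per slot.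
  obtain ⟨n, hn⟩ := exists_nat_ge (2 * K / (γ - ρ))
  refine ⟨n + 1, Nat.succ_pos n, fun q hq d hd x m => ?_⟩
  set s : Sch := ⟨d, hd⟩ with hs
  set Q := ∑ i, q i * (d i : ℝ) with hQ
  have hQ0 : 0 ≤ Q := Finset.sum_nonneg fun i _ => mul_nonneg (hq i) (Nat.cast_nonneg _)
  -- Hold the wanted schedule with `x₁`, force a change with `x₀`.
  set f : X → Memory v → X := fun _ m => if (dec m).2.1 = s then x₁ else x₀ with hf
  have key : ∀ x m, γ * Q + Q * h₀ s x (dec m) ≤ objective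
      (recTrans C (runReceiver y₀ dec ι g hg)) (allocMean C (runReceiver y₀ dec ι g hg)) 1 q
      (fun x m => Q * h₀ s x (dec m)) x m (f x m) := by
    intro x m
    have h1 : Q * I s (dec m).2.1 ≤
        ∑ i, q i * allocMean C (runReceiver y₀ dec ι g hg) (f x m) m i := by
      simp only [allocMean_runReceiver, hI]
      split_ifs with h
      · rw [h, mul_one]
      · rw [mul_zero]
        exact Finset.sum_nonneg fun i _ => mul_nonneg (hq i) (Nat.cast_nonneg _)
    have h2 : ∑ m', recTrans C (runReceiver y₀ dec ι g hg) x m m' * (Q * h₀ s (f x m) (dec m')) =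
        Q * ∑ m', recTrans C (runReceiver y₀ dec ι g hg) x m m' * h₀ s (f x m) (dec m') := by
      rw [Finset.mul_sum]
      exact Finset.sum_congr rfl fun m' _ => by ring
    have h3 : γ + h₀ s x (dec m) ≤ I s (dec m).2.1 +
        ∑ m', recTrans C (runReceiver y₀ dec ι g hg) x m m' * h₀ s (f x m) (dec m') := by
      cases hm : (dec m).1 with
      | false =>
        rw [sum_recTrans_of_parity_false C hdec x hm]
        simp only [hh₀, hm, Bool.false_eq_true, if_false, if_true]
        have h4 := le_runBias_step hγ0 hγ1 ha hx₀ hg hη hgη hA hA2 s (dec m).2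
          (s := C.prob (f x m) y₀) (C.prob_nonneg _ _) (by
            simp only [hf]
            split_ifs
            · exact hx₁
            · rfl)
        simp only [hB, hE, hI] at h4 ⊢
        linarith
      | true =>
        rw [sum_recTrans_of_parity_true C hdec x hm]
        have hpar : ∀ d, (runSuccess (dec m).2 d).1 = false := by
          intro d
          unfold runSuccess
          split_ifs <;> rfl
        simp only [hh₀, hm, hpar, Bool.false_eq_true, if_false, if_true, hE, Fin.val_zero]
        have h5 : ∑ d, (volume {u | g u = d}).toReal * (2 * B s (runSuccess (dec m).2 d).2.1
            (runSuccess (dec m).2 d).2.2) = 2 * ∑ d, (volume {u | g u = d}).toReal *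
              B s (runSuccess (dec m).2 d).2.1 (runSuccess (dec m).2 d).2.2 := by
          rw [Finset.mul_sum]
          exact Finset.sum_congr rfl fun d _ => by ring
        rw [h5]
        linarith
    rw [objective, one_mul, h2]
    have h6 := mul_le_mul_of_nonneg_left h3 hQ0
    linarith
  have h1 := le_value_of_le_objective (recTrans_nonneg C _) (sum_recTrans C _) (H := Q * K)
    (fun x m => mul_le_mul_of_nonneg_left (hK1 s x (dec m)) hQ0) f key (n + 1) x m
  refine le_trans ?_ h1
  have h2 := mul_le_mul_of_nonneg_left (hK2 s x (dec m)) hQ0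
  have h3 : 2 * K ≤ (n + 1) * (γ - ρ) := by
    rw [div_le_iff₀ (by linarith)] at hn
    linarith
  have h4 := mul_le_mul_of_nonneg_right h3 hQ0
  push_cast
  linarith

/-- With an informative channel, receivers with large memory achieve any fraction of the maximum
capacity region, without encoder memory. -/
theorem exists_receiver_achieves (hSch : Sch.Nonempty) {C : Channel X Y} (hC : C.Informative)
    {ρ : ℝ} (hρ0 : 0 ≤ ρ) (hρ1 : ρ < 1) :
    ∃ v₀ : ℕ, ∀ v, v₀ ≤ v → ∃ ψ : AllocationPolicy Sch Y v, Achieves C ψ ρ ∧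
      HasReachableMemory C ψ ∧ ∀ k, IsImplementable C ψ k := by
  obtain ⟨x₁, x₀, y₀, hlt⟩ : ∃ x₁ x₀ y₀, C.prob x₁ y₀ < C.prob x₀ y₀ := by
    obtain ⟨x, x', hne⟩ := hC
    obtain ⟨y, hy⟩ := Function.ne_iff.1 hne
    rcases lt_or_gt_of_ne hy with h | h
    · exact ⟨x, x', y, h⟩
    · exact ⟨x', x, y, h⟩
  obtain ⟨d₀, hd₀⟩ := hSch
  have : Nonempty Sch := ⟨⟨d₀, hd₀⟩⟩
  obtain ⟨g, hg, hg0⟩ := exists_random_selection Sch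
  obtain ⟨dmin, hmin⟩ := Finite.exists_min fun d : Sch => (volume {u | g u = d}).toReal
  set η := (volume {u | g u = dmin}).toReal with hη
  have hη0 : 0 < η := ENNReal.toReal_pos (hg0 dmin) (measure_ne_top _ _)
  set b := C.prob x₀ y₀ with hb
  have hb0 : 0 < b := (C.prob_nonneg _ _).trans_lt hlt
  -- A midpoint, because `C.prob x₁ y₀` may vanish while `runTime` needs a positive probability.
  set a := (C.prob x₁ y₀ + b) / 2 with ha
  have ha0 : 0 < a := by linarith [C.prob_nonneg x₁ y₀]
  set γ := (1 + ρ) / 2 with hγ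
  have hγ1 : 0 < 1 - γ := by linarith
  obtain ⟨L, hL⟩ := exists_mul_runTime_le ha0 (by linarith : a < b) (C.prob_le_one x₀ y₀)
    (K := γ / (η * (1 - γ))) (div_nonneg (by linarith) (by positivity))
  have hA2 : γ * runTime b (L + 1) / η ≤ (1 - γ) * runTime a (L + 1) := by
    have := mul_le_mul_of_nonneg_left hL hγ1.le
    refine le_trans (le_of_eq ?_) this
    field_simp
  refine ⟨Fintype.card (RunMemory Sch L), fun v hv => ?_⟩
  obtain ⟨ι⟩ : Nonempty (RunMemory Sch L ↪ Memory v) := by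
    refine Function.Embedding.nonempty_of_card_le (hv.trans ?_)
    simpa using (Nat.lt_two_pow_self (n := v)).le
  have hdec : ∀ t, Function.invFun ι (ι t) = t := Function.leftInverse_invFun ι.injective
  refine ⟨runReceiver y₀ (Function.invFun ι) ι g hg, ?_, ?_, ?_⟩
  · refine achieves_runReceiver (x₀ := x₀) (x₁ := x₁) (a := a) C hdec hg (by linarith) (by linarith) (by linarith) ha0
      (by linarith) hb0 hη0 hmin ?_ hA2
    exact mul_div_cancel₀ _ hη0.ne'
  · exact hasReachableMemory_runReceiver C hdec hg0 hb0.ne' ⟨d₀, hd₀⟩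
  · exact fun k => isImplementable_runReceiver C hdec k

theorem exists_forall_lt_capacityFactor (hserve : ServesEachQueue Sch) (hSch : Sch.Nonempty)
    {C : Channel X Y} (hC : C.Informative) (hle : ∀ d ∈ Sch, ∀ i, d i ≤ 1) {b : ℝ≥0∞}
    (hb : b < 1) : ∃ v₀ : ℕ, ∀ v, v₀ ≤ v → ∀ k, b < capacityFactor Sch C k v := by
  obtain ⟨ρ, hbρ, hρ1⟩ := ENNReal.lt_iff_exists_nnreal_btwn.1 hb
  have hρ1' : ρ < 1 := by exact_mod_cast hρ1
  obtain ⟨ρ₀, h1, h2⟩ := exists_between hρ1'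
  obtain ⟨v₀, hv₀⟩ := exists_receiver_achieves hSch hC ρ₀.2 (by exact_mod_cast h2 : (ρ₀ : ℝ) < 1)
  refine ⟨v₀, fun v hv k => hbρ.trans_le ?_⟩
  obtain ⟨ψ, hach, hreach, himp⟩ := hv₀ v hv
  obtain ⟨φ, hφ⟩ := exists_policy_of_achieves C ψ hserve hSch ρ.2 (NNReal.coe_lt_coe.2 h1) hach
    hreach (himp k) fun d hd i => by
      have h3 : (d i : ℝ) ≤ 1 := by exact_mod_cast hle d hd i
      have h4 : (ρ : ℝ) ≤ 1 := by exact_mod_cast hρ1'.le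
      exact mul_le_one₀ h4 (Nat.cast_nonneg _) h3
  exact le_capacityFactor hφ

theorem tendsto_one_of_eventually_lt {f : ℕ → ℝ≥0∞} (hle : ∀ n, f n ≤ 1)
    (h : ∀ b < 1, ∃ n₀ : ℕ, ∀ n, n₀ ≤ n → b < f n) : Tendsto f atTop (𝓝 1) :=
  tendsto_order.2 ⟨fun b hb => eventually_atTop.2 (h b hb), fun _ hb =>
    Eventually.of_forall fun n => (hle n).trans_lt hb⟩

end RunReceiverCapacity

end SPII

/-! ### Assembly of the four items -/

theorem theorem1 {N : ℕ} (Sch : Finset (Fin N → ℕ))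
    (hmono : SPII.IsMonotone Sch) (hserve : SPII.ServesEachQueue Sch)
    (hmax : SPII.HasTwoMaximal Sch)
    {X Y : Type*} [Fintype X] [Fintype Y] (C : SPII.Channel X Y) (hC : C.Informative) :
    -- memoryless receiver
    (∀ k : ℕ∞, SPII.IsCapacityFactor Sch C k 0 (SPII.capacityFactor Sch C 0 0)) ∧
    -- receiver with finite memory
    (∀ v : ℕ, 1 ≤ v → ∀ k : ℕ∞, (SPII.memoryThreshold Sch X : ℕ∞) ≤ k →
      SPII.IsCapacityFactor Sch C k v
        (SPII.capacityFactor Sch C (SPII.memoryThreshold Sch X) v)) ∧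
    -- receiver with infinite memory; all vectors of `Λ` have to be rates of Bernoulli arrivals
    ((∀ d ∈ Sch, ∀ i, d i ≤ 1) → ∀ k : ℕ∞, SPII.IsCapacityFactor Sch C k ⊤ 1) ∧
    -- noisy channel
    ((∃ ε : ℝ, 0 < ε ∧ ε < 1 ∧ C.PositivelyMajorizing ε) →
      ∀ v : ℕ, ∀ k : ℕ∞, ∃ r : ENNReal, r < 1 ∧ SPII.IsCapacityFactor Sch C k v r) := by
  classical
  have : Nonempty X := ⟨hC.choose⟩
  have hSch : Sch.Nonempty := by
    obtain ⟨d, hd, _⟩ := hmax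
    exact ⟨d, hd.1⟩
  have hN : 0 < N := by
    obtain ⟨d₁, _, d₂, _, hne⟩ := hmax
    rcases Nat.eq_zero_or_pos N with rfl | h
    · exact absurd (Subsingleton.elim d₁ d₂) hne
    · exact h
  set K := SPII.memoryThreshold Sch X with hK
  have hcard : ∀ k, K ≤ k → Fintype.card X ≤ 2 ^ k := fun k hk =>
    (SPII.card_le_two_pow_memoryThreshold hmax).trans (Nat.pow_le_pow_right two_pos hk)
  have hmem : ∀ v k, K ≤ k → SPII.capacityFactor Sch C k v = SPII.capacityFactor Sch C K v :=
    fun v k hk => SPII.capacityFactor_eq_of_card_le hserve hSch (hcard k hk) (hcard K le_rfl)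
  have h0 : ∀ k, SPII.capacityFactor Sch C k 0 = SPII.capacityFactor Sch C 0 0 := fun k =>
    SPII.capacityFactor_memoryless_eq hserve hSch k 0
  refine ⟨fun k => ?_, fun v _ k hk => ?_, fun hle k => ?_, ?_⟩
  · exact SPII.isCapacityFactor_of_forall_ge (K := 0) (fun k _ => h0 k) (zero_le (a := k))
  · exact SPII.isCapacityFactor_of_forall_ge (hmem v) hk
  · have hlim : ∀ k : ℕ, Filter.Tendsto (fun v : ℕ => SPII.capacityFactor Sch C k v) Filter.atTop
        (nhds 1) := fun k => SPII.tendsto_one_of_eventually_lt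
      (fun v => SPII.capacityFactor_le_one hserve hSch hN k v) fun b hb =>
        (SPII.exists_forall_lt_capacityFactor hserve hSch hC hle hb).imp fun _ h v hv => h v hv k
    induction k with
    | top =>
      -- For each `v` the sequence in `k` is constant from `K` on, so the inner limit is its value
      -- at `K`.
      exact ⟨⟨fun _ => 1, hlim, tendsto_const_nhds⟩, fun v => SPII.capacityFactor Sch C K v,
        fun v => SPII.isCapacityFactor_of_forall_ge (k := ⊤) (hmem v) le_top, hlim K⟩
    | coe k => exact hlim k
  · rintro ⟨ε, hε0, hε1, hmaj⟩ v k
    obtain ⟨c, hc, hprob⟩ := hmaj.exists_le_prob hε0 hε1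
    obtain ⟨b, hb1, hb⟩ := SPII.exists_capacityFactor_le hserve hN hmax hc hprob v
    induction k with
    | top =>
      exact ⟨_, (hb K).trans_lt hb1, SPII.isCapacityFactor_of_forall_ge (hmem v) le_top⟩
    | coe k => exact ⟨_, (hb k).trans_lt hb1, rfl⟩
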